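/- Let $A>0$. At time $0$ a fire occupies the closed disc of radius $A$ about the origin of the plane $\mathbb{C}$, and it spreads at unit speed. A fire fighter moves along a curve $\gamma$ at constant speed $v>1$, and the part $\gamma([0,t])$ built up to time $t$ is a barrier that the fire cannot cross; that is, the region $R(t)$ burned up to time $t$ consists of all endpoints $x(s)$, $0\le s\le t$, of $1$-Lipschitz paths $x:[0,s]\to\mathbb{C}$ with $|x(0)|\le A$ and $x(r)\notin\gamma([0,r])$ for all $r\in[0,s]$. If the fighter stops at time $T$, the barrier is $\gamma([0,\min(r,T)])$ at every time $r$. The barrier curve $\mathrm{FF}_v$ (built up to time $T>0$) is a continuously differentiable curve $\gamma:[0,T]\to\mathbb{C}$, injective on $[0,T)$, with $\gamma(0)=A$, $|\gamma'|=v$, starting counterclockwise ($\operatorname{Im}\gamma'(0)>0$), such that the fighter is always on the boundary of the expanding fire, $\gamma(t)\in\partial R(t)$ for all $t\in[0,T)$. For $v>1$ put $\alpha=\arccos(1/v)$, $s=e^{(2\pi+\alpha)\cot\alpha}$ and $w=(2\pi+\alpha)/\sin\alpha$. Theorem. There is exactly one speed $v_c>1$ with $s/w=e$, and $2.6144\le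 v_c<2.6145$. For all $A>0$ and all $v>v_c$ the curve $\mathrm{FF}_v$ closes on itself and contains the fire: there are a time $T>0$ and a curve $\gamma$ that is $\mathrm{FF}_v$ built up to time $T$, such that $\gamma(T)\in\gamma([0,T))$ and the set $\bigcup_{t\ge 0}R(t)$ of all points that ever burn (with the fighter stopping at time $T$) is bounded. This curve is unique: if $\gamma'$ is $\mathrm{FF}_v$ built up to a time $T'$, then $T'\le T$ and $\gamma'=\gamma$ on $[0,T']$. -/

import Mathlib

/-- The part of the barrier that exists at time `t`: at each time `s ∈ [0, T]` the fighter is at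
`γ s`, and at time `T` she stops building. -/
def barrierAt (γ : ℝ → ℂ) (T t : ℝ) : Set ℂ :=
  γ '' Set.Icc 0 (min t T)

/-- A trajectory of the fire during `[0, s]`: it starts in the initial disc of radius `A` about the
origin, moves at speed at most `1`, and at no time is on the barrier that exists at that time. -/
structure IsFirePath (A : ℝ) (γ : ℝ → ℂ) (T s : ℝ) (x : ℝ → ℂ) : Prop where
  start : ‖x 0‖ ≤ A
  speed_le : LipschitzOnWith 1 x (Set.Icc 0 s)
  avoids : ∀ r ∈ Set.Icc 0 s, x r ∉ barrierAt γ T r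

/-- The region burned up to time `t`: all points that the fire reaches at some time `s ≤ t`. -/
def burned (A : ℝ) (γ : ℝ → ℂ) (T t : ℝ) : Set ℂ :=
  {z | ∃ s ∈ Set.Icc 0 t, ∃ x : ℝ → ℂ, IsFirePath A γ T s x ∧ x s = z}

/-- `γ`, restricted to `[0, T]`, is the barrier curve `FF_v` as built up to time `T`, for a fire
with initial disc of radius `A` about the origin: starting at the boundary point `A` in
counterclockwise direction, the fighter moves on a continuously differentiable curve at constant
speed `v`, and as long as the curve has not closed on itself she is always on the boundary of the
expanding fire. As points of the barrier built before the fire's arrival do not burn while points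
that the fire has already passed are interior to the burned region, `on_front` says that at each
point of the curve fighter and fire arrive simultaneously. -/
structure IsFFCurve (A v T : ℝ) (γ : ℝ → ℂ) : Prop where
  pos : 0 < T
  start : γ 0 = (A : ℂ)
  smooth : ContDiffOn ℝ 1 γ (Set.Icc 0 T)
  speed : ∀ t ∈ Set.Icc 0 T, ‖derivWithin γ (Set.Icc 0 T) t‖ = v
  counterclockwise : 0 < (derivWithin γ (Set.Icc 0 T) 0).im
  simple : Set.InjOn γ (Set.Ico 0 T)
  on_front : ∀ t ∈ Set.Ico 0 T, γ t ∈ frontier (burned A γ T t)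

/-- The curve meets itself at time `T`. -/
def ClosesAt (γ : ℝ → ℂ) (T : ℝ) : Prop :=
  γ T ∈ γ '' Set.Ico 0 T

/-- The barrier `γ`, completed at time `T`, contains the fire: all that ever burns is bounded. -/
def ContainsFire (A : ℝ) (γ : ℝ → ℂ) (T : ℝ) : Prop :=
  Bornology.IsBounded (⋃ t ∈ Set.Ici (0 : ℝ), burned A γ T t)

/-- With `α = arccos (1 / v)`, the quotient `s / w` of `s = exp ((2π + α) cot α)` and
`w = (2π + α) / sin α`. -/
noncomputable def speedRatio (v : ℝ) : ℝ :=
  Real.exp ((2 * Real.pi + Real.arccos (1 / v)) *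
      (Real.cos (Real.arccos (1 / v)) / Real.sin (Real.arccos (1 / v)))) /
    ((2 * Real.pi + Real.arccos (1 / v)) / Real.sin (Real.arccos (1 / v)))

/-- `c` is the critical speed: the only speed `> 1` at which `s / w = e` holds. -/
def IsCriticalSpeed (c : ℝ) : Prop :=
  1 < c ∧ speedRatio c = Real.exp 1 ∧ ∀ v : ℝ, 1 < v → speedRatio v = Real.exp 1 → v = c

/-!
The barrier curve is described by a taut string. While the fire burns around the barrier, it reaches
a point fastest by following the outer side of the curve up to some point and then going straight
along the tangent there. The point of this string at which the fighter meets the fire is the end of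
the free string. Unwound directions `φ` of the string serve as the parameter: the fighter has heading
`φ + α` with `cos α = 1 / v`, because her velocity must have component `1` in the direction of the
string, so the string touches the curve where it had parameter `φ - (2π + α)`. This is the structure
`StringSpiral`; the initial segment from the origin to `A` is added to the curve, which makes the
logarithmic spiral of the first turn a special case.

*Closing.* The length `F` of the free string satisfies the linear delay equation
`F' = cot α F - F(· - τ) / sin α` with `τ = 2π + α`. Without its first term, that is, for
`G = F exp (-cot α x)`, it reads `G' = -p G(· - τ)` with `p τ = w / s`. When `p τ > 1 / e` the rate of
decay of a positive solution would grow without bound (`not_forall_pos_of_delay`). Hence for `s / w < e`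
the string shrinks to length `0`, and there the spiral meets its own previous turn
(`exists_stringSpiral`). As `s / w` is decreasing in `v`, the condition says that `v` exceeds the
critical speed (`exists_criticalSpeed`, `IsCriticalSpeed.speedRatio_lt`).

*The fire.* The increments of the curve are positive combinations of its headings (`turning`). This
form of convexity implies that distinct strings are disjoint (`string_unique`), so that the curve is
simple and the region swept by the strings, with the arrival time along curve and string, is well
described by string coordinates (`exists_chart`), in which the arrival time is `1`-Lipschitz. The
fire therefore stays in the swept region and is never early (`reached_of_path`). Conversely, by
following the barrier at a small distance, it is on time up to an arbitrarily small delay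
(`exists_path`). Hence the spiral is a barrier curve and, as the swept region is bounded, contains
the fire (`isFFCurve`, `containsFire`).

*Uniqueness.* Let a barrier curve agree with the spiral until time `t₁`. Near the fighter the arrival
time in string coordinates then equals the time along the curve (`exists_chart_time_eq`): earlier
arrival is excluded by `reached_of_path`, and later presence of the fighter would let the fire pass her,
as a curve of speed `v > 1` does not obstruct the way back to points that have been passed. The
gradient of the arrival time is the direction of the string, hence the velocity of the curve is
determined by its position (`derivWithin_eq_dir`), and uniqueness for differential equations extends
the agreement beyond `t₁`.
-/


/-! ### The critical speed -/

theorem abs_sin_sub_taylor_le {x : ℝ} (hx : |x| ≤ 1) :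
    |Real.sin x - (x - x ^ 3 / 6 + x ^ 5 / 120 - x ^ 7 / 5040)| ≤ |x| ^ 9 / 300000 := by
  have hn : ‖(x : ℂ) * Complex.I‖ = |x| := by simp
  have h := Complex.exp_bound (x := x * Complex.I) (by rw [hn]; exact hx) (n := 9) (by norm_num)
  have h2 := (Complex.abs_im_le_norm _).trans h
  rw [hn] at h2
  have e1 : (Complex.exp (x * Complex.I) -
      ∑ m ∈ Finset.range 9, ((x : ℂ) * Complex.I) ^ m / (m.factorial : ℂ)).im =
      Real.sin x - (x - x ^ 3 / 6 + x ^ 5 / 120 - x ^ 7 / 5040) := by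
    have hI3 : Complex.I ^ 3 = -Complex.I := Complex.I_pow_three
    have hI4 : Complex.I ^ 4 = 1 := Complex.I_pow_four
    have : ∑ m ∈ Finset.range 9, ((x : ℂ) * Complex.I) ^ m / (m.factorial : ℂ) =
        ((1 - x ^ 2 / 2 + x ^ 4 / 24 - x ^ 6 / 720 + x ^ 8 / 40320 : ℝ) : ℂ) +
          ((x - x ^ 3 / 6 + x ^ 5 / 120 - x ^ 7 / 5040 : ℝ) : ℂ) * Complex.I := by
      have hI5 : Complex.I ^ 5 = Complex.I := by
        rw [show (5 : ℕ) = 4 + 1 from rfl, pow_succ, hI4, one_mul]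
      have hI6 : Complex.I ^ 6 = -1 := by
        rw [show (6 : ℕ) = 4 + 2 from rfl, pow_add, hI4, one_mul, Complex.I_sq]
      have hI7 : Complex.I ^ 7 = -Complex.I := by
        rw [show (7 : ℕ) = 4 + 3 from rfl, pow_add, hI4, one_mul, hI3]
      have hI8 : Complex.I ^ 8 = 1 := by
        rw [show (8 : ℕ) = 4 * 2 from rfl, pow_mul, hI4, one_pow]
      simp only [Finset.sum_range_succ, Finset.sum_range_zero, Nat.factorial, mul_pow, hI3, hI4,
        hI5, hI6, hI7, hI8, Complex.I_sq]
      push_cast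
      ring
    rw [this, Complex.sub_im, Complex.exp_ofReal_mul_I_im, Complex.add_im, Complex.ofReal_im,
      Complex.im_ofReal_mul, Complex.I_im]
    ring
  rw [e1] at h2
  refine h2.trans ?_
  have : ((Nat.succ 9 : ℕ) : ℝ) * (((Nat.factorial 9 : ℕ) : ℝ) * (9 : ℕ))⁻¹ ≤ 1 / 300000 := by
    norm_num [Nat.factorial]
  calc _ ≤ |x| ^ 9 * (1 / 300000) := by gcongr
    _ = _ := by ring

/-- The logarithm of `s / w` as a function of the angle `α`. -/
noncomputable def logRatio (a : ℝ) : ℝ :=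
  (2 * Real.pi + a) * (Real.cos a / Real.sin a) + Real.log (Real.sin a) -
    Real.log (2 * Real.pi + a)

theorem hasDerivAt_logRatio {a : ℝ} (h0 : 0 < a) (h1 : a < Real.pi) :
    HasDerivAt logRatio
      (2 * (Real.cos a / Real.sin a) - (2 * Real.pi + a) / Real.sin a ^ 2 -
        1 / (2 * Real.pi + a)) a := by
  have hs : 0 < Real.sin a := Real.sin_pos_of_pos_of_lt_pi h0 h1
  have hp : 0 < 2 * Real.pi + a := by positivity
  have d1 : HasDerivAt (fun a : ℝ => 2 * Real.pi + a) 1 a := (hasDerivAt_id a).const_add _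
  have d2 := (Real.hasDerivAt_cos a).div (Real.hasDerivAt_sin a) hs.ne'
  have d := ((d1.mul d2).add ((Real.hasDerivAt_sin a).log hs.ne')).sub (d1.log hp.ne')
  refine d.congr_deriv ?_
  have := Real.sin_sq_add_cos_sq a
  have e : -Real.sin a * Real.sin a - Real.cos a * Real.cos a = -1 := by linarith
  rw [e]
  simp only [Pi.div_apply]
  ring

theorem strictAntiOn_logRatio : StrictAntiOn logRatio (Set.Ioo 0 Real.pi) := by
  refine strictAntiOn_of_deriv_neg (convex_Ioo _ _) ?_ ?_
  · intro a ha
    exact (hasDerivAt_logRatio ha.1 ha.2).continuousAt.continuousWithinAt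
  · intro a ha
    rw [interior_Ioo] at ha
    rw [(hasDerivAt_logRatio ha.1 ha.2).deriv]
    have hs : 0 < Real.sin a := Real.sin_pos_of_pos_of_lt_pi ha.1 ha.2
    have hpi := Real.pi_gt_three
    have ha0 := ha.1
    have h1 : 0 < 1 / (2 * Real.pi + a) := by positivity
    have h2 : 2 * (Real.cos a / Real.sin a) < (2 * Real.pi + a) / Real.sin a ^ 2 := by
      have e : 2 * (Real.cos a / Real.sin a) =
          2 * Real.cos a * Real.sin a / Real.sin a ^ 2 := by
        field_simp
      rw [e]
      gcongr
      nlinarith [Real.sin_sq_add_cos_sq a, sq_nonneg (Real.cos a - Real.sin a)]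
    linarith

theorem arccos_one_div_mem {v : ℝ} (hv : 1 < v) :
    Real.arccos (1 / v) ∈ Set.Ioo 0 (Real.pi / 2) := by
  have h0 : 0 < 1 / v := by positivity
  have h1 : 1 / v < 1 := by rw [div_lt_one (by linarith)]; exact hv
  exact ⟨Real.arccos_pos.2 h1, Real.arccos_lt_pi_div_two.2 h0⟩

theorem cos_arccos_one_div {v : ℝ} (hv : 1 < v) : Real.cos (Real.arccos (1 / v)) = 1 / v := by
  have h0 : 0 < 1 / v := by positivity
  have h1 : 1 / v < 1 := by rw [div_lt_one (by linarith)]; exact hv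
  exact Real.cos_arccos (by linarith) h1.le

theorem speedRatio_eq_exp {v : ℝ} (hv : 1 < v) :
    speedRatio v = Real.exp (logRatio (Real.arccos (1 / v))) := by
  obtain ⟨h0, h1⟩ := arccos_one_div_mem hv
  set a := Real.arccos (1 / v) with ha
  have hs : 0 < Real.sin a := Real.sin_pos_of_pos_of_lt_pi h0 (by linarith [Real.pi_pos])
  have hp : 0 < 2 * Real.pi + a := by positivity
  rw [speedRatio, ← ha, logRatio, Real.exp_sub, Real.exp_add, Real.exp_log hs, Real.exp_log hp]
  field_simp

theorem speedRatio_strictAntiOn : StrictAntiOn speedRatio (Set.Ioi 1) := by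
  intro v hv w hw hvw
  have hv : 1 < v := hv
  have hw : 1 < w := hw
  rw [speedRatio_eq_exp hv, speedRatio_eq_exp hw, Real.exp_lt_exp]
  have m1 := arccos_one_div_mem hv
  have m2 := arccos_one_div_mem hw
  have hpi := Real.pi_pos
  refine strictAntiOn_logRatio ⟨m1.1, by linarith [m1.2]⟩ ⟨m2.1, by linarith [m2.2]⟩ ?_
  have h0 : 0 < 1 / w := by positivity
  have h1 : 1 / v < 1 := by rw [div_lt_one (by linarith)]; exact hv
  exact Real.arccos_lt_arccos (by linarith) (by gcongr) h1.le

theorem continuousOn_speedRatio : ContinuousOn speedRatio (Set.Ioi 1) := by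
  refine ContinuousOn.congr (f := fun v => Real.exp (logRatio (Real.arccos (1 / v)))) ?_
    fun v hv => speedRatio_eq_exp hv
  intro v hv
  have hv : 1 < v := hv
  have m := arccos_one_div_mem hv
  have c1 : ContinuousAt (fun v : ℝ => Real.arccos (1 / v)) v :=
    Real.continuous_arccos.continuousAt.comp
      (continuousAt_const.div continuousAt_id (by positivity))
  have c2 : ContinuousAt logRatio (Real.arccos (1 / v)) :=
    (hasDerivAt_logRatio m.1 (by linarith [m.2, Real.pi_pos])).continuousAt
  exact (Real.continuous_exp.continuousAt.comp
    (ContinuousAt.comp (f := fun v : ℝ => Real.arccos (1 / v)) c2 c1)).continuousWithinAt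

theorem sin_arccos_one_div {v : ℝ} : Real.sin (Real.arccos (1 / v)) = √(1 - (1 / v) ^ 2) :=
  Real.sin_arccos _

theorem arccos_one_div_le {v b : ℝ} (h0 : 0 ≤ b) (h1 : b ≤ 1) (h : Real.sin b ≤ 1 / v) :
    Real.arccos (1 / v) ≤ Real.pi / 2 - b := by
  have : Real.arccos (Real.sin b) = Real.pi / 2 - b := by
    rw [← Real.cos_pi_div_two_sub, Real.arccos_cos]
    · linarith [Real.pi_gt_three]
    · linarith [Real.pi_pos]
  rw [← this]
  exact Real.arccos_le_arccos h

theorem le_arccos_one_div {v b : ℝ} (h0 : 0 ≤ b) (h1 : b ≤ 1) (h : 1 / v ≤ Real.sin b) :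
    Real.pi / 2 - b ≤ Real.arccos (1 / v) := by
  have : Real.arccos (Real.sin b) = Real.pi / 2 - b := by
    rw [← Real.cos_pi_div_two_sub, Real.arccos_cos]
    · linarith [Real.pi_gt_three]
    · linarith [Real.pi_pos]
  rw [← this]
  exact Real.arccos_le_arccos h

/-- Since `cos α = 1 / 2.6144`, the angle `α` is enclosed by bounding the sine of its complement
with a Taylor polynomial. -/
theorem exp_one_le_speedRatio : Real.exp 1 ≤ speedRatio 2.6144 := by
  have hv : (1 : ℝ) < 2.6144 := by norm_num
  have hpi1 := Real.pi_gt_d6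
  have hpi2 := Real.pi_lt_d6
  set a := Real.arccos (1 / 2.6144) with ha
  have hc : Real.cos a = 1 / 2.6144 := cos_arccos_one_div hv
  have hs : Real.sin a = √(1 - (1 / 2.6144) ^ 2) := sin_arccos_one_div
  have hs0 : 0.923956 ≤ Real.sin a := by
    rw [hs]; exact Real.le_sqrt_of_sq_le (by norm_num)
  have hs1 : Real.sin a ≤ 0.923957 := by
    rw [hs]; exact (Real.sqrt_le_left (by norm_num)).2 (by norm_num)
  have a0 : Real.pi / 2 - 0.392499 ≤ a := by
    refine le_arccos_one_div (by norm_num) (by norm_num) ?_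
    have := (abs_le.1 (abs_sin_sub_taylor_le (x := 0.392499) (by norm_num [abs_le]))).1
    rw [abs_of_pos (by norm_num)] at this
    norm_num at this ⊢
    linarith
  have a1 : a ≤ Real.pi / 2 - 0.392495 := by
    refine arccos_one_div_le (by norm_num) (by norm_num) ?_
    have := (abs_le.1 (abs_sin_sub_taylor_le (x := 0.392495) (by norm_num [abs_le]))).2
    rw [abs_of_pos (by norm_num)] at this
    norm_num at this ⊢
    linarith
  have hx0 : 7.46148 ≤ 2 * Real.pi + a := by linarith
  have hx1 : 2 * Real.pi + a ≤ 7.46149 := by linarith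
  rw [speedRatio, ← ha, le_div_iff₀ (by positivity)]
  have hk : (0.413976 : ℝ) ≤ Real.cos a / Real.sin a := by
    rw [hc, le_div_iff₀ (by linarith)]
    linarith
  have hy : 1 + 1 + 1 + (0.08887 : ℝ) ≤ (2 * Real.pi + a) * (Real.cos a / Real.sin a) := by
    calc (1 + 1 + 1 + 0.08887 : ℝ) ≤ 7.46148 * 0.413976 := by norm_num
      _ ≤ _ := by gcongr
  have hw : (2 * Real.pi + a) / Real.sin a ≤ 8.0756 := by
    rw [div_le_iff₀ (by linarith)]
    linarith
  have he := Real.exp_one_gt_d9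
  have h5 : (1.09293 : ℝ) ≤ Real.exp 0.08887 := by
    have := Real.sum_le_exp_of_nonneg (x := 0.08887) (by norm_num) 5
    norm_num [Finset.sum_range_succ, Nat.factorial] at this ⊢
    linarith
  calc Real.exp 1 * ((2 * Real.pi + a) / Real.sin a)
      ≤ Real.exp 1 * (2.7182818283 * 2.7182818283 * 1.09293) := by
        gcongr
        refine hw.trans ?_
        norm_num
    _ ≤ Real.exp 1 * (Real.exp 1 * Real.exp 1 * Real.exp 0.08887) := by gcongr
    _ = Real.exp (1 + 1 + 1 + 0.08887) := by rw [Real.exp_add, Real.exp_add, Real.exp_add]; ring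
    _ ≤ _ := Real.exp_le_exp.2 hy

theorem speedRatio_lt_exp_one : speedRatio 2.6145 < Real.exp 1 := by
  have hv : (1 : ℝ) < 2.6145 := by norm_num
  have hpi1 := Real.pi_gt_d6
  have hpi2 := Real.pi_lt_d6
  set a := Real.arccos (1 / 2.6145) with ha
  have hc : Real.cos a = 1 / 2.6145 := cos_arccos_one_div hv
  have hs : Real.sin a = √(1 - (1 / 2.6145) ^ 2) := sin_arccos_one_div
  have hs0 : 0.923962 ≤ Real.sin a := by
    rw [hs]; exact Real.le_sqrt_of_sq_le (by norm_num)
  have hs1 : Real.sin a ≤ 0.923963 := by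
    rw [hs]; exact (Real.sqrt_le_left (by norm_num)).2 (by norm_num)
  have a0 : Real.pi / 2 - 0.392484 ≤ a := by
    refine le_arccos_one_div (by norm_num) (by norm_num) ?_
    have := (abs_le.1 (abs_sin_sub_taylor_le (x := 0.392484) (by norm_num [abs_le]))).1
    rw [abs_of_pos (by norm_num)] at this
    norm_num at this ⊢
    linarith
  have a1 : a ≤ Real.pi / 2 - 0.392480 := by
    refine arccos_one_div_le (by norm_num) (by norm_num) ?_
    have := (abs_le.1 (abs_sin_sub_taylor_le (x := 0.392480) (by norm_num [abs_le]))).2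
    rw [abs_of_pos (by norm_num)] at this
    norm_num at this ⊢
    linarith
  have hx0 : 7.461494 ≤ 2 * Real.pi + a := by linarith
  have hx1 : 2 * Real.pi + a ≤ 7.461505 := by linarith
  rw [speedRatio, ← ha, div_lt_iff₀ (by positivity)]
  have hk : Real.cos a / Real.sin a ≤ 0.413959 := by
    rw [hc, div_le_iff₀ (by linarith)]
    linarith
  have hk0 : 0 ≤ Real.cos a / Real.sin a := by rw [hc]; positivity
  have hy : (2 * Real.pi + a) * (Real.cos a / Real.sin a) ≤ 1 + 1 + 1 + (0.08876 : ℝ) := by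
    calc _ ≤ (7.461505 : ℝ) * 0.413959 := by gcongr
      _ ≤ _ := by norm_num
  have hw : 8.0755 ≤ (2 * Real.pi + a) / Real.sin a := by
    rw [le_div_iff₀ (by linarith)]
    linarith
  have he := Real.exp_one_lt_d9
  have h5 : Real.exp 0.08876 ≤ 1.09282 := by
    have := (abs_le.1 (Real.exp_bound (x := 0.08876) (by norm_num [abs_le]) (n := 5)
      (by norm_num))).2
    rw [abs_of_pos (by norm_num)] at this
    norm_num [Finset.sum_range_succ, Nat.factorial] at this ⊢
    linarith
  calc Real.exp ((2 * Real.pi + a) * (Real.cos a / Real.sin a))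
      ≤ Real.exp (1 + 1 + 1 + 0.08876) := Real.exp_le_exp.2 hy
    _ = Real.exp 1 * (Real.exp 1 * Real.exp 1 * Real.exp 0.08876) := by
        rw [Real.exp_add, Real.exp_add, Real.exp_add]; ring
    _ ≤ Real.exp 1 * (2.7182818286 * 2.7182818286 * 1.09282) := by gcongr
    _ < Real.exp 1 * 8.0755 := by
        gcongr
        norm_num
    _ ≤ _ := by gcongr

theorem exists_criticalSpeed :
    ∃ vc : ℝ, IsCriticalSpeed vc ∧ 2.6144 ≤ vc ∧ vc < 2.6145 := by
  have hsub : Set.Icc (2.6144 : ℝ) 2.6145 ⊆ Set.Ioi 1 := fun x hx => by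
    have := hx.1
    norm_num at this
    exact lt_of_lt_of_le (by norm_num) this
  obtain ⟨c, hc, hce⟩ := intermediate_value_Icc' (by norm_num : (2.6144 : ℝ) ≤ 2.6145)
    (continuousOn_speedRatio.mono hsub)
    ⟨speedRatio_lt_exp_one.le, exp_one_le_speedRatio⟩
  refine ⟨c, ⟨hsub hc, hce, fun v hv hve => ?_⟩, hc.1, lt_of_le_of_ne hc.2 fun h => ?_⟩
  · exact speedRatio_strictAntiOn.injOn hv (hsub hc) (hve.trans hce.symm)
  · rw [h] at hce
    exact absurd hce speedRatio_lt_exp_one.ne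

theorem IsCriticalSpeed.speedRatio_lt {c v : ℝ} (hc : IsCriticalSpeed c) (hv : c < v) :
    speedRatio v < Real.exp 1 := by
  rw [← hc.2.1]
  exact speedRatio_strictAntiOn hc.1 (hc.1.trans hv) hv

/-! ### Right derivatives and oscillation of a delay equation -/

theorem le_of_hasDerivWithinAt_nonpos {f f' : ℝ → ℝ} {a b : ℝ} (hab : a ≤ b)
    (hc : ContinuousOn f (Set.Icc a b))
    (hd : ∀ x ∈ Set.Ico a b, HasDerivWithinAt f (f' x) (Set.Ici x) x)
    (hn : ∀ x ∈ Set.Ico a b, f' x ≤ 0) : f b ≤ f a :=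
  image_le_of_deriv_right_le_deriv_boundary hc hd (B := fun _ => f a) (B' := fun _ => 0) le_rfl
    continuousOn_const (fun _ _ => hasDerivWithinAt_const _ _ _) hn (Set.right_mem_Icc.2 hab)

theorem le_of_hasDerivWithinAt_nonneg {f f' : ℝ → ℝ} {a b : ℝ} (hab : a ≤ b)
    (hc : ContinuousOn f (Set.Icc a b))
    (hd : ∀ x ∈ Set.Ico a b, HasDerivWithinAt f (f' x) (Set.Ici x) x)
    (hn : ∀ x ∈ Set.Ico a b, 0 ≤ f' x) : f a ≤ f b := by
  have := le_of_hasDerivWithinAt_nonpos (f := fun x => -f x) (f' := fun x => -f' x) hab hc.neg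
    (fun x hx => (hd x hx).neg) (fun x hx => by linarith [hn x hx])
  linarith

/-- Every positive solution of `G' = -p G(· - τ)` dies out when `p τ > 1 / e`: the decay rate
`λ = -G' / G` satisfies `λ ≥ p e ^ (λ τ) ≥ (p τ e) λ` one delay later, hence grows beyond all
bounds, whereas two half-delay steps bound `G (x - τ) / G x`. -/
theorem not_forall_pos_of_delay {G : ℝ → ℝ} {p τ a : ℝ} (hp : 0 < p) (hτ : 0 < τ)
    (hq : 1 < p * τ * Real.exp 1) (hc : ContinuousOn G (Set.Ici a))
    (hd : ∀ x, a + τ ≤ x → HasDerivWithinAt G (-(p * G (x - τ))) (Set.Ici x) x)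
    (hpos : ∀ x, a ≤ x → 0 < G x) : False := by
  have anti : ∀ x y, a + τ ≤ x → x ≤ y → G y ≤ G x := fun x y hx hxy =>
    le_of_hasDerivWithinAt_nonpos hxy (hc.mono fun z hz => by
      have := hz.1; simp only [Set.mem_Ici]; linarith)
      (fun z hz => hd z (hx.trans hz.1))
      (fun z hz => by
        have := hpos (z - τ) (by linarith [hz.1])
        have := mul_pos hp this
        linarith)
  -- `G` is decreasing, so that over half a delay it loses at least `κ` times an earlier value
  set κ := p * (τ / 2) with hκ
  have hκ0 : 0 < κ := by positivity
  have half : ∀ y, a + 3 * τ ≤ y → κ * G (y - τ) ≤ G (y - τ / 2) := by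
    intro y hy
    have := le_of_hasDerivWithinAt_nonpos (a := y - τ / 2) (b := y)
      (f := fun s => G s + p * G (y - τ) * s)
      (f' := fun s => -(p * G (s - τ)) + p * G (y - τ) * 1) (by linarith)
      ((hc.mono fun z hz => by
        have := hz.1; simp only [Set.mem_Ici]; linarith).add (by fun_prop))
      (fun z hz => (hd z (by linarith [hz.1])).add
        ((hasDerivWithinAt_id z _).const_mul _))
      (fun z hz => by
        have := anti (z - τ) (y - τ) (by linarith [hz.1]) (by linarith [hz.2])
        have := mul_le_mul_of_nonneg_left this hp.le
        linarith)
    have h0 := hpos y (by linarith)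
    have : p * G (y - τ) * y - p * G (y - τ) * (y - τ / 2) = κ * G (y - τ) := by
      rw [hκ]; ring
    linarith
  have full : ∀ x, a + 3 * τ ≤ x → κ ^ 2 * G (x - τ) ≤ G x := by
    intro x hx
    have h1 := half x hx
    have h2 := half (x + τ / 2) (by linarith)
    rw [show x + τ / 2 - τ = x - τ / 2 by ring, show x + τ / 2 - τ / 2 = x by ring] at h2
    calc κ ^ 2 * G (x - τ) = κ * (κ * G (x - τ)) := by ring
      _ ≤ κ * G (x - τ / 2) := by gcongr
      _ ≤ _ := h2
  have rate : ∀ n : ℕ, ∃ b, a + 3 * τ ≤ b ∧ ∀ x, b ≤ x →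
      (p * τ * Real.exp 1) ^ n * p * G x ≤ p * G (x - τ) := by
    intro n
    induction n with
    | zero =>
      refine ⟨a + 3 * τ, le_rfl, fun x hx => ?_⟩
      have := anti (x - τ) x (by linarith) (by linarith)
      simpa using mul_le_mul_of_nonneg_left this hp.le
    | succ n ih =>
      obtain ⟨b, hb, h⟩ := ih
      refine ⟨b + τ, by linarith, fun x hx => ?_⟩
      set l := (p * τ * Real.exp 1) ^ n * p with hl
      have hdec : Real.exp (l * x) * G x ≤ Real.exp (l * (x - τ)) * G (x - τ) := by
        refine le_of_hasDerivWithinAt_nonpos (f := fun s => Real.exp (l * s) * G s)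
          (f' := fun s => Real.exp (l * s) * (l * 1) * G s +
            Real.exp (l * s) * (-(p * G (s - τ)))) (by linarith) ?_ ?_ ?_
        · exact ContinuousOn.mul (by fun_prop) (hc.mono fun z hz => by
            have := hz.1; simp only [Set.mem_Ici]; linarith)
        · intro s hs
          exact ((((hasDerivAt_id s).const_mul l).exp).hasDerivWithinAt).mul
            (hd s (by linarith [hs.1]))
        · intro s hs
          have h1 := h s (by linarith [hs.1])
          have h2 := Real.exp_pos (l * s)
          nlinarith
      have hG : Real.exp (l * τ) * G x ≤ G (x - τ) := by
        have e : Real.exp (l * x) = Real.exp (l * (x - τ)) * Real.exp (l * τ) := by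
          rw [← Real.exp_add]; ring_nf
        rw [e, mul_assoc] at hdec
        exact le_of_mul_le_mul_left hdec (Real.exp_pos _)
      have hexp : Real.exp 1 * (l * τ) ≤ Real.exp (l * τ) := by
        have h1 := Real.add_one_le_exp (l * τ - 1)
        rw [Real.exp_sub, le_div_iff₀ (Real.exp_pos _)] at h1
        linarith
      have hGx := hpos x (by linarith)
      calc (p * τ * Real.exp 1) ^ (n + 1) * p * G x = p * ((Real.exp 1 * (l * τ)) * G x) := by
            rw [hl]; ring
        _ ≤ p * (Real.exp (l * τ) * G x) := by gcongr
        _ ≤ _ := by gcongr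
  obtain ⟨n, hn⟩ := pow_unbounded_of_one_lt (1 / κ ^ 2) hq
  obtain ⟨b, hb, h⟩ := rate n
  have h1 := h b le_rfl
  have h2 := full b hb
  have h3 := hpos b (by linarith)
  have h4 : (p * τ * Real.exp 1) ^ n * p * G b ≤ p * (G b / κ ^ 2) := by
    refine h1.trans ?_
    gcongr
    rw [le_div_iff₀ (by positivity)]
    linarith
  have h5 : (p * τ * Real.exp 1) ^ n ≤ 1 / κ ^ 2 := by
    have : (p * τ * Real.exp 1) ^ n * (p * G b) ≤ 1 / κ ^ 2 * (p * G b) := by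
      calc _ = _ := by ring
        _ ≤ _ := h4
        _ = _ := by ring
    exact le_of_mul_le_mul_right this (by positivity)
  linarith

/-! ### The fundamental solution of the delay equation -/

/-- The `k`-th summand of the fundamental solution of `Y' = c Y - q Y(· - τ)`, supported on
`[k τ, ∞)`. -/
noncomputable def delayTerm (c q τ : ℝ) (k : ℕ) (x : ℝ) : ℝ :=
  if x < k * τ then 0
  else (-q) ^ k * ((x - k * τ) ^ k / (k.factorial : ℝ)) * Real.exp (c * (x - k * τ))

/-- The solution of `Y' = c Y - q Y(· - τ)` with `Y = 0` on the negative axis and `Y 0 = 1`. -/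
noncomputable def delayFun (c q τ x : ℝ) : ℝ :=
  ∑ k ∈ Finset.range (⌊x / τ⌋₊ + 1), delayTerm c q τ k x

section DelayFun

variable {c q τ : ℝ}

theorem delayTerm_of_lt {k : ℕ} {x : ℝ} (h : x < k * τ) : delayTerm c q τ k x = 0 := if_pos h

theorem delayFun_eq_sum (hτ : 0 < τ) {N : ℕ} {x : ℝ} (h : x < N * τ) (hN : 0 < N) :
    delayFun c q τ x = ∑ k ∈ Finset.range N, delayTerm c q τ k x := by
  refine Finset.sum_subset ?_ ?_
  · intro k hk
    rw [Finset.mem_range] at hk ⊢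
    have : ⌊x / τ⌋₊ < N := by
      rw [Nat.floor_lt' hN.ne', div_lt_iff₀ hτ]
      exact h
    omega
  · intro k _ hk
    rw [Finset.mem_range, not_lt] at hk
    refine delayTerm_of_lt ?_
    have := Nat.lt_floor_add_one (x / τ)
    rw [div_lt_iff₀ hτ] at this
    refine this.trans_le ?_
    gcongr
    exact_mod_cast hk

theorem delayFun_of_neg (hτ : 0 < τ) {x : ℝ} (h : x < 0) : delayFun c q τ x = 0 := by
  rw [delayFun_eq_sum hτ (N := 1) (by simpa using h.trans hτ) one_pos]
  simp [delayTerm, h]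

theorem delayFun_of_le (hτ : 0 < τ) {x : ℝ} (h0 : 0 ≤ x) (h : x ≤ τ) :
    delayFun c q τ x = Real.exp (c * x) := by
  have h2 : x < (2 : ℕ) * τ := by push_cast; linarith
  rw [delayFun_eq_sum hτ h2 two_pos, Finset.sum_range_succ, Finset.sum_range_one]
  have e1 : delayTerm c q τ 1 x = 0 := by
    rcases h.lt_or_eq with h | h
    · exact delayTerm_of_lt (by simpa using h)
    · simp [delayTerm, h]
  rw [e1, delayTerm]
  simp [not_lt.2 h0]

theorem hasDerivWithinAt_delayTerm_zero (x : ℝ) :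
    HasDerivWithinAt (delayTerm c q τ 0) (c * delayTerm c q τ 0 x) (Set.Ici x) x := by
  rcases lt_or_ge x 0 with h | h
  · have e : delayTerm c q τ 0 =ᶠ[nhds x] fun _ => 0 := by
      filter_upwards [Iio_mem_nhds h] with y hy
      exact delayTerm_of_lt (by simpa using hy)
    rw [e.self_of_nhds, mul_zero]
    exact ((hasDerivAt_const x (0 : ℝ)).congr_of_eventuallyEq e).hasDerivWithinAt
  · have e : ∀ y ∈ Set.Ici x, delayTerm c q τ 0 y = Real.exp (c * y) := fun y hy => by
      have : ¬ y < 0 := not_lt.2 (h.trans hy)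
      simp [delayTerm, this]
    have d : HasDerivAt (fun y : ℝ => Real.exp (c * y)) (Real.exp (c * x) * (c * 1)) x :=
      ((hasDerivAt_id x).const_mul c).exp
    refine (d.hasDerivWithinAt.congr e (e x Set.self_mem_Ici)).congr_deriv ?_
    rw [e x Set.self_mem_Ici]; ring

theorem hasDerivWithinAt_delayTerm_succ (k : ℕ) (x : ℝ) :
    HasDerivWithinAt (delayTerm c q τ (k + 1))
      (c * delayTerm c q τ (k + 1) x - q * delayTerm c q τ k (x - τ)) (Set.Ici x) x := by
  have hk : ((k + 1 : ℕ) : ℝ) * τ = k * τ + τ := by push_cast; ring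
  rcases lt_or_ge x ((k + 1 : ℕ) * τ) with h | h
  · have e : delayTerm c q τ (k + 1) =ᶠ[nhds x] fun _ => 0 := by
      filter_upwards [Iio_mem_nhds h] with y hy
      exact delayTerm_of_lt hy
    rw [e.self_of_nhds, delayTerm_of_lt (x := x - τ) (k := k) (by linarith)]
    simp only [mul_zero, sub_zero]
    exact ((hasDerivAt_const x (0 : ℝ)).congr_of_eventuallyEq e).hasDerivWithinAt
  · set g : ℝ → ℝ := fun y => (-q) ^ (k + 1) * ((y - (k + 1 : ℕ) * τ) ^ (k + 1) /
      ((k + 1).factorial : ℝ)) * Real.exp (c * (y - (k + 1 : ℕ) * τ)) with hg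
    have e : ∀ y ∈ Set.Ici x, delayTerm c q τ (k + 1) y = g y := fun y hy =>
      if_neg (not_lt.2 (h.trans hy))
    have d0 : HasDerivAt (fun y : ℝ => y - (k + 1 : ℕ) * τ) 1 x := (hasDerivAt_id x).sub_const _
    have d : HasDerivAt g _ x :=
      (((d0.pow (k + 1)).div_const ((k + 1).factorial : ℝ)).const_mul ((-q) ^ (k + 1))).mul
        ((d0.const_mul c).exp)
    refine (d.hasDerivWithinAt.congr e (e x Set.self_mem_Ici)).congr_deriv ?_
    rw [e x Set.self_mem_Ici, delayTerm, if_neg (not_lt.2 (by linarith)), hg]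
    have e2 : x - τ - k * τ = x - (k + 1 : ℕ) * τ := by rw [hk]; ring
    rw [e2]
    simp only [Nat.factorial_succ, Nat.cast_mul]
    have hf : (k.factorial : ℝ) ≠ 0 := by positivity
    have hk1 : ((k + 1 : ℕ) : ℝ) ≠ 0 := by positivity
    simp only [Nat.add_sub_cancel]
    field_simp
    simp only [Pi.pow_apply]
    ring

/-- Right derivatives are taken, because `delayFun` jumps at `0` and has a corner one delay later. -/
theorem hasDerivWithinAt_delayFun (hτ : 0 < τ) (x : ℝ) :
    HasDerivWithinAt (delayFun c q τ)
      (c * delayFun c q τ x - q * delayFun c q τ (x - τ)) (Set.Ici x) x := by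
  obtain ⟨N, hN⟩ := exists_nat_gt (max (x / τ) 0)
  have hN0 : 0 < N := by
    have : (0 : ℝ) < N := (le_max_right _ _).trans_lt hN
    exact_mod_cast this
  have hxN : x < N * τ := by
    rw [← div_lt_iff₀ hτ]; exact (le_max_left _ _).trans_lt hN
  have hlt : x < (N + 1 : ℕ) * τ := by push_cast; linarith
  have e : delayFun c q τ =ᶠ[nhds x]
      fun y => ∑ k ∈ Finset.range (N + 1), delayTerm c q τ k y := by
    filter_upwards [Iio_mem_nhds hlt] with y hy
    exact delayFun_eq_sum hτ hy (by omega)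
  have d : HasDerivWithinAt (fun y => ∑ k ∈ Finset.range (N + 1), delayTerm c q τ k y)
      (c * delayFun c q τ x - q * delayFun c q τ (x - τ)) (Set.Ici x) x := by
    have e1 : c * delayFun c q τ x - q * delayFun c q τ (x - τ) =
        (∑ k ∈ Finset.range N, (c * delayTerm c q τ (k + 1) x - q * delayTerm c q τ k (x - τ))) +
          c * delayTerm c q τ 0 x := by
      rw [delayFun_eq_sum hτ hlt (by omega), delayFun_eq_sum hτ (N := N) (by linarith) hN0,
        Finset.sum_range_succ', Finset.sum_sub_distrib, ← Finset.mul_sum, ← Finset.mul_sum]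
      ring
    rw [e1]
    have e2 : (fun y => ∑ k ∈ Finset.range (N + 1), delayTerm c q τ k y) =
        fun y => (∑ k ∈ Finset.range N, delayTerm c q τ (k + 1) y) + delayTerm c q τ 0 y := by
      funext y
      rw [Finset.sum_range_succ']
    rw [e2]
    exact (HasDerivWithinAt.fun_sum fun k _ => hasDerivWithinAt_delayTerm_succ k x).add
      (hasDerivWithinAt_delayTerm_zero x)
  exact d.congr_of_eventuallyEq (e.filter_mono nhdsWithin_le_nhds) e.self_of_nhds

theorem continuousOn_delayFun (hτ : 0 < τ) : ContinuousOn (delayFun c q τ) (Set.Ici 0) := by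
  have hz : ∀ k : ℕ, ContinuousOn (delayTerm c q τ k) (Set.Ici 0) := by
    intro k
    have hcont : Continuous fun x : ℝ => (-q) ^ k * ((x - k * τ) ^ k / (k.factorial : ℝ)) *
        Real.exp (c * (x - k * τ)) := by fun_prop
    rcases k with _ | k
    · refine hcont.continuousOn.congr fun x hx => ?_
      exact if_neg (by simpa using hx)
    · refine Continuous.continuousOn ?_
      refine (continuous_if_le (f := fun _ => ((k + 1 : ℕ) : ℝ) * τ) (g := id)
        (g' := fun _ => (0 : ℝ)) continuous_const continuous_id hcont.continuousOn
        continuousOn_const fun x hx => ?_).congr fun x => ?_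
      · have hx : ((k + 1 : ℕ) : ℝ) * τ = x := hx
        simp [← hx]
      · simp only [delayTerm, id_eq]
        by_cases h : x < ((k + 1 : ℕ) : ℝ) * τ
        · rw [if_pos h, if_neg (not_le.2 h)]
        · rw [if_neg h, if_pos (not_lt.1 h)]
  intro x hx
  obtain ⟨N, hN⟩ := exists_nat_gt (max (x / τ) 0)
  have hN0 : 0 < N := by
    have : (0 : ℝ) < N := (le_max_right _ _).trans_lt hN
    exact_mod_cast this
  have hxN : x < N * τ := by
    rw [← div_lt_iff₀ hτ]; exact (le_max_left _ _).trans_lt hN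
  have e : delayFun c q τ =ᶠ[nhds x]
      fun y => ∑ k ∈ Finset.range N, delayTerm c q τ k y := by
    filter_upwards [Iio_mem_nhds hxN] with y hy
    exact delayFun_eq_sum hτ hy hN0
  have h1 : ContinuousWithinAt (fun y => ∑ k ∈ Finset.range N, delayTerm c q τ k y)
      (Set.Ici 0) x := (continuousOn_finsetSum _ fun k _ => hz k) x hx
  exact h1.congr_of_eventuallyEq (e.filter_mono nhdsWithin_le_nhds) e.self_of_nhds

end DelayFun

/-! ### Directions and projections in the plane -/

/-- The unit vector in direction `φ`. -/
noncomputable def dir (φ : ℝ) : ℂ := ⟨Real.cos φ, Real.sin φ⟩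

/-- The component of `z` in direction `θ`. -/
noncomputable def proj (θ : ℝ) (z : ℂ) : ℝ := z.re * Real.cos θ + z.im * Real.sin θ

@[simp] theorem dir_re (φ : ℝ) : (dir φ).re = Real.cos φ := rfl

@[simp] theorem dir_im (φ : ℝ) : (dir φ).im = Real.sin φ := rfl

theorem dir_zero : dir 0 = 1 := by apply Complex.ext <;> simp

theorem norm_dir (φ : ℝ) : ‖dir φ‖ = 1 := by
  rw [Complex.norm_def, Complex.normSq_apply]
  simp only [dir_re, dir_im]
  rw [← sq, ← sq, Real.cos_sq_add_sin_sq, Real.sqrt_one]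

theorem norm_mul_dir (r φ : ℝ) : ‖(r : ℂ) * dir φ‖ = |r| := by
  rw [norm_mul, norm_dir, mul_one, Complex.norm_real, Real.norm_eq_abs]

theorem dir_add_two_pi (φ : ℝ) : dir (φ + 2 * Real.pi) = dir φ := by
  apply Complex.ext <;> simp

theorem dir_sub_two_pi (φ : ℝ) : dir (φ - 2 * Real.pi) = dir φ := by
  apply Complex.ext <;> simp

theorem hasDerivAt_dir (φ : ℝ) : HasDerivAt dir (dir (φ + Real.pi / 2)) φ := by
  have h1 : HasDerivAt (fun φ : ℝ => (Real.cos φ : ℂ) + (Real.sin φ : ℂ) * Complex.I)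
      (((-Real.sin φ : ℝ) : ℂ) + ((Real.cos φ : ℝ) : ℂ) * Complex.I) φ :=
    ((Real.hasDerivAt_cos φ).ofReal_comp).add
      (((Real.hasDerivAt_sin φ).ofReal_comp).mul_const _)
  have e : dir = fun φ : ℝ => (Real.cos φ : ℂ) + (Real.sin φ : ℂ) * Complex.I := by
    funext φ
    apply Complex.ext <;> simp [-Complex.ofReal_cos, -Complex.ofReal_sin]
  rw [e]
  refine h1.congr_deriv ?_
  apply Complex.ext <;>
    simp [-Complex.ofReal_cos, -Complex.ofReal_sin, Real.cos_add_pi_div_two,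
      Real.sin_add_pi_div_two]

theorem continuous_dir : Continuous dir :=
  continuous_iff_continuousAt.2 fun φ => (hasDerivAt_dir φ).continuousAt

theorem proj_add (θ : ℝ) (z w : ℂ) : proj θ (z + w) = proj θ z + proj θ w := by
  simp only [proj, Complex.add_re, Complex.add_im]; ring

theorem proj_sub (θ : ℝ) (z w : ℂ) : proj θ (z - w) = proj θ z - proj θ w := by
  simp only [proj, Complex.sub_re, Complex.sub_im]; ring

theorem proj_neg (θ : ℝ) (z : ℂ) : proj θ (-z) = -proj θ z := by
  simp only [proj, Complex.neg_re, Complex.neg_im]; ring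

@[simp] theorem proj_zero (θ : ℝ) : proj θ 0 = 0 := by simp [proj]

theorem proj_ofReal (θ r : ℝ) : proj θ (r : ℂ) = r * Real.cos θ := by simp [proj]

theorem proj_mul_dir (θ r φ : ℝ) : proj θ ((r : ℂ) * dir φ) = r * Real.cos (φ - θ) := by
  rw [Real.cos_sub]
  simp [proj]; ring

theorem proj_add_pi (θ : ℝ) (z : ℂ) : proj (θ + Real.pi) z = -proj θ z := by
  simp only [proj, Real.cos_add_pi, Real.sin_add_pi]; ring

theorem proj_add_two_pi (θ : ℝ) (z : ℂ) : proj (θ + 2 * Real.pi) z = proj θ z := by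
  simp only [proj, Real.cos_add_two_pi, Real.sin_add_two_pi]

theorem abs_proj_le (θ : ℝ) (z : ℂ) : |proj θ z| ≤ ‖z‖ := by
  rw [Complex.norm_def, Complex.normSq_apply]
  apply Real.abs_le_sqrt
  have := Real.sin_sq_add_cos_sq θ
  simp only [proj]
  nlinarith [sq_nonneg (z.re * Real.sin θ - z.im * Real.cos θ)]

theorem proj_le (θ : ℝ) (z : ℂ) : proj θ z ≤ ‖z‖ := (le_abs_self _).trans (abs_proj_le θ z)

theorem continuous_proj (θ : ℝ) : Continuous (proj θ) :=
  (Complex.continuous_re.mul continuous_const).add (Complex.continuous_im.mul continuous_const)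

theorem eq_norm_mul_dir_arg (z : ℂ) : z = (‖z‖ : ℂ) * dir (Complex.arg z) := by
  conv_lhs => rw [← Complex.norm_mul_exp_arg_mul_I z]
  congr 1
  rw [Complex.exp_mul_I]
  apply Complex.ext <;> simp [← Complex.ofReal_cos, ← Complex.ofReal_sin]

theorem exists_proj_eq_norm (z : ℂ) : ∃ θ, proj θ z = ‖z‖ := by
  refine ⟨Complex.arg z, ?_⟩
  have h := proj_mul_dir (Complex.arg z) ‖z‖ (Complex.arg z)
  rwa [← eq_norm_mul_dir_arg z, sub_self, Real.cos_zero, mul_one] at h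

/-- A vector is recovered from its components along and across a direction. -/
theorem eq_proj_mul_dir {θ : ℝ} {z : ℂ} (h : proj (θ + Real.pi / 2) z = 0) :
    z = (proj θ z : ℂ) * dir θ := by
  simp only [proj, Real.cos_add_pi_div_two, Real.sin_add_pi_div_two] at h
  have := Real.sin_sq_add_cos_sq θ
  apply Complex.ext
  · rw [Complex.re_ofReal_mul, dir_re, proj]
    linear_combination (-z.re) * this - Real.sin θ * h
  · rw [Complex.im_ofReal_mul, dir_im, proj]
    linear_combination (-z.im) * this + Real.cos θ * h

theorem hasDerivWithinAt_proj {f : ℝ → ℂ} {f' : ℂ} {s : Set ℝ} {x : ℝ} (θ : ℝ)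
    (h : HasDerivWithinAt f f' s x) :
    HasDerivWithinAt (fun y => proj θ (f y)) (proj θ f') s x := by
  have h1 := Complex.reCLM.hasFDerivAt.comp_hasDerivWithinAt x h
  have h2 := Complex.imCLM.hasFDerivAt.comp_hasDerivWithinAt x h
  exact (h1.mul_const (Real.cos θ)).add (h2.mul_const (Real.sin θ))

/-! ### The spiral traced by the end of a free string -/

/-- A spiral that is traced by the end of a taut string of slope `α`, as far as it is free.
The parameter `φ` is the (unwound) direction of the string; the curve then has heading `φ + α`,
so that the string touches the curve one turn plus `α` earlier. Here `pos φ` is the point with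
parameter `φ`, `len φ` is the length of the curve up to that point, and `last` is the parameter at
which the string has length `0`. The initial segment from the origin to the point `A` is made a
part of the curve that is traversed at parameter `-α`; hence the string is anchored at the origin
for `φ < 2π` and at the point `A` for `2π ≤ φ ≤ 2π + α`, and in all cases the fire, which travels
along the curve and then along the string, needs time `len φ * cos α`. -/
structure StringSpiral (A α : ℝ) where
  /-- length of the curve up to the given parameter, not counting the initial segment -/
  len : ℝ → ℝ
  /-- the point with the given parameter -/
  pos : ℝ → ℂ
  /-- the parameter at which the string has length `0` -/
  last : ℝ
  A_pos : 0 < A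
  α_pos : 0 < α
  α_lt : α < Real.pi / 2
  lt_last : 2 * Real.pi + α < last
  len_of_lt : ∀ x, x < -α → len x = -A
  pos_of_lt : ∀ x, x < -α → pos x = 0
  len_of_nonpos : ∀ x, -α ≤ x → x ≤ 0 → len x = 0
  pos_of_nonpos : ∀ x, -α ≤ x → x ≤ 0 → pos x = A
  continuousOn_len : ContinuousOn len (Set.Icc (-α) last)
  strictMonoOn_len : StrictMonoOn len (Set.Icc 0 last)
  /-- the increments of the curve are positive combinations of its headings -/
  turning : ∀ x y θ c, x ≤ y → y ≤ last → (∀ s ∈ Set.Icc x y, c ≤ Real.cos (s + α - θ)) →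
    c * (len y - len x) ≤ proj θ (pos y - pos x)
  pos_eq : ∀ x ∈ Set.Icc 0 last, pos x = pos (x - (2 * Real.pi + α)) +
    ((len x * Real.cos α - len (x - (2 * Real.pi + α)) : ℝ) : ℂ) * dir x
  free_pos : ∀ x ∈ Set.Ico 0 last, len (x - (2 * Real.pi + α)) < len x * Real.cos α
  free_last : len (last - (2 * Real.pi + α)) = len last * Real.cos α

/-! ### Construction of the spiral -/

/-- The length `F` of the free string of the spiral as a function of its direction. The string grows
because its end moves with slope `α`, and shrinks because it is wound onto the curve at the other
end, which gives `F' = cot α F - F(· - (2π + α)) / sin α`. The second summand accounts for the jump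
at direction `2π`, where the anchor passes from the origin to the point `A`. -/
noncomputable def freeString (A α x : ℝ) : ℝ :=
  A * (delayFun (Real.cos α / Real.sin α) (1 / Real.sin α) (2 * Real.pi + α) x -
    delayFun (Real.cos α / Real.sin α) (1 / Real.sin α) (2 * Real.pi + α) (x - 2 * Real.pi))

theorem HasDerivWithinAt.comp_sub_const_Ici {E : Type*} [NormedAddCommGroup E] [NormedSpace ℝ E]
    {f : ℝ → E} {f' : E} {x a : ℝ} (h : HasDerivWithinAt f f' (Set.Ici (x - a)) (x - a)) :
    HasDerivWithinAt (fun y => f (y - a)) f' (Set.Ici x) x := by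
  have := h.scomp x ((hasDerivWithinAt_id x (Set.Ici x)).sub_const a)
    (fun y hy => by simpa using hy)
  simpa [Function.comp_def] using this

section FreeString

variable {A α : ℝ}

theorem freeString_of_neg (hα : 0 < α) {x : ℝ} (hx : x < 0) : freeString A α x = 0 := by
  have hπ := Real.pi_pos
  rw [freeString, delayFun_of_neg (by positivity) hx,
    delayFun_of_neg (by positivity) (by linarith)]
  simp

theorem freeString_of_lt (hα : 0 < α) {x : ℝ} (h0 : 0 ≤ x) (h1 : x < 2 * Real.pi) :
    freeString A α x = A * Real.exp (Real.cos α / Real.sin α * x) := by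
  have hπ := Real.pi_pos
  rw [freeString, delayFun_of_le (by positivity) h0 (by linarith),
    delayFun_of_neg (by positivity) (by linarith), sub_zero]

theorem freeString_of_le (hα : 0 < α) {x : ℝ} (h0 : 2 * Real.pi ≤ x)
    (h1 : x ≤ 2 * Real.pi + α) :
    freeString A α x = A * (Real.exp (Real.cos α / Real.sin α * x) -
      Real.exp (Real.cos α / Real.sin α * (x - 2 * Real.pi))) := by
  have hπ := Real.pi_pos
  rw [freeString, delayFun_of_le (by positivity) (by linarith) h1,
    delayFun_of_le (by positivity) (by linarith) (by linarith)]

theorem hasDerivWithinAt_freeString (hα : 0 < α) (x : ℝ) :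
    HasDerivWithinAt (freeString A α)
      (Real.cos α / Real.sin α * freeString A α x -
        1 / Real.sin α * freeString A α (x - (2 * Real.pi + α))) (Set.Ici x) x := by
  have hτ : 0 < 2 * Real.pi + α := by have := Real.pi_pos; positivity
  have h1 := hasDerivWithinAt_delayFun (c := Real.cos α / Real.sin α) (q := 1 / Real.sin α) hτ x
  have h2 := (hasDerivWithinAt_delayFun (c := Real.cos α / Real.sin α) (q := 1 / Real.sin α) hτ
    (x - 2 * Real.pi)).comp_sub_const_Ici
  refine ((h1.sub h2).const_mul A).congr_deriv ?_
  rw [freeString, freeString, show x - (2 * Real.pi + α) - 2 * Real.pi =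
    x - 2 * Real.pi - (2 * Real.pi + α) by ring]
  ring

theorem continuousOn_freeString (hα : 0 < α) :
    ContinuousOn (freeString A α) (Set.Ici (2 * Real.pi)) := by
  have hπ := Real.pi_pos
  have hτ : 0 < 2 * Real.pi + α := by positivity
  refine ContinuousOn.const_smul (ContinuousOn.sub ((continuousOn_delayFun hτ).mono fun x hx => ?_)
    ((continuousOn_delayFun hτ).comp (by fun_prop) fun x hx => ?_)) A
  · have : 2 * Real.pi ≤ x := hx
    exact Set.mem_Ici.2 (by linarith)
  · have : 2 * Real.pi ≤ x := hx
    exact Set.mem_Ici.2 (by linarith)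

theorem intervalIntegrable_delayFun {c q τ : ℝ} (hτ : 0 < τ) (a b : ℝ) :
    IntervalIntegrable (delayFun c q τ) MeasureTheory.volume a b := by
  rw [intervalIntegrable_iff]
  have h1 : MeasureTheory.IntegrableOn (delayFun c q τ) (Set.Iio 0) :=
    MeasureTheory.integrableOn_zero.congr_fun
      (fun x hx => (delayFun_of_neg hτ hx).symm) measurableSet_Iio
  have h2 : MeasureTheory.IntegrableOn (delayFun c q τ) (Set.Icc 0 (max a b)) :=
    ((continuousOn_delayFun hτ).mono Set.Icc_subset_Ici_self).integrableOn_compact isCompact_Icc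
  refine (h1.union h2).mono_set fun x hx => ?_
  rcases lt_or_ge x 0 with h | h
  · exact Or.inl h
  · exact Or.inr ⟨h, hx.2⟩

theorem intervalIntegrable_freeString (hα : 0 < α) (a b : ℝ) :
    IntervalIntegrable (freeString A α) MeasureTheory.volume a b := by
  have hτ : 0 < 2 * Real.pi + α := by have := Real.pi_pos; positivity
  have h2 := (intervalIntegrable_delayFun (c := Real.cos α / Real.sin α) (q := 1 / Real.sin α) hτ
    (a - 2 * Real.pi) (b - 2 * Real.pi)).comp_sub_right (2 * Real.pi)
  simp only [sub_add_cancel] at h2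
  exact ((intervalIntegrable_delayFun hτ a b).sub h2).const_mul A

theorem hasDerivWithinAt_integral_Ici {E : Type*} [NormedAddCommGroup E] [NormedSpace ℝ E]
    [CompleteSpace E] {f : ℝ → E} {x : ℝ}
    (hf : ∀ a b, IntervalIntegrable f MeasureTheory.volume a b)
    (hr : ContinuousWithinAt f (Set.Ici x) x) :
    HasDerivWithinAt (fun u => ∫ s in (0 : ℝ)..u, f s) (f x) (Set.Ici x) x := by
  refine intervalIntegral.integral_hasDerivWithinAt_right (hf 0 x) (t := Set.Ioi x) ?_
    (hr.mono Set.Ioi_subset_Ici_self)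
  refine ⟨Set.Ioc x (x + 1), Ioc_mem_nhdsGT (by linarith), ?_⟩
  have := (hf x (x + 1)).aestronglyMeasurable
  exact this

end FreeString

section Construction

variable {A α : ℝ}

/-- The length of the spiral: the string of length `F` unwinds at the rate `F / sin α`. -/
noncomputable def spiralLen (A α x : ℝ) : ℝ := ∫ s in (0 : ℝ)..x, freeString A α s / Real.sin α

/-- The spiral, which at parameter `s` has heading `s + α`. -/
noncomputable def spiralPos (A α x : ℝ) : ℂ :=
  A + ∫ s in (0 : ℝ)..x, ((freeString A α s / Real.sin α : ℝ) : ℂ) * dir (s + α)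

theorem intervalIntegrable_spiralLen (hα : 0 < α) (a b : ℝ) :
    IntervalIntegrable (fun s => freeString A α s / Real.sin α) MeasureTheory.volume a b :=
  (intervalIntegrable_freeString hα a b).div_const _

theorem intervalIntegrable_spiralPos (hα : 0 < α) (a b : ℝ) :
    IntervalIntegrable (fun s => ((freeString A α s / Real.sin α : ℝ) : ℂ) * dir (s + α))
      MeasureTheory.volume a b := by
  have h := (intervalIntegrable_spiralLen (A := A) hα a b)
  have h2 : IntervalIntegrable (fun s => ((freeString A α s / Real.sin α : ℝ) : ℂ))
      MeasureTheory.volume a b := by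
    rw [intervalIntegrable_iff] at h ⊢
    exact h.ofReal
  exact h2.mul_continuousOn (continuous_dir.comp (by fun_prop)).continuousOn

theorem hasDerivWithinAt_spiralLen (hα : 0 < α) (x : ℝ) :
    HasDerivWithinAt (spiralLen A α) (freeString A α x / Real.sin α) (Set.Ici x) x :=
  hasDerivWithinAt_integral_Ici (intervalIntegrable_spiralLen hα)
    ((hasDerivWithinAt_freeString hα x).continuousWithinAt.div_const _)

theorem hasDerivWithinAt_spiralPos (hα : 0 < α) (x : ℝ) :
    HasDerivWithinAt (spiralPos A α)
      (((freeString A α x / Real.sin α : ℝ) : ℂ) * dir (x + α)) (Set.Ici x) x := by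
  refine (hasDerivWithinAt_integral_Ici (intervalIntegrable_spiralPos hα) ?_).const_add _
  have h := (hasDerivWithinAt_freeString (A := A) hα x).continuousWithinAt.div_const (Real.sin α)
  have h2 : ContinuousWithinAt (fun s : ℝ => ((freeString A α s / Real.sin α : ℝ) : ℂ))
      (Set.Ici x) x := Complex.continuous_ofReal.continuousAt.comp_continuousWithinAt h
  exact h2.mul (continuous_dir.comp (by fun_prop)).continuousWithinAt

theorem continuous_spiralLen (hα : 0 < α) : Continuous (spiralLen A α) :=
  intervalIntegral.continuous_primitive (intervalIntegrable_spiralLen hα) 0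

theorem continuous_spiralPos (hα : 0 < α) : Continuous (spiralPos A α) :=
  continuous_const.add (intervalIntegral.continuous_primitive (intervalIntegrable_spiralPos hα) 0)

theorem spiralLen_of_nonpos (hα : 0 < α) {x : ℝ} (hx : x ≤ 0) : spiralLen A α x = 0 := by
  rw [spiralLen, intervalIntegral.integral_symm, neg_eq_zero, intervalIntegral.integral_of_le hx,
    MeasureTheory.integral_Ioc_eq_integral_Ioo]
  refine MeasureTheory.setIntegral_eq_zero_of_forall_eq_zero fun s hs => ?_
  rw [freeString_of_neg hα hs.2, zero_div]

theorem spiralPos_of_nonpos (hα : 0 < α) {x : ℝ} (hx : x ≤ 0) : spiralPos A α x = A := by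
  rw [spiralPos, intervalIntegral.integral_symm, intervalIntegral.integral_of_le hx,
    MeasureTheory.integral_Ioc_eq_integral_Ioo]
  rw [MeasureTheory.setIntegral_eq_zero_of_forall_eq_zero fun s hs => ?_, neg_zero, add_zero]
  rw [freeString_of_neg hα hs.2]
  simp

theorem eq_of_hasDerivWithinAt_eq {E : Type*} [NormedAddCommGroup E] [NormedSpace ℝ E]
    {f g f' g' : ℝ → E} {a b : ℝ} (hab : a ≤ b)
    (hf : ContinuousOn f (Set.Icc a b)) (hg : ContinuousOn g (Set.Icc a b))
    (hdf : ∀ x ∈ Set.Ico a b, HasDerivWithinAt f (f' x) (Set.Ici x) x)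
    (hdg : ∀ x ∈ Set.Ico a b, HasDerivWithinAt g (g' x) (Set.Ici x) x)
    (he : ∀ x ∈ Set.Ico a b, f' x = g' x) (ha : f a = g a) : f b = g b := by
  have := constant_of_has_deriv_right_zero (hf.sub hg)
    (fun x hx => ((hdf x hx).sub (hdg x hx)).congr_deriv (sub_eq_zero.2 (he x hx))) b
    (Set.right_mem_Icc.2 hab)
  simp only [Pi.sub_apply] at this
  rw [ha, sub_self, sub_eq_zero] at this
  exact this

theorem spiralLen_eq_of_le (hα : 0 < α) (hα' : α < Real.pi / 2) {x : ℝ} (h0 : 0 ≤ x)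
    (h1 : x ≤ 2 * Real.pi) :
    spiralLen A α x * Real.cos α = A * Real.exp (Real.cos α / Real.sin α * x) - A := by
  have hs : 0 < Real.sin α := Real.sin_pos_of_pos_of_lt_pi hα (by linarith [Real.pi_pos])
  refine eq_of_hasDerivWithinAt_eq (f := fun x => spiralLen A α x * Real.cos α)
    (g := fun x => A * Real.exp (Real.cos α / Real.sin α * x) - A) h0
    ((continuous_spiralLen hα).mul continuous_const).continuousOn (by fun_prop)
    (fun y hy => (hasDerivWithinAt_spiralLen hα y).mul_const _)
    (fun y hy => ((((((hasDerivAt_id y).const_mul _).exp).const_mul A).sub_const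
      A).hasDerivWithinAt)) (fun y hy => ?_) ?_
  · rw [freeString_of_lt hα hy.1 (hy.2.trans_le h1)]
    simp only [id]
    field_simp
  · simp [spiralLen]

/-- The string and the part of the curve it has been unwound from are as long as the path of the
fire to the end of the string. -/
theorem spiralLen_eq (hα : 0 < α) (hα' : α < Real.pi / 2) {x : ℝ} (h : 2 * Real.pi ≤ x) :
    spiralLen A α x * Real.cos α =
      freeString A α x + spiralLen A α (x - (2 * Real.pi + α)) := by
  have hs : 0 < Real.sin α := Real.sin_pos_of_pos_of_lt_pi hα (by linarith [Real.pi_pos])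
  refine eq_of_hasDerivWithinAt_eq (f := fun x => spiralLen A α x * Real.cos α)
    (g := fun x => freeString A α x + spiralLen A α (x - (2 * Real.pi + α))) h
    ((continuous_spiralLen hα).mul continuous_const).continuousOn
    (((continuousOn_freeString hα).mono Set.Icc_subset_Ici_self).add
      ((continuous_spiralLen hα).comp (by fun_prop)).continuousOn)
    (fun y hy => (hasDerivWithinAt_spiralLen hα y).mul_const _)
    (fun y hy => (hasDerivWithinAt_freeString hα y).add
      (hasDerivWithinAt_spiralLen hα _).comp_sub_const_Ici) (fun y hy => ?_) ?_
  · ring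
  · rw [spiralLen_eq_of_le hα hα' (by positivity) le_rfl,
      freeString_of_le hα le_rfl (by linarith), spiralLen_of_nonpos hα (by linarith)]
    simp
    ring

theorem dir_add_eq (x a : ℝ) :
    dir (x + a) = (Real.cos a : ℂ) * dir x + (Real.sin a : ℂ) * dir (x + Real.pi / 2) := by
  apply Complex.ext
  · rw [dir_re, Complex.add_re, Complex.re_ofReal_mul, Complex.re_ofReal_mul, dir_re, dir_re,
      Real.cos_add_pi_div_two, Real.cos_add]
    ring
  · rw [dir_im, Complex.add_im, Complex.im_ofReal_mul, Complex.im_ofReal_mul, dir_im, dir_im,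
      Real.sin_add_pi_div_two, Real.sin_add]
    ring

theorem spiralPos_eq_of_le (hα : 0 < α) (hα' : α < Real.pi / 2) {x : ℝ} (h0 : 0 ≤ x)
    (h1 : x ≤ 2 * Real.pi) :
    spiralPos A α x = ((A * Real.exp (Real.cos α / Real.sin α * x) : ℝ) : ℂ) * dir x := by
  have hs : 0 < Real.sin α := Real.sin_pos_of_pos_of_lt_pi hα (by linarith [Real.pi_pos])
  refine eq_of_hasDerivWithinAt_eq (f := spiralPos A α)
    (g := fun x => ((A * Real.exp (Real.cos α / Real.sin α * x) : ℝ) : ℂ) * dir x) h0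
    (continuous_spiralPos hα).continuousOn
    ((Complex.continuous_ofReal.comp (by fun_prop)).mul continuous_dir).continuousOn
    (fun y hy => hasDerivWithinAt_spiralPos hα y)
    (fun y hy => (((((((hasDerivAt_id y).const_mul (Real.cos α / Real.sin α)).exp).const_mul
      A).ofReal_comp).mul (hasDerivAt_dir y)).hasDerivWithinAt)) (fun y hy => ?_) ?_
  · rw [freeString_of_lt hα hy.1 (hy.2.trans_le h1), dir_add_eq]
    have hs' : (Real.sin α : ℂ) ≠ 0 := by exact_mod_cast hs.ne'
    simp only [id]
    push_cast [-Complex.ofReal_cos, -Complex.ofReal_sin]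
    field_simp
  · simp [spiralPos, dir_zero]

/-- The string is tangent to the curve at its anchor: both sides have the same derivative, because of
the delay equation for the length of the string. -/
theorem spiralPos_eq (hα : 0 < α) (hα' : α < Real.pi / 2) {x : ℝ} (h : 2 * Real.pi ≤ x) :
    spiralPos A α x =
      spiralPos A α (x - (2 * Real.pi + α)) + (freeString A α x : ℂ) * dir x := by
  have hs : 0 < Real.sin α := Real.sin_pos_of_pos_of_lt_pi hα (by linarith [Real.pi_pos])
  refine eq_of_hasDerivWithinAt_eq (f := spiralPos A α)
    (g := fun x => spiralPos A α (x - (2 * Real.pi + α)) + (freeString A α x : ℂ) * dir x) h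
    (continuous_spiralPos hα).continuousOn
    (((continuous_spiralPos hα).comp (by fun_prop)).continuousOn.add
      ((Complex.continuous_ofReal.comp_continuousOn
        ((continuousOn_freeString hα).mono Set.Icc_subset_Ici_self)).mul
        continuous_dir.continuousOn))
    (fun y hy => hasDerivWithinAt_spiralPos hα y)
    (fun y hy => (hasDerivWithinAt_spiralPos hα _).comp_sub_const_Ici.add
      ((hasDerivWithinAt_freeString hα y).ofReal_comp.mul (hasDerivAt_dir y).hasDerivWithinAt))
    (fun y hy => ?_) ?_
  · rw [dir_add_eq y α, show y - (2 * Real.pi + α) + α = y - 2 * Real.pi by ring, dir_sub_two_pi]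
    have hs' : (Real.sin α : ℂ) ≠ 0 := by exact_mod_cast hs.ne'
    push_cast [-Complex.ofReal_cos, -Complex.ofReal_sin]
    field_simp
    ring
  · rw [spiralPos_eq_of_le hα hα' (by positivity) le_rfl,
      freeString_of_le hα le_rfl (by linarith), spiralPos_of_nonpos hα (by linarith)]
    have : dir (2 * Real.pi) = 1 := by rw [← dir_zero, ← dir_add_two_pi 0, zero_add]
    rw [this, sub_self, mul_zero, Real.exp_zero]
    push_cast
    ring

/-- The string shrinks to length `0` when `s / w < e`. -/
theorem exists_freeString_eq_zero (hA : 0 < A) (hα : 0 < α) (hα' : α < Real.pi / 2)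
    (h : Real.exp ((2 * Real.pi + α) * (Real.cos α / Real.sin α)) /
      ((2 * Real.pi + α) / Real.sin α) < Real.exp 1) :
    ∃ b, 2 * Real.pi + α < b ∧ freeString A α b = 0 ∧ ∀ x, 0 ≤ x → x < b → 0 < freeString A α x := by
  have hπ := Real.pi_pos
  have hs : 0 < Real.sin α := Real.sin_pos_of_pos_of_lt_pi hα (by linarith [Real.pi_pos])
  have hc : 0 < Real.cos α := Real.cos_pos_of_mem_Ioo ⟨by linarith, hα'⟩
  set τ := 2 * Real.pi + α with hτ
  have hτ0 : 0 < τ := by positivity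
  set c := Real.cos α / Real.sin α with hcdef
  have hc0 : 0 < c := by positivity
  have pos0 : ∀ x, 0 ≤ x → x ≤ τ → 0 < freeString A α x := by
    intro x h0 h1
    rcases lt_or_ge x (2 * Real.pi) with h2 | h2
    · rw [freeString_of_lt hα h0 h2]; positivity
    · rw [freeString_of_le hα h2 h1]
      refine mul_pos hA (sub_pos.2 (Real.exp_lt_exp.2 ?_))
      have := mul_pos hc0 hπ
      rw [← hcdef]
      nlinarith
  have hex : ∃ x, 2 * Real.pi ≤ x ∧ freeString A α x ≤ 0 := by
    by_contra hno
    push Not at hno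
    -- the factor `exp (-(c * x))` removes the undelayed term from the equation
    refine not_forall_pos_of_delay (G := fun x => freeString A α x * Real.exp (-(c * x)))
      (p := 1 / Real.sin α * Real.exp (-(c * τ))) (τ := τ) (a := 2 * Real.pi) (by positivity) hτ0
      ?_ ?_ ?_ ?_
    · have e1 : Real.exp (c * τ) < Real.exp 1 * (τ / Real.sin α) := by
        rw [mul_comm c τ]
        rwa [div_lt_iff₀ (by positivity)] at h
      calc (1 : ℝ) = Real.exp (c * τ) * Real.exp (-(c * τ)) := by
            rw [← Real.exp_add]; simp
        _ < Real.exp 1 * (τ / Real.sin α) * Real.exp (-(c * τ)) := by gcongr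
        _ = _ := by ring
    · exact (continuousOn_freeString hα).mul (by fun_prop)
    · intro x _
      have d2 : HasDerivAt (fun x : ℝ => Real.exp (-(c * x))) (Real.exp (-(c * x)) * (-(c * 1))) x :=
        (((hasDerivAt_id x).const_mul c).neg).exp
      refine ((hasDerivWithinAt_freeString hα x).mul d2.hasDerivWithinAt).congr_deriv ?_
      have e : Real.exp (-(c * (x - τ))) * Real.exp (-(c * τ)) = Real.exp (-(c * x)) := by
        rw [← Real.exp_add]; ring_nf
      rw [← hcdef, ← hτ, ← e]
      ring
    · intro x hx
      exact mul_pos (hno x hx) (Real.exp_pos _)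
  obtain ⟨x1, hx1, hx1'⟩ := hex
  set S := {x | 2 * Real.pi ≤ x ∧ freeString A α x ≤ 0} with hS
  have hcl : IsClosed S := by
    have := (continuousOn_freeString (A := A) hα).preimage_isClosed_of_isClosed isClosed_Ici
      (isClosed_Iic (a := (0 : ℝ)))
    exact this
  have hne : S.Nonempty := ⟨x1, hx1, hx1'⟩
  have hbdd : BddBelow S := ⟨2 * Real.pi, fun y hy => hy.1⟩
  have hmem : sInf S ∈ S := hcl.csInf_mem hne hbdd
  have hlt : ∀ x, 0 ≤ x → x < sInf S → 0 < freeString A α x := by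
    intro x h0 hx
    rcases le_or_gt x τ with h1 | h1
    · exact pos0 x h0 h1
    · by_contra hcon
      exact absurd (csInf_le hbdd (show x ∈ S from ⟨by linarith, not_lt.1 hcon⟩)) (not_le.2 hx)
  have hτlt : τ < sInf S := by
    by_contra hcon
    exact absurd (pos0 _ (by linarith [hmem.1]) (not_lt.1 hcon)) (not_lt.2 hmem.2)
  refine ⟨sInf S, hτlt, le_antisymm hmem.2 ?_, hlt⟩
  have hcw : ContinuousWithinAt (freeString A α) (Set.Ico (2 * Real.pi) (sInf S)) (sInf S) :=
    (continuousOn_freeString hα _ hmem.1).mono Set.Ico_subset_Ici_self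
  have : (nhdsWithin (sInf S) (Set.Ico (2 * Real.pi) (sInf S))).NeBot := by
    refine mem_closure_iff_nhdsWithin_neBot.1 ?_
    rw [closure_Ico (by linarith)]
    exact ⟨hmem.1, le_rfl⟩
  exact ge_of_tendsto hcw (Filter.eventually_of_mem self_mem_nhdsWithin
    fun x hx => (hlt x (by linarith [hx.1]) hx.2).le)

/-- The increments of the curve are integrals of its headings with weight `F / sin α`, which is
nonnegative up to the first zero of the length `F` of the string. -/
theorem exists_stringSpiral (hA : 0 < A) (hα : 0 < α) (hα' : α < Real.pi / 2)
    (h : Real.exp ((2 * Real.pi + α) * (Real.cos α / Real.sin α)) /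
      ((2 * Real.pi + α) / Real.sin α) < Real.exp 1) : Nonempty (StringSpiral A α) := by
  have hπ := Real.pi_pos
  have hs : 0 < Real.sin α := Real.sin_pos_of_pos_of_lt_pi hα (by linarith [Real.pi_pos])
  have hc : 0 < Real.cos α := Real.cos_pos_of_mem_Ioo ⟨by linarith, hα'⟩
  obtain ⟨b, hb, hb0, hpos⟩ := exists_freeString_eq_zero hA hα hα' h
  have hnn : ∀ x, x < b → 0 ≤ freeString A α x := fun x hx => by
    rcases lt_or_ge x 0 with h | h
    · exact (freeString_of_neg hα h).ge
    · exact (hpos x h hx).le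
  set len : ℝ → ℝ := fun x => if x < -α then -A else spiralLen A α x with hlen
  set pos : ℝ → ℂ := fun x => if x < -α then 0 else spiralPos A α x with hposdef
  have len1 : ∀ x, -α ≤ x → len x = spiralLen A α x := fun x hx => if_neg (not_lt.2 hx)
  have pos1 : ∀ x, -α ≤ x → pos x = spiralPos A α x := fun x hx => if_neg (not_lt.2 hx)
  have len0 : ∀ x, x < -α → len x = -A := fun x hx => if_pos hx
  have pos0 : ∀ x, x < -α → pos x = 0 := fun x hx => if_pos hx
  have lenI : ∀ x, 0 ≤ x →
      len x * Real.cos α - len (x - (2 * Real.pi + α)) = freeString A α x := by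
    intro x hx
    rw [len1 x (by linarith)]
    rcases lt_or_ge x (2 * Real.pi) with h2 | h2
    · rw [len0 _ (by linarith), spiralLen_eq_of_le hα hα' hx h2.le, freeString_of_lt hα hx h2]
      ring
    · rw [len1 _ (by linarith), spiralLen_eq hα hα' h2]
      ring
  refine ⟨⟨len, pos, b, hA, hα, hα', hb, len0, pos0, ?_, ?_, ?_, ?_, ?_, ?_, ?_, ?_⟩⟩
  · exact fun x h1 h2 => (len1 x h1).trans (spiralLen_of_nonpos hα h2)
  · exact fun x h1 h2 => (pos1 x h1).trans (spiralPos_of_nonpos hα h2)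
  · exact (continuous_spiralLen hα).continuousOn.congr fun x hx => len1 x hx.1
  · have mono : ∀ x y, 0 ≤ x → x ≤ y → y ≤ b → spiralLen A α x ≤ spiralLen A α y :=
      fun x y hx hxy hy => le_of_hasDerivWithinAt_nonneg hxy
        (continuous_spiralLen hα).continuousOn
        (fun s _ => hasDerivWithinAt_spiralLen hα s)
        (fun s hs' => div_nonneg (hnn s (by linarith [hs'.2])) hs.le)
    intro x hx y hy hxy
    rw [len1 x (by linarith [hx.1]), len1 y (by linarith [hy.1])]
    refine lt_of_le_of_ne (mono x y hx.1 hxy.le hy.2) fun he => ?_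
    -- otherwise the length is constant on `[x, y]`, so that its right derivative at `x` is `0`
    have hconst : HasDerivWithinAt (spiralLen A α) 0 (Set.Ici x) x := by
      refine (hasDerivWithinAt_const x (Set.Ici x) (spiralLen A α x)).congr_of_eventuallyEq ?_ rfl
      filter_upwards [Icc_mem_nhdsGE hxy] with z hz
      exact le_antisymm ((mono z y (hx.1.trans hz.1) hz.2 hy.2).trans he.ge)
        (mono x z hx.1 hz.1 (hz.2.trans hy.2))
    have := (uniqueDiffWithinAt_Ici x).eq_deriv _ (hasDerivWithinAt_spiralLen hα x) hconst
    have h2 := div_pos (hpos x hx.1 (hxy.trans_le hy.2)) hs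
    exact h2.ne' this
  · have main : ∀ x y θ c, -α ≤ x → x ≤ y → y ≤ b →
        (∀ s ∈ Set.Icc x y, c ≤ Real.cos (s + α - θ)) →
        c * (spiralLen A α y - spiralLen A α x) ≤
          proj θ (spiralPos A α y) - proj θ (spiralPos A α x) := by
      intro x y θ c _ hxy hy hcs
      have := le_of_hasDerivWithinAt_nonneg (a := x) (b := y)
        (f := fun s => proj θ (spiralPos A α s) - c * spiralLen A α s)
        (f' := fun s => proj θ (((freeString A α s / Real.sin α : ℝ) : ℂ) * dir (s + α)) -
          c * (freeString A α s / Real.sin α)) hxy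
        ((((continuous_proj θ).comp (continuous_spiralPos hα)).sub
          (continuous_const.mul (continuous_spiralLen hα))).continuousOn)
        (fun s _ => (hasDerivWithinAt_proj θ (hasDerivWithinAt_spiralPos hα s)).sub
          ((hasDerivWithinAt_spiralLen hα s).const_mul c))
        (fun s hs' => by
          rw [proj_mul_dir]
          have h1 := hcs s ⟨hs'.1, hs'.2.le⟩
          have h2 := div_nonneg (hnn s (by linarith [hs'.2])) hs.le
          nlinarith)
      linarith
    intro x y θ c hxy hy hcs
    rw [proj_sub]
    rcases lt_or_ge y (-α) with h1 | h1
    · rw [len0 y h1, len0 x (by linarith), pos0 y h1, pos0 x (by linarith)]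
      simp
    · rcases lt_or_ge x (-α) with h2 | h2
      · rw [len1 y h1, len0 x h2, pos1 y h1, pos0 x h2]
        have h3 := main (-α) y θ c le_rfl h1 hy fun s hs' => hcs s ⟨by linarith [hs'.1], hs'.2⟩
        rw [spiralLen_of_nonpos (x := -α) hα (by linarith),
          spiralPos_of_nonpos (x := -α) hα (by linarith), proj_ofReal] at h3
        have h4 := hcs (-α) ⟨h2.le, h1⟩
        rw [neg_add_cancel, zero_sub, Real.cos_neg] at h4
        have h5 := mul_le_mul_of_nonneg_left h4 hA.le
        rw [proj_zero]
        linarith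
      · rw [len1 y h1, len1 x h2, pos1 y h1, pos1 x h2]
        exact main x y θ c h2 hxy hy hcs
  · intro x hx
    rw [lenI x hx.1, pos1 x (by linarith [hx.1])]
    rcases lt_or_ge x (2 * Real.pi) with h2 | h2
    · rw [pos0 _ (by linarith), spiralPos_eq_of_le hα hα' hx.1 h2.le,
        freeString_of_lt hα hx.1 h2, zero_add]
    · rw [pos1 _ (by linarith), spiralPos_eq hα hα' h2]
  · intro x hx
    have := lenI x hx.1
    have := hpos x hx.1 hx.2
    linarith
  · have := lenI b (by linarith)
    linarith

end Construction

/-! ### Convexity of the spiral -/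

namespace StringSpiral

variable {A α : ℝ} (S : StringSpiral A α)

/-- The point at which the string with direction `φ` is attached. -/
noncomputable def anchor (φ : ℝ) : ℂ := S.pos (φ - (2 * Real.pi + α))

/-- The time at which the fire, travelling along the curve, arrives at the anchor of the string
with direction `φ`. -/
noncomputable def wound (φ : ℝ) : ℝ := S.len (φ - (2 * Real.pi + α))

/-- The signed distance of `z` from the line of the string with direction `φ`, positive on the
left. -/
noncomputable def side (z : ℂ) (φ : ℝ) : ℝ := proj (φ + Real.pi / 2) (z - S.anchor φ)

theorem last_pos : 0 < S.last := by
  have := S.lt_last; have := S.α_pos; have := Real.pi_pos; linarith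

theorem sin_pos (S : StringSpiral A α) : 0 < Real.sin α :=
  Real.sin_pos_of_pos_of_lt_pi S.α_pos (by linarith [Real.pi_pos, S.α_lt])

theorem cos_pos (S : StringSpiral A α) : 0 < Real.cos α :=
  Real.cos_pos_of_mem_Ioo ⟨by linarith [Real.pi_pos, S.α_pos], S.α_lt⟩

theorem len_zero : S.len 0 = 0 := S.len_of_nonpos 0 (by linarith [S.α_pos]) le_rfl

theorem pos_zero : S.pos 0 = A := S.pos_of_nonpos 0 (by linarith [S.α_pos]) le_rfl

theorem len_nonneg {x : ℝ} (h0 : -α ≤ x) (h1 : x ≤ S.last) : 0 ≤ S.len x := by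
  rcases le_or_gt x 0 with h | h
  · exact (S.len_of_nonpos x h0 h).ge
  · rw [← S.len_zero]
    exact (S.strictMonoOn_len ⟨le_rfl, S.last_pos.le⟩ ⟨h.le, h1⟩ h).le

theorem len_pos {x : ℝ} (h0 : 0 < x) (h1 : x ≤ S.last) : 0 < S.len x := by
  rw [← S.len_zero]
  exact S.strictMonoOn_len ⟨le_rfl, S.last_pos.le⟩ ⟨h0.le, h1⟩ h0

theorem anchor_of_lt {φ : ℝ} (h : φ < 2 * Real.pi) : S.anchor φ = 0 :=
  S.pos_of_lt _ (by linarith)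

theorem wound_of_lt {φ : ℝ} (h : φ < 2 * Real.pi) : S.wound φ = -A :=
  S.len_of_lt _ (by linarith)

theorem anchor_of_le {φ : ℝ} (h : 2 * Real.pi ≤ φ) (h' : φ ≤ 2 * Real.pi + α) :
    S.anchor φ = A :=
  S.pos_of_nonpos _ (by linarith) (by linarith)

theorem wound_of_le {φ : ℝ} (h : 2 * Real.pi ≤ φ) (h' : φ ≤ 2 * Real.pi + α) :
    S.wound φ = 0 :=
  S.len_of_nonpos _ (by linarith) (by linarith)

theorem pos_eq_anchor {x : ℝ} (hx : x ∈ Set.Icc 0 S.last) :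
    S.pos x = S.anchor x + ((S.len x * Real.cos α - S.wound x : ℝ) : ℂ) * dir x :=
  S.pos_eq x hx

theorem wound_lt {x : ℝ} (hx : x ∈ Set.Ico 0 S.last) : S.wound x < S.len x * Real.cos α :=
  S.free_pos x hx

theorem wound_last : S.wound S.last = S.len S.last * Real.cos α := S.free_last

theorem norm_pos_sub_le {x y : ℝ} (hxy : x ≤ y) (hy : y ≤ S.last) :
    ‖S.pos y - S.pos x‖ ≤ S.len y - S.len x := by
  obtain ⟨θ, hθ⟩ := exists_proj_eq_norm (S.pos y - S.pos x)
  have := S.turning x y (θ + Real.pi) (-1) hxy hy fun s _ => Real.neg_one_le_cos _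
  rw [proj_add_pi, hθ] at this
  linarith

theorem len_mono {x y : ℝ} (hxy : x ≤ y) (hy : y ≤ S.last) : S.len x ≤ S.len y := by
  have := S.norm_pos_sub_le hxy hy
  have := norm_nonneg (S.pos y - S.pos x)
  linarith

theorem turning_anchor {x y θ c : ℝ} (hxy : x ≤ y) (hy : y ≤ S.last)
    (h : ∀ s ∈ Set.Icc x y, c ≤ Real.cos (s - θ)) :
    c * (S.wound y - S.wound x) ≤ proj θ (S.anchor y - S.anchor x) := by
  refine S.turning _ _ θ c (by linarith) (by linarith [S.α_pos, Real.pi_pos]) fun s hs => ?_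
  have := h (s + (2 * Real.pi + α)) ⟨by linarith [hs.1], by linarith [hs.2]⟩
  rwa [show s + (2 * Real.pi + α) - θ = s + α - θ + 2 * Real.pi by ring,
    Real.cos_add_two_pi] at this

theorem wound_mono {x y : ℝ} (hxy : x ≤ y) (hy : y ≤ S.last) : S.wound x ≤ S.wound y :=
  S.len_mono (by linarith) (by linarith [S.α_pos, Real.pi_pos])

theorem norm_anchor_sub_le {x y : ℝ} (hxy : x ≤ y) (hy : y ≤ S.last) :
    ‖S.anchor y - S.anchor x‖ ≤ S.wound y - S.wound x :=
  S.norm_pos_sub_le (by linarith) (by linarith [S.α_pos, Real.pi_pos])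

theorem neg_le_wound {x : ℝ} (hx : x ≤ S.last) : -A ≤ S.wound x := by
  rcases lt_or_ge x (2 * Real.pi) with h | h
  · exact (S.wound_of_lt h).ge
  · have := S.len_nonneg (x := x - (2 * Real.pi + α)) (by linarith)
      (by linarith [S.α_pos, Real.pi_pos])
    have h2 := S.A_pos
    rw [wound]
    linarith

theorem cross_nonneg {x y θ : ℝ} (hxy : x ≤ y) (hy : y ≤ S.last)
    (h : ∀ s ∈ Set.Icc x y, 0 ≤ Real.sin (s + α - θ)) :
    0 ≤ proj (θ + Real.pi / 2) (S.pos y - S.pos x) := by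
  have := S.turning x y (θ + Real.pi / 2) 0 hxy hy fun s hs => by
    rw [show s + α - (θ + Real.pi / 2) = s + α - θ - Real.pi / 2 by ring,
      Real.cos_sub_pi_div_two]
    exact h s hs
  linarith

/-- A piece of the curve away from its ends contributes strictly, since the length increases there. -/
theorem cross_pos {x y θ : ℝ} (hxy : x < y) (hy0 : 0 < y) (hy : y ≤ S.last)
    (h : ∀ s ∈ Set.Icc x y, 0 ≤ Real.sin (s + α - θ))
    (h' : ∀ s ∈ Set.Ioo x y, 0 < Real.sin (s + α - θ)) :
    0 < proj (θ + Real.pi / 2) (S.pos y - S.pos x) := by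
  have hm : max x 0 < y := max_lt hxy hy0
  obtain ⟨m, hm1, hm2⟩ := exists_between hm
  obtain ⟨n, hn1, hn2⟩ := exists_between hm2
  have hxm : x < m := (le_max_left _ _).trans_lt hm1
  have h0m : 0 < m := (le_max_right _ _).trans_lt hm1
  obtain ⟨s0, hs0, hmin⟩ := isCompact_Icc.exists_isMinOn (Set.nonempty_Icc.2 hn1.le)
    (f := fun s => Real.sin (s + α - θ)) (by fun_prop)
  have hpos := h' s0 ⟨by linarith [hs0.1], by linarith [hs0.2]⟩
  have h1 := S.cross_nonneg (x := x) (y := m) (θ := θ) hxm.le (by linarith)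
    fun s hs => h s ⟨hs.1, by linarith [hs.2]⟩
  have h3 := S.cross_nonneg (x := n) (y := y) (θ := θ) hn2.le hy
    fun s hs => h s ⟨by linarith [hs.1], hs.2⟩
  have h2 := S.turning m n (θ + Real.pi / 2) (Real.sin (s0 + α - θ)) hn1.le (by linarith)
    fun s hs => by
      rw [show s + α - (θ + Real.pi / 2) = s + α - θ - Real.pi / 2 by ring,
        Real.cos_sub_pi_div_two]
      exact hmin hs
  have h4 := S.strictMonoOn_len ⟨h0m.le, by linarith⟩ ⟨by linarith, by linarith⟩ hn1
  have h5 := mul_pos hpos (sub_pos.2 h4)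
  rw [proj_sub] at *
  linarith

theorem cross_anchor_nonneg {x y θ : ℝ} (hxy : x ≤ y) (hy : y ≤ S.last)
    (h : ∀ s ∈ Set.Icc x y, 0 ≤ Real.sin (s - θ)) :
    0 ≤ proj (θ + Real.pi / 2) (S.anchor y - S.anchor x) := by
  have := S.turning_anchor (θ := θ + Real.pi / 2) (c := 0) hxy hy fun s hs => by
    rw [show s - (θ + Real.pi / 2) = s - θ - Real.pi / 2 by ring, Real.cos_sub_pi_div_two]
    exact h s hs
  linarith

theorem cross_mul_dir (θ r φ : ℝ) :
    proj (θ + Real.pi / 2) ((r : ℂ) * dir φ) = r * Real.sin (φ - θ) := by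
  rw [proj_mul_dir, show φ - (θ + Real.pi / 2) = φ - θ - Real.pi / 2 by ring,
    Real.cos_sub_pi_div_two]

theorem side_anchor_add (φ ρ : ℝ) : S.side (S.anchor φ + ρ * dir φ) φ = 0 := by
  rw [side, add_sub_cancel_left, cross_mul_dir, sub_self, Real.sin_zero, mul_zero]

/-- The line that is tangent to the curve at parameter `φ - α` is parallel to the string with
direction `φ`, whose end is the point with parameter `φ`. -/
theorem side_add_two_pi_sub (z : ℂ) {φ : ℝ} (h0 : 0 ≤ φ) (h : φ ≤ S.last) :
    S.side z (φ + 2 * Real.pi) - S.side z φ =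
      proj (φ + Real.pi / 2) (S.pos φ - S.pos (φ - α)) := by
  have h1 := S.pos_eq φ ⟨h0, h⟩
  rw [side, side, anchor, anchor, show φ + 2 * Real.pi + Real.pi / 2 =
    φ + Real.pi / 2 + 2 * Real.pi by ring, proj_add_two_pi,
    show φ + 2 * Real.pi - (2 * Real.pi + α) = φ - α by ring, h1]
  simp only [proj_sub, proj_add, cross_mul_dir, sub_self, Real.sin_zero]
  ring

/-- After a full turn every tangent line has moved outwards. -/
theorem side_le_side_add_two_pi (z : ℂ) {φ : ℝ} (h : φ ≤ S.last) :
    S.side z φ ≤ S.side z (φ + 2 * Real.pi) := by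
  rcases lt_or_ge φ 0 with h0 | h0
  · rw [side, side, S.anchor_of_lt (by linarith [Real.pi_pos]), S.anchor_of_lt (by linarith),
      show φ + 2 * Real.pi + Real.pi / 2 = φ + Real.pi / 2 + 2 * Real.pi by ring, proj_add_two_pi]
  · have h1 := S.side_add_two_pi_sub z h0 h
    have h2 := S.cross_nonneg (x := φ - α) (y := φ) (θ := φ) (by linarith [S.α_pos]) h
      fun s hs => Real.sin_nonneg_of_nonneg_of_le_pi (by linarith [hs.1])
        (by linarith [hs.2, S.α_lt, Real.pi_pos])
    linarith

theorem side_lt_side_add_two_pi (z : ℂ) {φ : ℝ} (h0 : 0 < φ) (h : φ ≤ S.last) :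
    S.side z φ < S.side z (φ + 2 * Real.pi) := by
  have h1 := S.side_add_two_pi_sub z h0.le h
  have h2 := S.cross_pos (x := φ - α) (y := φ) (θ := φ) (by linarith [S.α_pos]) h0 h
      (fun s hs => Real.sin_nonneg_of_nonneg_of_le_pi (by linarith [hs.1])
        (by linarith [hs.2, S.α_lt, Real.pi_pos]))
      (fun s hs => Real.sin_pos_of_pos_of_lt_pi (by linarith [hs.1])
        (by linarith [hs.2, S.α_lt, Real.pi_pos]))
  linarith

section Disjoint

variable {S} {φ₁ ρ₁ φ₂ ρ₂ : ℝ} {z : ℂ}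

/-- Between two directions less than half a turn apart the anchor moves to the left of the first
string, and the second string points further to the left. -/
theorem false_of_sub_lt_pi (hφ : φ₁ < φ₂) (hπ : φ₂ < φ₁ + Real.pi) (hs : φ₂ ≤ S.last)
    (h2 : 0 < ρ₂) (e1 : z = S.anchor φ₁ + ρ₁ * dir φ₁)
    (e2 : z = S.anchor φ₂ + ρ₂ * dir φ₂) : False := by
  have h3 := S.cross_anchor_nonneg (x := φ₁) (y := φ₂) (θ := φ₁) hφ.le hs fun s hs =>
    Real.sin_nonneg_of_nonneg_of_le_pi (by linarith [hs.1]) (by linarith [hs.2])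
  have h4 : S.anchor φ₂ - S.anchor φ₁ = (ρ₁ : ℂ) * dir φ₁ - (ρ₂ : ℂ) * dir φ₂ := by
    rw [e1] at e2
    linear_combination -e2
  rw [h4, proj_sub, cross_mul_dir, cross_mul_dir, sub_self, Real.sin_zero] at h3
  have h5 := mul_pos h2 (Real.sin_pos_of_pos_of_lt_pi (x := φ₂ - φ₁) (by linarith) (by linarith))
  linarith

/-- The position relative to a tangent line is compared with the parallel tangent line one turn
earlier. -/
theorem side_eq_half_turn (e1 : z = S.anchor φ₁ + ρ₁ * dir φ₁) (φ : ℝ) :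
    S.side z φ = proj (φ - 2 * Real.pi + Real.pi / 2) (S.anchor φ₁ - S.anchor (φ - 2 * Real.pi)) +
      (S.side z φ - S.side z (φ - 2 * Real.pi)) + ρ₁ * Real.sin (φ₁ - φ) := by
  have h : S.side z (φ - 2 * Real.pi) =
      proj (φ - 2 * Real.pi + Real.pi / 2) (S.anchor φ₁ - S.anchor (φ - 2 * Real.pi)) +
        ρ₁ * Real.sin (φ₁ - φ) := by
    rw [side, e1, show S.anchor φ₁ + ρ₁ * dir φ₁ - S.anchor (φ - 2 * Real.pi) =
      (S.anchor φ₁ - S.anchor (φ - 2 * Real.pi)) + ρ₁ * dir φ₁ by ring, proj_add, cross_mul_dir,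
      show φ₁ - (φ - 2 * Real.pi) = φ₁ - φ + 2 * Real.pi by ring, Real.sin_add_two_pi]
  linarith

/-- In the second half of the turn after `φ₁` the points of the string with direction `φ₁` lie
to the left of the tangent lines. -/
theorem side_pos_of_half_turn {φ : ℝ} (h1 : 0 < ρ₁) (e1 : z = S.anchor φ₁ + ρ₁ * dir φ₁)
    (hφ : φ₁ + Real.pi ≤ φ) (hφ' : φ < φ₁ + 2 * Real.pi) (hs : φ ≤ S.last)
    (h : φ₁ + Real.pi < φ ∨ 2 * Real.pi < φ) : 0 < S.side z φ := by
  have hπ := Real.pi_pos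
  have a1 := S.cross_anchor_nonneg (x := φ - 2 * Real.pi) (y := φ₁) (θ := φ - 2 * Real.pi)
    (by linarith) (by linarith) fun s hs =>
      Real.sin_nonneg_of_nonneg_of_le_pi (by linarith [hs.1]) (by linarith [hs.2])
  have a2 := S.side_le_side_add_two_pi z (φ := φ - 2 * Real.pi) (by linarith)
  have e := side_eq_half_turn e1 φ
  have a3 : Real.sin (φ₁ - φ) = Real.sin (φ₁ - φ + 2 * Real.pi) := by rw [Real.sin_add_two_pi]
  rw [sub_add_cancel] at a2
  rcases h with h | h
  · have := mul_pos h1 (Real.sin_pos_of_pos_of_lt_pi (x := φ₁ - φ + 2 * Real.pi) (by linarith)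
      (by linarith))
    rw [← a3] at this
    linarith
  · have := mul_nonneg h1.le (Real.sin_nonneg_of_nonneg_of_le_pi (x := φ₁ - φ + 2 * Real.pi)
      (by linarith) (by linarith))
    rw [← a3] at this
    have a4 := S.side_lt_side_add_two_pi z (φ := φ - 2 * Real.pi) (by linarith) (by linarith)
    rw [sub_add_cancel] at a4
    linarith

/-- The position of a point of the string relative to a tangent line is computed from the free end of
the string, which lies on the curve. -/
theorem side_eq_next_turn (hφ₁ : φ₁ ∈ Set.Icc 0 S.last)
    (e1 : z = S.anchor φ₁ + ρ₁ * dir φ₁) (φ : ℝ) :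
    S.side z φ = (S.len φ₁ * Real.cos α - S.wound φ₁ - ρ₁) * Real.sin (φ - φ₁) +
      proj (φ + Real.pi / 2) (S.pos φ₁ - S.pos (φ - (2 * Real.pi + α))) := by
  have h := S.pos_eq_anchor hφ₁
  have e : z - S.anchor φ = (S.pos φ₁ - S.pos (φ - (2 * Real.pi + α))) -
      ((S.len φ₁ * Real.cos α - S.wound φ₁ - ρ₁ : ℝ) : ℂ) * dir φ₁ := by
    rw [e1, h, Complex.ofReal_sub _ ρ₁, ← anchor]
    ring
  rw [side, e, proj_sub, cross_mul_dir, show φ₁ - φ = -(φ - φ₁) by ring, Real.sin_neg]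
  ring

theorem cross_next_turn_nonneg {φ : ℝ} (hφ₁ : φ₁ ∈ Set.Icc 0 S.last)
    (hφ : φ₁ + 2 * Real.pi ≤ φ) (hφ' : φ ≤ φ₁ + 3 * Real.pi) (hs : φ ≤ S.last) :
    0 ≤ proj (φ + Real.pi / 2) (S.pos φ₁ - S.pos (φ - (2 * Real.pi + α))) := by
  have hπ := Real.pi_pos
  have hα := S.α_pos
  have hα' := S.α_lt
  rcases le_or_gt (φ - (2 * Real.pi + α)) φ₁ with h | h
  · refine S.cross_nonneg h hφ₁.2 fun s hs => ?_
    rw [← Real.sin_add_two_pi]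
    exact Real.sin_nonneg_of_nonneg_of_le_pi (by linarith [hs.1]) (by linarith [hs.2])
  · have := S.cross_nonneg (x := φ₁) (y := φ - (2 * Real.pi + α)) (θ := φ + Real.pi) h.le
      (by linarith) fun s hs => by
        rw [← Real.sin_add_two_pi, ← Real.sin_add_two_pi]
        exact Real.sin_nonneg_of_nonneg_of_le_pi (by linarith [hs.1]) (by linarith [hs.2])
    rw [show φ + Real.pi + Real.pi / 2 = φ + Real.pi / 2 + Real.pi by ring, proj_add_pi,
      ← proj_neg, neg_sub] at this
    exact this

theorem side_nonneg_next_turn {φ : ℝ} (hφ₁ : φ₁ ∈ Set.Icc 0 S.last)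
    (hb : S.wound φ₁ + ρ₁ ≤ S.len φ₁ * Real.cos α)
    (e1 : z = S.anchor φ₁ + ρ₁ * dir φ₁) (hφ : φ₁ + 2 * Real.pi ≤ φ)
    (hφ' : φ ≤ φ₁ + 3 * Real.pi) (hs : φ ≤ S.last) : 0 ≤ S.side z φ := by
  rw [side_eq_next_turn hφ₁ e1]
  refine add_nonneg (mul_nonneg (by linarith) ?_) (cross_next_turn_nonneg hφ₁ hφ hφ' hs)
  rw [← Real.sin_sub_two_pi]
  exact Real.sin_nonneg_of_nonneg_of_le_pi (by linarith) (by linarith)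

/-- One turn later, the string with direction `φ₁` lies to the left of the tangent lines. The only
exception is its free end, which is the anchor of the string with direction `φ₁ + 2π + α`. -/
theorem false_of_next_turn (hφ₁ : φ₁ ∈ Set.Icc 0 S.last)
    (hb : S.wound φ₁ + ρ₁ ≤ S.len φ₁ * Real.cos α) (h2 : 0 < ρ₂)
    (e1 : z = S.anchor φ₁ + ρ₁ * dir φ₁) (e2 : z = S.anchor φ₂ + ρ₂ * dir φ₂)
    (hφ : φ₁ + 2 * Real.pi ≤ φ₂) (hφ' : φ₂ ≤ φ₁ + 3 * Real.pi) (hs : φ₂ ≤ S.last) : False := by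
  have hπ := Real.pi_pos
  have hα := S.α_pos
  have hα' := S.α_lt
  have h0 : S.side z φ₂ = 0 := by rw [e2]; exact S.side_anchor_add _ _
  have h1 := side_eq_next_turn hφ₁ e1 φ₂
  have hsin : Real.sin (φ₂ - φ₁) = Real.sin (φ₂ - φ₁ - 2 * Real.pi) := by
    rw [Real.sin_sub_two_pi]
  have hsin0 : 0 ≤ Real.sin (φ₂ - φ₁) := by
    rw [hsin]; exact Real.sin_nonneg_of_nonneg_of_le_pi (by linarith) (by linarith)
  have hfirst := mul_nonneg (sub_nonneg.2 (by linarith : ρ₁ ≤ S.len φ₁ * Real.cos α - S.wound φ₁))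
    hsin0
  rcases lt_trichotomy φ₂ (φ₁ + (2 * Real.pi + α)) with h | h | h
  · rcases hφ₁.1.lt_or_eq with h3 | h3
    · have := S.cross_pos (x := φ₂ - (2 * Real.pi + α)) (y := φ₁) (θ := φ₂) (by linarith) h3 hφ₁.2
        (fun s hs => by
          rw [← Real.sin_add_two_pi]
          exact Real.sin_nonneg_of_nonneg_of_le_pi (by linarith [hs.1]) (by linarith [hs.2]))
        (fun s hs => by
          rw [← Real.sin_add_two_pi]
          exact Real.sin_pos_of_pos_of_lt_pi (by linarith [hs.1]) (by linarith [hs.2]))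
      linarith
    · -- the strings with direction `0` and with direction in `[2π, 2π + α]` lie on different
      -- sides of the point `A`
      subst h3
      rw [S.wound_of_lt (by linarith), S.len_zero] at hb
      rw [S.anchor_of_lt (by linarith)] at e1
      rw [S.anchor_of_le (by linarith) (by linarith), e1] at e2
      have h5 := congrArg Complex.re e2
      simp only [Complex.add_re, Complex.re_ofReal_mul, dir_re, Real.cos_zero, Complex.zero_re,
        Complex.ofReal_re] at h5
      have h6 := mul_pos h2 (Real.cos_pos_of_mem_Ioo (x := φ₂ - 2 * Real.pi)
        ⟨by linarith, by linarith⟩)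
      rw [Real.cos_sub_two_pi] at h6
      linarith
  · have h3 : Real.sin (φ₂ - φ₁) = Real.sin α := by
      rw [hsin, h]; congr 1; ring
    have h4 : φ₂ - (2 * Real.pi + α) = φ₁ := by linarith
    rw [h4, sub_self, proj_zero, h3, h0] at h1
    have h5 : S.len φ₁ * Real.cos α - S.wound φ₁ - ρ₁ = 0 := by
      have := S.sin_pos.ne'
      have h6 : (S.len φ₁ * Real.cos α - S.wound φ₁ - ρ₁) * Real.sin α = 0 := by linarith
      exact (mul_eq_zero.1 h6).resolve_right this
    have h6 : z = S.pos φ₁ := by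
      rw [e1, S.pos_eq_anchor hφ₁, show S.len φ₁ * Real.cos α - S.wound φ₁ = ρ₁ by linarith]
    rw [h6, anchor, h4, left_eq_add] at e2
    have h7 := congrArg norm e2
    rw [norm_mul_dir, norm_zero, abs_of_pos h2] at h7
    exact h2.ne' h7
  · have := S.cross_pos (x := φ₁) (y := φ₂ - (2 * Real.pi + α)) (θ := φ₂ + Real.pi) (by linarith)
      (by linarith [hφ₁.1]) (by linarith) (fun s hs => by
        rw [← Real.sin_add_two_pi, ← Real.sin_add_two_pi]
        exact Real.sin_nonneg_of_nonneg_of_le_pi (by linarith [hs.1]) (by linarith [hs.2]))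
      (fun s hs => by
        rw [← Real.sin_add_two_pi, ← Real.sin_add_two_pi]
        exact Real.sin_pos_of_pos_of_lt_pi (by linarith [hs.1]) (by linarith [hs.2]))
    rw [show φ₂ + Real.pi + Real.pi / 2 = φ₂ + Real.pi / 2 + Real.pi by ring, proj_add_pi,
      ← proj_neg, neg_sub] at this
    linarith

theorem side_nonneg_of_lt (hφ₁ : φ₁ ∈ Set.Icc 0 S.last) (h1 : 0 < ρ₁)
    (hb : S.wound φ₁ + ρ₁ ≤ S.len φ₁ * Real.cos α)
    (e1 : z = S.anchor φ₁ + ρ₁ * dir φ₁) (n : ℕ) :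
    ∀ φ, φ₁ + Real.pi < φ → φ ≤ φ₁ + Real.pi + 2 * Real.pi * (n + 1) → φ ≤ S.last →
      0 ≤ S.side z φ := by
  induction n with
  | zero =>
    intro φ hφ hφ' hs
    rcases lt_or_ge φ (φ₁ + 2 * Real.pi) with h | h
    · exact (side_pos_of_half_turn h1 e1 hφ.le h hs (Or.inl hφ)).le
    · exact side_nonneg_next_turn hφ₁ hb e1 h (by push_cast at hφ'; linarith) hs
  | succ n ih =>
    intro φ hφ hφ' hs
    rcases le_or_gt φ (φ₁ + Real.pi + 2 * Real.pi * (n + 1)) with h | h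
    · exact ih φ hφ h hs
    · have hπ := Real.pi_pos
      have hn : (0 : ℝ) ≤ 2 * Real.pi * n := by positivity
      push_cast at hφ'
      have h3 := ih (φ - 2 * Real.pi) (by linarith) (by linarith) (by linarith)
      have h4 := S.side_le_side_add_two_pi z (φ := φ - 2 * Real.pi) (by linarith)
      rw [sub_add_cancel] at h4
      exact h3.trans h4

/-- A point of the string with direction `φ₁` does not lie on any later string. Within half a turn
this is convexity of the curve from which the string unwinds; later on, the tangent lines that bear
the strings have the point strictly on their left. -/
theorem false_of_lt (hφ₁ : 0 ≤ φ₁) (h1 : 0 < ρ₁)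
    (hb : S.wound φ₁ + ρ₁ ≤ S.len φ₁ * Real.cos α) (h2 : 0 < ρ₂) (hφ : φ₁ < φ₂)
    (hs : φ₂ ≤ S.last) (e1 : z = S.anchor φ₁ + ρ₁ * dir φ₁)
    (e2 : z = S.anchor φ₂ + ρ₂ * dir φ₂) : False := by
  have hπ := Real.pi_pos
  have h0 : S.side z φ₂ = 0 := by rw [e2]; exact S.side_anchor_add _ _
  have hm : φ₁ ∈ Set.Icc 0 S.last := ⟨hφ₁, by linarith⟩
  rcases lt_or_ge φ₂ (φ₁ + Real.pi) with c1 | c1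
  · exact false_of_sub_lt_pi hφ c1 hs h2 e1 e2
  rcases lt_or_ge φ₂ (φ₁ + 2 * Real.pi) with c2 | c2
  · by_cases c : φ₁ + Real.pi < φ₂ ∨ 2 * Real.pi < φ₂
    · exact (side_pos_of_half_turn h1 e1 c1 c2 hs c).ne' h0
    · -- the opposite direction is special only while the anchors are the origin and `A`
      push Not at c
      have hφ2 : φ₂ = φ₁ + Real.pi := le_antisymm c.1 c1
      rw [S.anchor_of_lt (by linarith), zero_add] at e1
      have hp1 : proj φ₁ z = ρ₁ := by
        rw [e1, proj_mul_dir, sub_self, Real.cos_zero, mul_one]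
      rcases c.2.lt_or_eq with c3 | c3
      · rw [S.anchor_of_lt c3, zero_add] at e2
        rw [e2, proj_mul_dir, hφ2, add_sub_cancel_left, Real.cos_pi] at hp1
        linarith
      · rw [S.anchor_of_le c3.ge (by linarith [S.α_pos])] at e2
        have : φ₁ = Real.pi := by linarith
        rw [e2, proj_add, proj_mul_dir, proj_ofReal, hφ2, add_sub_cancel_left, Real.cos_pi, this,
          Real.cos_pi] at hp1
        linarith [S.A_pos]
  rcases le_or_gt φ₂ (φ₁ + 3 * Real.pi) with c3 | c3
  · exact false_of_next_turn hm hb h2 e1 e2 c2 c3 hs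
  · obtain ⟨n, hn⟩ := exists_nat_gt ((φ₂ - φ₁) / (2 * Real.pi))
    rw [div_lt_iff₀ (by positivity)] at hn
    have h3 := side_nonneg_of_lt hm h1 hb e1 n (φ₂ - 2 * Real.pi) (by linarith) (by linarith)
      (by linarith)
    have h4 := S.side_lt_side_add_two_pi z (φ := φ₂ - 2 * Real.pi) (by linarith) (by linarith)
    rw [sub_add_cancel, h0] at h4
    linarith

/-- Distinct strings, without their anchors, are disjoint. -/
theorem string_unique (hφ₁ : φ₁ ∈ Set.Icc 0 S.last) (hφ₂ : φ₂ ∈ Set.Icc 0 S.last)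
    (h1 : 0 < ρ₁) (h2 : 0 < ρ₂)
    (hb₁ : S.wound φ₁ + ρ₁ ≤ S.len φ₁ * Real.cos α)
    (hb₂ : S.wound φ₂ + ρ₂ ≤ S.len φ₂ * Real.cos α)
    (e : S.anchor φ₁ + ρ₁ * dir φ₁ = S.anchor φ₂ + ρ₂ * dir φ₂) : φ₁ = φ₂ ∧ ρ₁ = ρ₂ := by
  rcases lt_trichotomy φ₁ φ₂ with h | h | h
  · exact (false_of_lt hφ₁.1 h1 hb₁ h2 h hφ₂.2 rfl e).elim
  · subst h
    refine ⟨rfl, ?_⟩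
    have := congrArg (proj φ₁) e
    rw [proj_add, proj_add, proj_mul_dir, proj_mul_dir, sub_self, Real.cos_zero] at this
    linarith
  · exact (false_of_lt hφ₂.1 h2 hb₂ h1 h hφ₁.2 rfl e.symm).elim

end Disjoint

theorem injOn_pos : Set.InjOn S.pos (Set.Ico 0 S.last) := by
  intro x hx y hy hxy
  have hx' : x ∈ Set.Icc 0 S.last := ⟨hx.1, hx.2.le⟩
  have hy' : y ∈ Set.Icc 0 S.last := ⟨hy.1, hy.2.le⟩
  rw [S.pos_eq_anchor hx', S.pos_eq_anchor hy'] at hxy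
  exact (string_unique hx' hy' (sub_pos.2 (S.wound_lt hx)) (sub_pos.2 (S.wound_lt hy))
    (by linarith) (by linarith) hxy).1

theorem pos_last : S.pos S.last = S.pos (S.last - (2 * Real.pi + α)) := by
  rw [S.pos_eq_anchor ⟨S.last_pos.le, le_rfl⟩, S.wound_last, sub_self]
  simp [anchor]

/-- At parameter `last` the string has length `0`, so that the spiral meets the anchor there. -/
theorem exists_mem_Ico_pos_eq {x : ℝ} (hx : x ∈ Set.Icc 0 S.last) :
    ∃ y ∈ Set.Ico 0 S.last, S.pos y = S.pos x := by
  rcases hx.2.lt_or_eq with h | h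
  · exact ⟨x, ⟨hx.1, h⟩, rfl⟩
  · refine ⟨S.last - (2 * Real.pi + α), ⟨?_, ?_⟩, ?_⟩
    · linarith [S.lt_last]
    · linarith [S.α_pos, Real.pi_pos]
    · rw [h, S.pos_last]

theorem side_origin_nonneg (n : ℕ) :
    ∀ φ, φ < 2 * Real.pi * (n + 1) → φ ≤ S.last → 0 ≤ S.side 0 φ := by
  have h0 : ∀ φ, φ < 2 * Real.pi → 0 ≤ S.side 0 φ := fun φ h => by
    rw [side, S.anchor_of_lt h, sub_self, proj_zero]
  induction n with
  | zero => exact fun φ h _ => h0 φ (by push_cast at h; linarith)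
  | succ n ih =>
    intro φ h hs
    push_cast at h
    have h1 := ih (φ - 2 * Real.pi) (by linarith) (by linarith [Real.pi_pos])
    have h2 := S.side_le_side_add_two_pi 0 (φ := φ - 2 * Real.pi) (by linarith [Real.pi_pos])
    rw [sub_add_cancel] at h2
    exact h1.trans h2

theorem pos_ne_zero {x : ℝ} (hx : x ∈ Set.Ico 0 S.last) : S.pos x ≠ 0 := by
  intro h
  have e := S.pos_eq_anchor ⟨hx.1, hx.2.le⟩
  have hF := S.wound_lt hx
  have hπ := Real.pi_pos
  rcases lt_trichotomy x (2 * Real.pi) with h1 | h1 | h1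
  · rw [S.anchor_of_lt h1, zero_add, h] at e
    have := congrArg norm e
    rw [norm_mul_dir, norm_zero, abs_of_pos (by linarith)] at this
    linarith
  · rw [S.anchor_of_le h1.ge (by linarith [S.α_pos]), h] at e
    have h2 := congrArg Complex.re e
    simp only [Complex.add_re, Complex.re_ofReal_mul, dir_re, Complex.zero_re,
        Complex.ofReal_re] at h2
    rw [h1, Real.cos_two_pi, ← h1] at h2
    linarith [S.A_pos]
  · obtain ⟨n, hn⟩ := exists_nat_gt (x / (2 * Real.pi))
    rw [div_lt_iff₀ (by positivity)] at hn
    have h2 := S.side_origin_nonneg n (x - 2 * Real.pi) (by linarith) (by linarith [hx.2])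
    have h3 := S.side_lt_side_add_two_pi 0 (φ := x - 2 * Real.pi) (by linarith)
      (by linarith [hx.2])
    have h4 : S.side 0 x = 0 := by
      rw [← h, e]; exact S.side_anchor_add _ _
    rw [sub_add_cancel, h4] at h3
    linarith

/-! ### The region reached by the fire -/

/-- `z` lies in the region that the fire has reached at time `r`: in the open initial disc or on a
string between its anchor and its free end, where the fire has arrived along curve and string. -/
def Reached (r : ℝ) (z : ℂ) : Prop :=
  ‖z‖ < A ∨ ∃ φ ∈ Set.Ioo 0 S.last, ∃ ρ > 0, z = S.anchor φ + ((ρ : ℝ) : ℂ) * dir φ ∧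
    S.wound φ + ρ < S.len φ * Real.cos α ∧ S.wound φ + ρ ≤ r

variable {S} in
theorem Reached.mono {r r' : ℝ} {z : ℂ} (h : S.Reached r z) (hr : r ≤ r') : S.Reached r' z := by
  rcases h with h | ⟨φ, hφ, ρ, hρ, e, h1, h2⟩
  · exact Or.inl h
  · exact Or.inr ⟨φ, hφ, ρ, hρ, e, h1, h2.trans hr⟩

theorem exists_polar {z : ℂ} : ∃ φ, 0 ≤ φ ∧ φ < 2 * Real.pi ∧ z = (‖z‖ : ℂ) * dir φ := by
  have h1 := Complex.neg_pi_lt_arg z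
  have h2 := Complex.arg_le_pi z
  have h3 := eq_norm_mul_dir_arg z
  rcases lt_or_ge (Complex.arg z) 0 with h | h
  · refine ⟨Complex.arg z + 2 * Real.pi, by linarith, by linarith, ?_⟩
    rw [dir_add_two_pi]
    exact h3
  · exact ⟨Complex.arg z, h, by linarith [Real.pi_pos], h3⟩

/-- A point of the disc lies on a string with anchor at the origin, before the end of that string. -/
theorem lt_norm_pos {x : ℝ} (h0 : 0 < x) (h1 : x < S.last) : A < ‖S.pos x‖ := by
  by_contra hcon
  rw [not_lt] at hcon
  have hx : x ∈ Set.Ico 0 S.last := ⟨h0.le, h1⟩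
  have hx' : x ∈ Set.Icc 0 S.last := ⟨h0.le, h1.le⟩
  obtain ⟨φ, hφ, hφ', e⟩ := exists_polar (z := S.pos x)
  have hne : 0 < ‖S.pos x‖ := norm_pos_iff.2 (S.pos_ne_zero hx)
  have hφs : φ ≤ S.last := by linarith [S.lt_last, S.α_pos]
  have hlen := mul_nonneg (S.len_nonneg (x := φ) (by linarith [S.α_pos]) hφs) S.cos_pos.le
  have e2 : S.anchor φ + ((‖S.pos x‖ : ℝ) : ℂ) * dir φ =
      S.anchor x + ((S.len x * Real.cos α - S.wound x : ℝ) : ℂ) * dir x := by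
    rw [S.anchor_of_lt hφ', zero_add, ← S.pos_eq_anchor hx', ← e]
  obtain ⟨h2, h3⟩ := string_unique ⟨hφ, hφs⟩ hx' hne (sub_pos.2 (S.wound_lt hx))
    (by rw [S.wound_of_lt hφ']; linarith) (by linarith) e2
  have h4 := mul_pos (S.len_pos h0 h1.le) S.cos_pos
  rw [S.wound_of_lt (h2 ▸ hφ')] at h3
  linarith

theorem le_norm_pos {x : ℝ} (hx : x ∈ Set.Icc 0 S.last) : A ≤ ‖S.pos x‖ := by
  obtain ⟨y, hy, e⟩ := S.exists_mem_Ico_pos_eq hx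
  rw [← e]
  rcases hy.1.lt_or_eq with h | h
  · exact (S.lt_norm_pos h hy.2).le
  · rw [← h, S.pos_zero, Complex.norm_real, Real.norm_eq_abs]
    exact le_abs_self A

/-- The curve itself is not reached, because its points are the free ends of the strings. -/
theorem not_reached_pos {x r : ℝ} (hx : x ∈ Set.Icc 0 S.last) : ¬ S.Reached r (S.pos x) := by
  obtain ⟨y, hy, e⟩ := S.exists_mem_Ico_pos_eq hx
  rintro (h | ⟨φ, hφ, ρ, hρ, e1, h1, -⟩)
  · exact absurd h (not_lt.2 (S.le_norm_pos hx))
  · have hy' : y ∈ Set.Icc 0 S.last := ⟨hy.1, hy.2.le⟩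
    rw [← e, S.pos_eq_anchor hy'] at e1
    obtain ⟨h2, h3⟩ := string_unique hy' ⟨hφ.1.le, hφ.2.le⟩ (sub_pos.2 (S.wound_lt hy)) hρ
      (by linarith) h1.le e1
    subst h2
    linarith

end StringSpiral

namespace StringSpiral

variable {A α : ℝ} (S : StringSpiral A α)

/-! ### String coordinates -/

/-- The end of the fire's path to time `D` along the curve and then along the string with
direction `φ`. -/
noncomputable def tip (φ D : ℝ) : ℂ := S.anchor φ + ((D - S.wound φ : ℝ) : ℂ) * dir φ

theorem continuousOn_wound : ContinuousOn S.wound (Set.Icc (2 * Real.pi) S.last) :=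
  S.continuousOn_len.comp (by fun_prop) fun x hx =>
    ⟨by linarith [hx.1], by linarith [hx.2, S.α_pos, Real.pi_pos]⟩

theorem continuousOn_of_norm_sub_le {f : ℝ → ℂ} {g : ℝ → ℝ} {s : Set ℝ} (hg : ContinuousOn g s)
    (h : ∀ x ∈ s, ∀ y ∈ s, x ≤ y → ‖f y - f x‖ ≤ g y - g x) : ContinuousOn f s := by
  have h' : ∀ x ∈ s, ∀ y ∈ s, dist (f x) (f y) ≤ dist (g x) (g y) := by
    intro x hx y hy
    rw [Real.dist_eq]
    rcases le_total x y with hxy | hxy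
    · rw [dist_comm, dist_eq_norm]
      exact (h x hx y hy hxy).trans (by rw [abs_sub_comm]; exact le_abs_self _)
    · rw [dist_eq_norm]
      exact (h y hy x hx hxy).trans (le_abs_self _)
  rw [Metric.continuousOn_iff] at hg ⊢
  intro x hx ε hε
  obtain ⟨δ, hδ, hd⟩ := hg x hx ε hε
  exact ⟨δ, hδ, fun y hy hyx => (h' y hy x hx).trans_lt (hd y hy hyx)⟩

theorem continuousOn_anchor : ContinuousOn S.anchor (Set.Icc (2 * Real.pi) S.last) :=
  continuousOn_of_norm_sub_le S.continuousOn_wound fun _ _ _ hy hxy =>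
    S.norm_anchor_sub_le hxy hy.2

theorem continuous_proj_dir (z : ℂ) : Continuous fun φ : ℝ => proj φ z := by
  unfold proj; fun_prop

/-- The tangent lines vary continuously, although the anchor jumps from the origin to `A` when the
string passes the direction `2π` of that jump. -/
theorem continuousOn_side (z : ℂ) : ContinuousOn (S.side z) (Set.Iic S.last) := by
  have hz : Continuous fun φ : ℝ => proj (φ + Real.pi / 2) z :=
    (continuous_proj_dir z).comp (by fun_prop)
  have e0 : ∀ φ ∈ Set.Iic (2 * Real.pi), S.side z φ = proj (φ + Real.pi / 2) z := by
    intro φ hφ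
    rcases (show φ ≤ 2 * Real.pi from hφ).lt_or_eq with h | h
    · rw [side, S.anchor_of_lt h, sub_zero]
    · rw [side, S.anchor_of_le h.ge (by linarith [S.α_pos]), proj_sub, proj_ofReal, h,
        Real.cos_add_pi_div_two, Real.sin_two_pi]
      ring
  have h1 : ContinuousOn (S.side z) (Set.Iic (2 * Real.pi)) :=
    hz.continuousOn.congr e0
  have h2 : ContinuousOn (S.side z) (Set.Icc (2 * Real.pi) S.last) := by
    have hc := S.continuousOn_anchor
    have hre := Complex.continuous_re.comp_continuousOn hc
    have him := Complex.continuous_im.comp_continuousOn hc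
    unfold side proj
    simp only [Complex.sub_re, Complex.sub_im]
    exact ((continuousOn_const.sub hre).mul (by fun_prop)).add
      ((continuousOn_const.sub him).mul (by fun_prop))
  refine (h1.union_of_isClosed h2 isClosed_Iic isClosed_Icc).mono fun x hx => ?_
  rcases le_total x (2 * Real.pi) with h | h
  · exact Or.inl h
  · exact Or.inr ⟨h, hx⟩

variable {S} in
/-- The arrival time `D` is `1`-Lipschitz, since it is the length of the path along curve and string:
the displacement is measured in direction `φ₁`. -/
theorem sub_le_norm_tip_sub_of_le {φ₁ φ₂ D₁ D₂ : ℝ} (hφ : φ₁ ≤ φ₂) (hs : φ₂ ≤ S.last)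
    (h2 : S.wound φ₂ ≤ D₂) : D₁ - D₂ ≤ ‖S.tip φ₁ D₁ - S.tip φ₂ D₂‖ := by
  refine le_trans ?_ (proj_le φ₁ _)
  have h3 := (proj_le φ₁ _).trans (S.norm_anchor_sub_le hφ hs)
  have h4 := Real.cos_le_one (φ₂ - φ₁)
  have h5 := mul_le_mul_of_nonneg_left h4 (sub_nonneg.2 h2)
  rw [proj_sub] at h3
  simp only [tip, proj_sub, proj_add, proj_mul_dir, sub_self, Real.cos_zero]
  linarith

theorem cos_le_cos_of_abs_le {x y : ℝ} (h : |x| ≤ y) (hy : y ≤ Real.pi) :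
    Real.cos y ≤ Real.cos x := by
  rw [← Real.cos_abs x]
  exact Real.cos_le_cos_of_nonneg_of_le_pi (abs_nonneg x) hy h

variable {S} in
/-- The counterpart of `sub_le_norm_tip_sub_of_le` for a string that is unwound. The restriction to
half a turn is needed, because the arrival time jumps across the barrier. -/
theorem sub_le_norm_tip_sub_of_ge {φ₁ φ₂ D₁ D₂ : ℝ} (hφ : φ₂ ≤ φ₁) (hs : φ₁ ≤ S.last)
    (hπ : φ₁ ≤ φ₂ + Real.pi) (h2 : S.wound φ₁ ≤ D₂) :
    D₁ - D₂ ≤ ‖S.tip φ₁ D₁ - S.tip φ₂ D₂‖ := by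
  refine le_trans ?_ (proj_le φ₁ _)
  have h3 := S.turning_anchor (θ := φ₁) (c := Real.cos (φ₂ - φ₁)) hφ hs fun s hs' => by
    rw [← Real.cos_neg (φ₂ - φ₁)]
    exact cos_le_cos_of_abs_le (abs_le.2 ⟨by linarith [hs'.1], by linarith [hs'.2]⟩)
      (by linarith)
  have h4 := Real.cos_le_one (φ₂ - φ₁)
  rw [proj_sub] at h3
  simp only [tip, proj_sub, proj_add, proj_mul_dir, sub_self, Real.cos_zero]
  nlinarith

/-- The jump of `S.wound` at `2π` is harmless, because it is continuous on the right. -/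
theorem exists_wound_add_le {φ₀ ε : ℝ} (hs : φ₀ < S.last) (hε : 0 < ε) :
    ∃ d > 0, φ₀ + d ≤ S.last ∧ S.wound (φ₀ + d) ≤ S.wound φ₀ + ε := by
  rcases lt_or_ge φ₀ (2 * Real.pi) with h | h
  · refine ⟨(2 * Real.pi - φ₀) / 2, by linarith, by linarith [S.lt_last, S.α_pos], ?_⟩
    rw [S.wound_of_lt h, S.wound_of_lt (by linarith)]
    linarith
  · have hc := S.continuousOn_wound φ₀ ⟨h, hs.le⟩
    rw [Metric.continuousWithinAt_iff] at hc
    obtain ⟨δ, hδ, hd⟩ := hc ε hε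
    have hm : 0 < min (δ / 2) (S.last - φ₀) := lt_min (by linarith) (by linarith)
    have hm1 := min_le_left (δ / 2) (S.last - φ₀)
    have hm2 := min_le_right (δ / 2) (S.last - φ₀)
    refine ⟨min (δ / 2) (S.last - φ₀), hm, by linarith, ?_⟩
    have := hd (x := φ₀ + min (δ / 2) (S.last - φ₀)) ⟨by linarith, by linarith⟩ (by
      rw [Real.dist_eq, add_sub_cancel_left, abs_of_pos hm]; linarith)
    rw [Real.dist_eq] at this
    linarith [(abs_lt.1 this).2]

theorem exists_small_angle {K ε : ℝ} (hε : 0 < ε) :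
    ∃ d > 0, d < Real.pi / 2 ∧ ∀ x, |x| ≤ d → K * (1 - Real.cos x) ≤ ε := by
  have hc : Filter.Tendsto (fun x : ℝ => K * (1 - Real.cos x)) (nhds 0) (nhds 0) := by
    have : Continuous fun x : ℝ => K * (1 - Real.cos x) := by fun_prop
    simpa using this.tendsto 0
  obtain ⟨d, hd, h⟩ := Metric.eventually_nhds_iff.1 (hc.eventually (gt_mem_nhds hε))
  refine ⟨min (d / 2) 1, by positivity, ?_, fun x hx => ?_⟩
  · exact (min_le_right _ _).trans_lt (by linarith [Real.pi_gt_three])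
  · refine (h ?_).le
    rw [Real.dist_eq, sub_zero]
    exact hx.trans_lt ((min_le_left _ _).trans_lt (by linarith))

/-- String coordinates exist near every point of a string other than its anchor, and the arrival
time is there a `1`-Lipschitz function. -/
theorem exists_chart {φ₀ D₀ δ : ℝ} (hδ : 0 < δ) (hs : φ₀ < S.last) (hD : S.wound φ₀ < D₀) :
    ∃ η > 0, ∀ z, ‖z - S.tip φ₀ D₀‖ < η → ∃ φ D, |φ - φ₀| < δ ∧ φ ≤ S.last ∧ z = S.tip φ D ∧
      (S.wound φ₀ + D₀) / 2 < D ∧ S.wound φ ≤ (S.wound φ₀ + D₀) / 2 ∧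
      |D - D₀| ≤ ‖z - S.tip φ₀ D₀‖ := by
  set w := S.wound φ₀ with hw
  set ρ := D₀ - w with hρ
  have hρ0 : 0 < ρ := sub_pos.2 hD
  obtain ⟨d₁, hd₁, hs₁, hw₁⟩ := S.exists_wound_add_le hs (ε := ρ / 2) (by linarith)
  obtain ⟨d₂, hd₂, hπ₂, hcos⟩ := exists_small_angle (K := ρ + (w + A)) (ε := ρ / 8) (by linarith)
  have hwA := S.neg_le_wound hs.le
  obtain ⟨d, hd, hdm⟩ := exists_between (lt_min hδ (lt_min hd₁ hd₂))
  have hdδ : d < δ := hdm.trans_le (min_le_left _ _)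
  have hdd₁ : d < d₁ := hdm.trans_le ((min_le_right _ _).trans (min_le_left _ _))
  have hdd₂ : d < d₂ := hdm.trans_le ((min_le_right _ _).trans (min_le_right _ _))
  have hsin : 0 < Real.sin d := Real.sin_pos_of_pos_of_lt_pi hd (by linarith)
  have hz₀ : S.tip φ₀ D₀ = S.anchor φ₀ + ((ρ : ℝ) : ℂ) * dir φ₀ := rfl
  have hwd : ∀ φ, φ ≤ φ₀ + d → S.wound φ ≤ w + ρ / 2 := fun φ hφ =>
    (S.wound_mono (by linarith) hs₁).trans hw₁
  -- the line of the string passes `z₀` between the directions `φ₀ - d` and `φ₀ + d`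
  have side_r : S.side (S.tip φ₀ D₀) (φ₀ + d) ≤ -(ρ / 2 * Real.sin d) := by
    have h := S.turning_anchor (x := φ₀) (y := φ₀ + d) (θ := φ₀ + d + Real.pi / 2)
      (c := -Real.sin d) (by linarith) (by linarith) fun s hs' => by
        rw [show s - (φ₀ + d + Real.pi / 2) = -(φ₀ + d - s) - Real.pi / 2 by ring,
          Real.cos_sub_pi_div_two, Real.sin_neg]
        exact neg_le_neg (Real.sin_le_sin_of_le_of_le_pi_div_two (by linarith [hs'.2])
          (by linarith) (by linarith [hs'.1]))
    have e : S.tip φ₀ D₀ - S.anchor (φ₀ + d) =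
        ((ρ : ℝ) : ℂ) * dir φ₀ - (S.anchor (φ₀ + d) - S.anchor φ₀) := by rw [hz₀]; ring
    rw [side, e, proj_sub, cross_mul_dir, show φ₀ - (φ₀ + d) = -d by ring, Real.sin_neg]
    have := hwd (φ₀ + d) le_rfl
    nlinarith
  have side_l : ρ / 2 * Real.sin d ≤ S.side (S.tip φ₀ D₀) (φ₀ - d) := by
    have h := S.cross_anchor_nonneg (x := φ₀ - d) (y := φ₀) (θ := φ₀ - d) (by linarith) hs.le
      fun s hs' => Real.sin_nonneg_of_nonneg_of_le_pi (by linarith [hs'.1]) (by linarith [hs'.2])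
    have e : S.tip φ₀ D₀ - S.anchor (φ₀ - d) =
        ((ρ : ℝ) : ℂ) * dir φ₀ + (S.anchor φ₀ - S.anchor (φ₀ - d)) := by rw [hz₀]; ring
    rw [side, e, proj_add, cross_mul_dir, show φ₀ - (φ₀ - d) = d by ring]
    have := mul_pos hρ0 hsin
    linarith
  have side_sub : ∀ z φ, |S.side z φ - S.side (S.tip φ₀ D₀) φ| ≤ ‖z - S.tip φ₀ D₀‖ := by
    intro z φ
    rw [side, side, ← proj_sub, sub_sub_sub_cancel_right]
    exact abs_proj_le _ _
  refine ⟨min (ρ / 2 * Real.sin d) (ρ / 8), by positivity, fun z hz => ?_⟩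
  have hz1 := hz.trans_le (min_le_left _ _)
  have hz2 := hz.trans_le (min_le_right _ _)
  obtain ⟨φ, hφ, hφ0⟩ := intermediate_value_Icc' (by linarith : φ₀ - d ≤ φ₀ + d)
    ((S.continuousOn_side z).mono fun x hx => (hx.2.trans (by linarith) : x ≤ S.last))
    (show (0 : ℝ) ∈ Set.Icc (S.side z (φ₀ + d)) (S.side z (φ₀ - d)) from
      ⟨by linarith [(abs_le.1 (side_sub z (φ₀ + d))).2],
        by linarith [(abs_le.1 (side_sub z (φ₀ - d))).1]⟩)
  have hφs : φ ≤ S.last := by linarith [hφ.2]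
  have hφw := hwd φ hφ.2
  have habs : |φ - φ₀| ≤ d := abs_le.2 ⟨by linarith [hφ.1], by linarith [hφ.2]⟩
  have hzt : z = S.tip φ (S.wound φ + proj φ (z - S.anchor φ)) := by
    rw [tip, add_sub_cancel_left, ← eq_proj_mul_dir hφ0, add_sub_cancel]
  set D := S.wound φ + proj φ (z - S.anchor φ) with hDdef
  have hDlow : (w + D₀) / 2 < D := by
    have h1 : proj φ (z - S.anchor φ) = proj φ (z - S.tip φ₀ D₀) + ρ * Real.cos (φ₀ - φ) +
        proj φ (S.anchor φ₀ - S.anchor φ) := by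
      rw [← proj_mul_dir φ ρ φ₀, ← proj_add, ← proj_add, hz₀]; congr 1; ring
    have h2 := (abs_le.1 (abs_proj_le φ (z - S.tip φ₀ D₀))).1
    have h3 := hcos (φ₀ - φ) (by rw [abs_sub_comm]; linarith)
    have h4 := Real.cos_le_one (φ₀ - φ)
    rcases le_total φ φ₀ with h | h
    · have h5 := S.turning_anchor (θ := φ) (c := Real.cos (φ₀ - φ)) h hs.le fun s hs' =>
        cos_le_cos_of_abs_le (abs_le.2 ⟨by linarith [hs'.1], by linarith [hs'.2]⟩)
          (by linarith [hφ.1])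
      have h6 := S.neg_le_wound hφs
      nlinarith
    · have h5 := (proj_le φ _).trans (S.norm_anchor_sub_le h hφs)
      have h6 : proj φ (S.anchor φ₀ - S.anchor φ) = -proj φ (S.anchor φ - S.anchor φ₀) := by
        rw [← proj_neg, neg_sub]
      nlinarith
  have hm : w + ρ / 2 = (w + D₀) / 2 := by rw [hρ]; ring
  refine ⟨φ, D, habs.trans_lt hdδ, hφs, hzt, hDlow, hm ▸ hφw, ?_⟩
  rw [abs_le, hzt]
  rcases le_total φ φ₀ with h | h
  · constructor
    · have := sub_le_norm_tip_sub_of_ge (S := S) (D₁ := D₀) (D₂ := D) h hs.le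
        (by linarith [hφ.1]) (by linarith)
      rw [norm_sub_rev] at this
      linarith
    · exact sub_le_norm_tip_sub_of_le h hs.le hD.le
  · constructor
    · have := sub_le_norm_tip_sub_of_le (S := S) (D₁ := D₀) (D₂ := D) h hφs (by linarith)
      rw [norm_sub_rev] at this
      linarith
    · exact sub_le_norm_tip_sub_of_ge h hφs (by linarith [hφ.2]) (by linarith)

/-! ### The fire stays in the reached region -/

theorem continuousAt_len {φ : ℝ} (h : φ ∈ Set.Ioo 0 S.last) : ContinuousAt S.len φ :=
  (S.continuousOn_len φ ⟨by linarith [h.1, S.α_pos], h.2.le⟩).continuousAt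
    (Icc_mem_nhds (by linarith [h.1, S.α_pos]) h.2)

theorem tip_eq (φ ρ : ℝ) : S.anchor φ + ((ρ : ℝ) : ℂ) * dir φ = S.tip φ (S.wound φ + ρ) := by
  rw [tip, add_sub_cancel_left]

variable {S} in
theorem reached_tip {φ D r : ℝ} (hφ : φ ∈ Set.Ioo 0 S.last) (h1 : S.wound φ < D)
    (h2 : D < S.len φ * Real.cos α) (h3 : D ≤ r) : S.Reached r (S.tip φ D) :=
  Or.inr ⟨φ, hφ, D - S.wound φ, sub_pos.2 h1, rfl, by linarith, by linarith⟩

variable {S} in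
/-- Off the barrier, fire that is within the reached region stays there for a while. -/
theorem Reached.exists_forall {r : ℝ} {z : ℂ} (h : S.Reached r z) :
    ∃ ε > 0, ∀ r' z', r' < r + ε → ‖z' - z‖ ≤ r' - r → S.Reached r' z' := by
  rcases h with h | ⟨φ, hφ, ρ, hρ, e, h1, h2⟩
  · refine ⟨A - ‖z‖, by linarith, fun r' z' h1 h2 => Or.inl ?_⟩
    have := norm_add_le z (z' - z)
    rw [add_sub_cancel] at this
    linarith
  · rw [tip_eq] at e
    set D := S.wound φ + ρ with hD
    set g := S.len φ * Real.cos α - D with hg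
    have hg0 : 0 < g := sub_pos.2 h1
    have hc : ContinuousAt (fun x => S.len x * Real.cos α) φ :=
      (S.continuousAt_len hφ).mul continuousAt_const
    rw [Metric.continuousAt_iff] at hc
    obtain ⟨δ, hδ, hd⟩ := hc (g / 2) (by linarith)
    obtain ⟨η, hη, hch⟩ := S.exists_chart (φ₀ := φ) (D₀ := D)
      (lt_min hδ (lt_min hφ.1 (sub_pos.2 hφ.2))) hφ.2 (by linarith)
    refine ⟨min η (g / 2), by positivity, fun r' z' hr' hz' => ?_⟩
    have hr1 : r' - r < η := by have := min_le_left η (g / 2); linarith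
    have hr2 : r' - r < g / 2 := by have := min_le_right η (g / 2); linarith
    rw [e] at hz'
    obtain ⟨φ', D', hφ', -, e', hD1, hD2, hD3⟩ := hch z' (hz'.trans_lt hr1)
    have a1 := hφ'.trans_le (min_le_left _ _)
    have a2 := hφ'.trans_le ((min_le_right _ _).trans (min_le_left _ _))
    have a3 := hφ'.trans_le ((min_le_right _ _).trans (min_le_right _ _))
    have a4 := (abs_lt.1 (hd (x := φ') (by rw [Real.dist_eq]; exact a1))).1
    have a5 := (abs_le.1 hD3).2
    rw [e']
    exact reached_tip ⟨by linarith [(abs_lt.1 a2).1], by linarith [(abs_lt.1 a3).2]⟩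
      (by linarith) (by linarith) (by linarith)

/-- The closure in space-time of the reached region, restricted to strings with directions in
`I` and to the closed initial disc. The strings with directions in `[0, 2π]`, anchored at the
origin, and those with directions at least `2π` are listed separately because of the jump of the
anchor. Strings are parametrized by `[0, 1]`, so that compactness applies. -/
def closedReach (I : Set ℝ) : Set (ℝ × ℂ) :=
  {p | ‖p.2‖ ≤ A} ∪
  {p | ∃ k ∈ (I ∩ Set.Icc 0 (2 * Real.pi)) ×ˢ Set.Icc (0 : ℝ) 1,
    p.2 = ((A + k.2 * (S.len k.1 * Real.cos α) : ℝ) : ℂ) * dir k.1 ∧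
      k.2 * (S.len k.1 * Real.cos α) ≤ p.1} ∪
  {p | ∃ k ∈ (I ∩ Set.Icc (2 * Real.pi) S.last) ×ˢ Set.Icc (0 : ℝ) 1,
    p.2 = S.tip k.1 (S.wound k.1 + k.2 * (S.len k.1 * Real.cos α - S.wound k.1)) ∧
      S.wound k.1 + k.2 * (S.len k.1 * Real.cos α - S.wound k.1) ≤ p.1}

open scoped Pointwise in
theorem isClosed_setOf_exists {X : Type*} [TopologicalSpace X] {K : Set X} (hK : IsCompact K)
    {f : X → ℂ} {h : X → ℝ} (hf : ContinuousOn f K) (hh : ContinuousOn h K) :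
    IsClosed {p : ℝ × ℂ | ∃ k ∈ K, p.2 = f k ∧ h k ≤ p.1} := by
  have h1 : IsCompact ((fun k => (h k, f k)) '' K) := hK.image_of_continuousOn (hh.prodMk hf)
  have h2 : IsClosed ((Set.Ici (0 : ℝ)) ×ˢ ({0} : Set ℂ)) := isClosed_Ici.prod isClosed_singleton
  convert h2.add_left_of_isCompact h1 using 1
  ext p
  rw [Set.mem_add]
  constructor
  · rintro ⟨k, hk, e, hp⟩
    refine ⟨(h k, f k), ⟨k, hk, rfl⟩, (p.1 - h k, 0), ⟨sub_nonneg.2 hp, rfl⟩, ?_⟩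
    ext1
    · simp
    · simp [e]
  · rintro ⟨_, ⟨k, hk, rfl⟩, q, ⟨hq1, hq2⟩, rfl⟩
    have hq2 : q.2 = 0 := hq2
    have hq1 : 0 ≤ q.1 := hq1
    exact ⟨k, hk, by simp [hq2], by simpa using hq1⟩

theorem isClosed_closedReach {I : Set ℝ} (hI : IsClosed I) : IsClosed (S.closedReach I) := by
  have hst := S.lt_last
  have hα := S.α_pos
  have hπ := Real.pi_pos
  have c1 : ∀ a b : ℝ, IsCompact ((I ∩ Set.Icc a b) ×ˢ Set.Icc (0 : ℝ) 1) := fun a b =>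
    (isCompact_Icc.inter_left hI).prod isCompact_Icc
  have fst : ∀ a b : ℝ, ∀ f : ℝ → ℝ, ContinuousOn f (Set.Icc a b) →
      ContinuousOn (fun k : ℝ × ℝ => f k.1) ((I ∩ Set.Icc a b) ×ˢ Set.Icc (0 : ℝ) 1) :=
    fun a b f hf => hf.comp continuous_fst.continuousOn fun k hk => hk.1.2
  refine ((isClosed_le (by fun_prop) continuous_const).union (isClosed_setOf_exists (c1 _ _)
    (f := fun k : ℝ × ℝ => ((A + k.2 * (S.len k.1 * Real.cos α) : ℝ) : ℂ) * dir k.1)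
    (h := fun k : ℝ × ℝ => k.2 * (S.len k.1 * Real.cos α)) ?_ ?_)).union
    (isClosed_setOf_exists (c1 _ _)
    (f := fun k : ℝ × ℝ =>
      S.tip k.1 (S.wound k.1 + k.2 * (S.len k.1 * Real.cos α - S.wound k.1)))
    (h := fun k : ℝ × ℝ => S.wound k.1 + k.2 * (S.len k.1 * Real.cos α - S.wound k.1)) ?_ ?_)
  all_goals
    have hl1 := fst 0 (2 * Real.pi) _ (S.continuousOn_len.mono
      (Set.Icc_subset_Icc (by linarith) (by linarith)))
    have hl2 := fst (2 * Real.pi) S.last _ (S.continuousOn_len.mono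
      (Set.Icc_subset_Icc (by linarith) le_rfl))
    have hw := fst _ _ _ S.continuousOn_wound
  · exact (Complex.continuous_ofReal.comp_continuousOn (continuousOn_const.add
      (continuous_snd.continuousOn.mul (hl1.mul continuousOn_const)))).mul
      (continuous_dir.comp continuous_fst).continuousOn
  · exact continuous_snd.continuousOn.mul (hl1.mul continuousOn_const)
  · have ha : ContinuousOn (fun k : ℝ × ℝ => S.anchor k.1)
        ((I ∩ Set.Icc (2 * Real.pi) S.last) ×ˢ Set.Icc (0 : ℝ) 1) :=
      S.continuousOn_anchor.comp continuous_fst.continuousOn fun k hk => hk.1.2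
    exact ha.add ((Complex.continuous_ofReal.comp_continuousOn ((hw.add
      (continuous_snd.continuousOn.mul ((hl2.mul continuousOn_const).sub hw))).sub hw)).mul
      (continuous_dir.comp continuous_fst).continuousOn)
  · exact hw.add (continuous_snd.continuousOn.mul ((hl2.mul continuousOn_const).sub hw))

theorem pos_eq_of_le {φ : ℝ} (h0 : 0 ≤ φ) (h1 : φ ≤ 2 * Real.pi) :
    S.pos φ = ((A + S.len φ * Real.cos α : ℝ) : ℂ) * dir φ := by
  rw [S.pos_eq_anchor ⟨h0, by linarith [S.lt_last, S.α_pos]⟩]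
  rcases h1.lt_or_eq with h | h
  · rw [S.anchor_of_lt h, S.wound_of_lt h, zero_add, sub_neg_eq_add, add_comm A]
  · rw [S.anchor_of_le h.ge (by linarith [S.α_pos]), S.wound_of_le h.ge (by linarith [S.α_pos])]
    have : dir φ = 1 := by rw [h, ← zero_add (2 * Real.pi), dir_add_two_pi, dir_zero]
    rw [this]
    push_cast
    ring

theorem exists_pos_eq_anchor {φ : ℝ} (h0 : 2 * Real.pi ≤ φ) (h1 : φ ≤ S.last) :
    ∃ ψ ∈ Set.Icc 0 S.last, S.pos ψ = S.anchor φ ∧ S.len ψ * Real.cos α ≤ S.wound φ := by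
  rcases le_or_gt φ (2 * Real.pi + α) with h | h
  · refine ⟨0, ⟨le_rfl, S.last_pos.le⟩, ?_, ?_⟩
    · rw [S.pos_zero, S.anchor_of_le h0 h]
    · rw [S.len_zero, S.wound_of_le h0 h, zero_mul]
  · have hm : φ - (2 * Real.pi + α) ≤ S.last := by linarith [S.α_pos, Real.pi_pos]
    refine ⟨φ - (2 * Real.pi + α), ⟨by linarith, hm⟩, rfl, ?_⟩
    exact mul_le_of_le_one_right (S.len_nonneg (by linarith [S.α_pos]) hm) (Real.cos_le_one _)

variable {S} in
/-- The boundary of the reached region consists of points of the barrier that exists when the fire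
arrives there. -/
theorem reached_of_mem_closedReach {r : ℝ} {z : ℂ} (hr : 0 ≤ r)
    (h : (r, z) ∈ S.closedReach Set.univ)
    (hav : ∀ φ ∈ Set.Icc 0 S.last, S.len φ * Real.cos α ≤ r → z ≠ S.pos φ) : S.Reached r z := by
  have hst := S.lt_last
  have hα := S.α_pos
  have hπ := Real.pi_pos
  have hA : z ≠ A := by
    rw [← S.pos_zero]
    exact hav 0 ⟨le_rfl, S.last_pos.le⟩ (by rw [S.len_zero, zero_mul]; exact hr)
  have disc : ∀ φ, 0 ≤ φ → φ ≤ 2 * Real.pi → z = (A : ℂ) * dir φ → S.Reached r z := by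
    intro φ h0 h1 e
    have h0' : φ ≠ 0 := by
      rintro rfl
      rw [dir_zero, mul_one] at e
      exact hA e
    have h1' : φ ≠ 2 * Real.pi := by
      rintro rfl
      rw [← zero_add (2 * Real.pi), dir_add_two_pi, dir_zero, mul_one] at e
      exact hA e
    have h0 := lt_of_le_of_ne h0 h0'.symm
    have h1 := lt_of_le_of_ne h1 h1'
    refine Or.inr ⟨φ, ⟨h0, by linarith⟩, A, S.A_pos, ?_, ?_, ?_⟩
    · rw [S.anchor_of_lt h1, zero_add, e]
    · rw [S.wound_of_lt h1, neg_add_cancel]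
      exact mul_pos (S.len_pos h0 (by linarith)) S.cos_pos
    · rw [S.wound_of_lt h1, neg_add_cancel]
      exact hr
  rcases h with (h | ⟨⟨φ, t⟩, ⟨⟨-, hφ⟩, ht⟩, e, h1⟩) | ⟨⟨φ, t⟩, ⟨⟨-, hφ⟩, ht⟩, e, h1⟩
  · rcases (show ‖z‖ ≤ A from h).lt_or_eq with h | h
    · exact Or.inl h
    · obtain ⟨φ, h0, h1, e⟩ := exists_polar (z := z)
      rw [h] at e
      exact disc φ h0 h1.le e
  · simp only at e h1 hφ ht
    rcases hφ.1.lt_or_eq with h0 | h0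
    swap
    · rw [← h0, S.len_zero, zero_mul, mul_zero, add_zero] at e
      exact disc 0 le_rfl (by linarith) e
    have hl := mul_pos (S.len_pos h0 (by linarith [hφ.2])) S.cos_pos
    rcases ht.2.lt_or_eq with h2 | h2
    swap
    · rw [h2, one_mul] at e h1
      rw [← S.pos_eq_of_le hφ.1 hφ.2] at e
      exact absurd e (hav φ ⟨hφ.1, by linarith [hφ.2]⟩ h1)
    rcases ht.1.lt_or_eq with h3 | h3
    swap
    · rw [← h3, zero_mul, add_zero] at e
      exact disc φ hφ.1 hφ.2 e
    have h4 := mul_pos h3 hl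
    have h5 := mul_lt_of_lt_one_left hl h2
    rcases hφ.2.lt_or_eq with h6 | h6
    · refine Or.inr ⟨φ, ⟨h0, by linarith⟩, A + t * (S.len φ * Real.cos α),
        by linarith [S.A_pos], ?_, ?_, ?_⟩
      · rw [S.anchor_of_lt h6, zero_add, e]
      · rw [S.wound_of_lt h6]; linarith
      · rw [S.wound_of_lt h6]; linarith
    · have hd : dir φ = 1 := by rw [h6, ← zero_add (2 * Real.pi), dir_add_two_pi, dir_zero]
      refine Or.inr ⟨φ, ⟨h0, by linarith⟩, t * (S.len φ * Real.cos α), h4, ?_, ?_, ?_⟩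
      · rw [S.anchor_of_le h6.ge (by linarith), e, hd]
        push_cast
        ring
      · rw [S.wound_of_le h6.ge (by linarith)]; linarith
      · rw [S.wound_of_le h6.ge (by linarith)]; linarith
  · simp only at e h1 hφ ht
    have base : z = S.anchor φ → S.wound φ ≤ r → False := by
      intro e' h'
      obtain ⟨ψ, hψ, e2, h2⟩ := S.exists_pos_eq_anchor hφ.1 hφ.2
      exact hav ψ hψ (h2.trans h') (e'.trans e2.symm)
    rcases hφ.2.lt_or_eq with h0 | h0
    swap
    · have hF0 : S.len φ * Real.cos α - S.wound φ = 0 := by rw [h0, S.wound_last, sub_self]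
      rw [hF0, mul_zero, add_zero] at e h1
      rw [tip, sub_self, Complex.ofReal_zero, zero_mul, add_zero] at e
      exact (base e h1).elim
    have hF := S.wound_lt (x := φ) ⟨by linarith [hφ.1], h0⟩
    rcases ht.1.lt_or_eq with h3 | h3
    swap
    · rw [← h3, zero_mul, add_zero] at e h1
      rw [tip, sub_self, Complex.ofReal_zero, zero_mul, add_zero] at e
      exact (base e h1).elim
    rcases ht.2.lt_or_eq with h2 | h2
    swap
    · rw [h2, one_mul, add_sub_cancel] at e h1
      rw [tip, ← S.pos_eq_anchor ⟨by linarith [hφ.1], hφ.2⟩] at e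
      exact absurd e (hav φ ⟨by linarith [hφ.1], hφ.2⟩ h1)
    rw [e]
    have h4 := mul_pos h3 (sub_pos.2 hF)
    have h5 := mul_lt_of_lt_one_left (sub_pos.2 hF) h2
    exact reached_tip ⟨by linarith [hφ.1], h0⟩ (by linarith) (by linarith) h1

variable {S} in
theorem Reached.mem_closedReach_or {r : ℝ} {z : ℂ} (h : S.Reached r z) (I : Set ℝ) :
    (r, z) ∈ S.closedReach I ∨ ∃ φ D, φ ∈ Set.Ioo 0 S.last ∧ φ ∉ I ∧ S.wound φ < D ∧
      D < S.len φ * Real.cos α ∧ D ≤ r ∧ z = S.tip φ D := by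
  rcases h with h | ⟨φ, hφ, ρ, hρ, e, h1, h2⟩
  · exact Or.inl (Or.inl (Or.inl (show ‖z‖ ≤ A from h.le)))
  · by_cases hI : φ ∈ I
    swap
    · exact Or.inr ⟨φ, S.wound φ + ρ, hφ, hI, by linarith, h1, h2, by rw [e, tip_eq]⟩
    · left
      rcases lt_or_ge φ (2 * Real.pi) with h3 | h3
      · rw [S.wound_of_lt h3] at h1 h2
        rw [S.anchor_of_lt h3, zero_add] at e
        rcases le_or_gt ρ A with h4 | h4
        · refine Or.inl (Or.inl (show ‖z‖ ≤ A from ?_))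
          rw [e, norm_mul_dir, abs_of_pos hρ]
          exact h4
        · have hl := mul_pos (S.len_pos hφ.1 hφ.2.le) S.cos_pos
          have e2 : (ρ - A) / (S.len φ * Real.cos α) * (S.len φ * Real.cos α) = ρ - A :=
            div_mul_cancel₀ _ hl.ne'
          refine Or.inl (Or.inr ⟨(φ, (ρ - A) / (S.len φ * Real.cos α)),
            ⟨⟨hI, hφ.1.le, h3.le⟩, ⟨div_nonneg (by linarith) hl.le, ?_⟩⟩, ?_, ?_⟩)
          · rw [div_le_one hl]; linarith
          · simp only [e2, e, add_sub_cancel]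
          · simp only [e2]; linarith
      · have hF := S.wound_lt (x := φ) ⟨hφ.1.le, hφ.2⟩
        have hF0 := sub_pos.2 hF
        have e2 : ρ / (S.len φ * Real.cos α - S.wound φ) * (S.len φ * Real.cos α - S.wound φ) = ρ :=
          div_mul_cancel₀ _ hF0.ne'
        refine Or.inr ⟨(φ, ρ / (S.len φ * Real.cos α - S.wound φ)),
          ⟨⟨hI, h3, hφ.2.le⟩, ⟨div_nonneg hρ.le hF0.le, ?_⟩⟩, ?_, ?_⟩
        · rw [div_le_one hF0]; linarith
        · simp only [e2, e, tip_eq]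
        · simp only [e2]; exact h2

variable {S} in
/-- The fire cannot leave the reached region: it could do so only through the barrier. -/
theorem reached_of_path {s : ℝ} {x : ℝ → ℂ} (h0 : ‖x 0‖ ≤ A)
    (hl : LipschitzOnWith 1 x (Set.Icc 0 s))
    (hav : ∀ r ∈ Set.Icc 0 s, ∀ φ ∈ Set.Icc 0 S.last, S.len φ * Real.cos α ≤ r →
      x r ≠ S.pos φ) : ∀ r ∈ Set.Icc 0 s, S.Reached r (x r) := by
  have key : Set.Icc 0 s ⊆ {r | (r, x r) ∈ S.closedReach Set.univ} := by
    refine IsClosed.Icc_subset_of_forall_mem_nhdsWithin ?_ ?_ ?_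
    · have hc : ContinuousOn (fun r => (r, x r)) (Set.Icc 0 s) :=
        continuousOn_id.prodMk hl.continuousOn
      have := hc.preimage_isClosed_of_isClosed isClosed_Icc
        (S.isClosed_closedReach isClosed_univ)
      rwa [Set.inter_comm] at this
    · exact Or.inl (Or.inl h0)
    · rintro r ⟨hr, hr2⟩
      have hre : S.Reached r (x r) := reached_of_mem_closedReach hr2.1 hr
        (hav r ⟨hr2.1, hr2.2.le⟩)
      obtain ⟨ε, hε, h⟩ := hre.exists_forall
      have hlt : r < min s (r + ε) := lt_min hr2.2 (by linarith)
      filter_upwards [Ioo_mem_nhdsGT hlt] with r' hr'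
      have h1 : r' < s := hr'.2.trans_le (min_le_left _ _)
      have h2 : r' < r + ε := hr'.2.trans_le (min_le_right _ _)
      have h3 : ‖x r' - x r‖ ≤ r' - r := by
        have := hl.dist_le_mul r' ⟨by linarith [hr2.1, hr'.1], h1.le⟩ r ⟨hr2.1, hr2.2.le⟩
        rwa [dist_eq_norm, Real.dist_eq, abs_of_pos (by linarith [hr'.1]), NNReal.coe_one,
          one_mul] at this
      have h4 := (h r' (x r') h2 h3).mem_closedReach_or Set.univ
      rcases h4 with h4 | ⟨_, _, _, h4, _⟩
      · exact h4
      · exact absurd (Set.mem_univ _) h4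
  exact fun r hr => reached_of_mem_closedReach hr.1 (key hr) (hav r hr)

variable {S} in
theorem Reached.norm_le {r : ℝ} {z : ℂ} (h : S.Reached r z) :
    ‖z‖ ≤ A + S.len S.last * Real.cos α := by
  rcases h with h | ⟨φ, hφ, ρ, hρ, e, h1, -⟩
  · have := mul_nonneg (S.len_nonneg (x := S.last) (by linarith [S.last_pos, S.α_pos]) le_rfl)
      S.cos_pos.le
    linarith
  · have h2 := S.norm_anchor_sub_le (x := 0) (y := φ) hφ.1.le hφ.2.le
    rw [S.anchor_of_lt (φ := 0) (by positivity), S.wound_of_lt (φ := 0) (by positivity),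
      sub_zero] at h2
    have h3 := norm_add_le (S.anchor φ) (((ρ : ℝ) : ℂ) * dir φ)
    rw [norm_mul_dir, abs_of_pos hρ, ← e] at h3
    have h4 := mul_le_mul_of_nonneg_right (S.len_mono hφ.2.le le_rfl) S.cos_pos.le
    linarith

end StringSpiral

/-! ### Paths of the fire along the barrier -/

theorem LipschitzOnWith.of_norm_sub_le {x : ℝ → ℂ} {s : Set ℝ}
    (h : ∀ a ∈ s, ∀ b ∈ s, a ≤ b → ‖x b - x a‖ ≤ b - a) : LipschitzOnWith 1 x s := by
  refine LipschitzOnWith.of_dist_le_mul fun a ha b hb => ?_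
  rw [NNReal.coe_one, one_mul, Real.dist_eq]
  rcases le_total a b with hab | hab
  · rw [dist_comm, dist_eq_norm, abs_sub_comm, abs_of_nonneg (sub_nonneg.2 hab)]
    exact h a ha b hb hab
  · rw [dist_eq_norm, abs_of_nonneg (sub_nonneg.2 hab)]
    exact h b hb a ha hab

/-- A curve whose increments are bounded by those of a continuous function `g` can be
reparametrized by the values of `g`, with unit speed. -/
theorem exists_reparam {X : ℝ → ℂ} {g : ℝ → ℝ} {a b : ℝ} (hab : a ≤ b)
    (hg : ContinuousOn g (Set.Icc a b)) (ha : g a = 0)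
    (hX : ∀ u ∈ Set.Icc a b, ∀ u' ∈ Set.Icc a b, u ≤ u' → ‖X u' - X u‖ ≤ g u' - g u) :
    ∃ x : ℝ → ℂ, x 0 = X a ∧ x (g b) = X b ∧ LipschitzOnWith 1 x (Set.Icc 0 (g b)) ∧
      ∀ r ∈ Set.Icc 0 (g b), ∃ u ∈ Set.Icc a b, x r = X u := by
  have hsurj : ∀ r ∈ Set.Icc 0 (g b), ∃ u ∈ Set.Icc a b, g u = r := by
    intro r hr
    rw [← ha] at hr
    exact intermediate_value_Icc hab hg hr
  choose! u hu hgu using hsurj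
  have key : ∀ r ∈ Set.Icc 0 (g b), ∀ v ∈ Set.Icc a b, ‖X v - X (u r)‖ ≤ |g v - r| := by
    intro r hr v hv
    rcases le_total (u r) v with h | h
    · have := hX _ (hu r hr) v hv h
      rw [hgu r hr] at this
      exact this.trans (le_abs_self _)
    · have := hX v hv _ (hu r hr) h
      rw [hgu r hr] at this
      rw [norm_sub_rev, abs_sub_comm]
      exact this.trans (le_abs_self _)
  have hgb : 0 ≤ g b := by
    have := (norm_nonneg _).trans
      (hX a (Set.left_mem_Icc.2 hab) b (Set.right_mem_Icc.2 hab) hab)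
    linarith
  have ends : ∀ r ∈ Set.Icc 0 (g b), ∀ v ∈ Set.Icc a b, g v = r → X (u r) = X v := by
    intro r hr v hv e
    have := key r hr v hv
    rw [e, sub_self, abs_zero] at this
    exact (sub_eq_zero.1 (norm_le_zero_iff.1 this)).symm
  refine ⟨fun r => X (u r), ?_, ?_, ?_, fun r hr => ⟨u r, hu r hr, rfl⟩⟩
  · exact ends 0 ⟨le_rfl, hgb⟩ a (Set.left_mem_Icc.2 hab) ha
  · exact ends (g b) ⟨hgb, le_rfl⟩ b (Set.right_mem_Icc.2 hab) rfl
  · refine LipschitzOnWith.of_norm_sub_le fun r hr r' hr' hrr' => ?_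
    have := key r hr (u r') (hu r' hr')
    rwa [hgu r' hr', abs_of_nonneg (sub_nonneg.2 hrr')] at this

theorem norm_dir_sub_dir_le {x y : ℝ} (h : x ≤ y) : ‖dir y - dir x‖ ≤ y - x := by
  have := Convex.norm_image_sub_le_of_norm_hasDerivWithin_le (f := dir)
    (f' := fun φ => dir (φ + Real.pi / 2)) (C := 1) (s := Set.univ)
    (fun φ _ => (hasDerivAt_dir φ).hasDerivWithinAt) (fun φ _ => (norm_dir _).le) convex_univ
    (Set.mem_univ x) (Set.mem_univ y)
  rwa [one_mul, Real.norm_eq_abs, abs_of_nonneg (sub_nonneg.2 h)] at this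

namespace StringSpiral

variable {A α : ℝ} (S : StringSpiral A α)

theorem Reached.ne_pos {S : StringSpiral A α} {r : ℝ} {z : ℂ} (h : S.Reached r z) :
    ∀ ψ ∈ Set.Icc 0 S.last, z ≠ S.pos ψ := by
  rintro ψ hψ rfl
  exact S.not_reached_pos hψ h

theorem exists_lt_free {φ : ℝ} (h0 : 2 * Real.pi ≤ φ) (h1 : φ < S.last) :
    ∃ m > 0, ∀ θ ∈ Set.Icc (2 * Real.pi) φ, S.wound θ + m < S.len θ * Real.cos α := by
  have hc : ContinuousOn (fun θ => S.len θ * Real.cos α - S.wound θ)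
      (Set.Icc (2 * Real.pi) φ) :=
    ((S.continuousOn_len.mono (Set.Icc_subset_Icc
      (by linarith [Real.pi_pos, S.α_pos]) h1.le)).mul continuousOn_const).sub
      (S.continuousOn_wound.mono (Set.Icc_subset_Icc_right h1.le))
  obtain ⟨θ₀, hθ₀, hmin⟩ := isCompact_Icc.exists_isMinOn (Set.nonempty_Icc.2 h0) hc
  have hpos := S.wound_lt (x := θ₀) ⟨by linarith [hθ₀.1, Real.pi_pos], by linarith [hθ₀.2]⟩
  refine ⟨(S.len θ₀ * Real.cos α - S.wound θ₀) / 2, by linarith, fun θ hθ => ?_⟩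
  have : S.len θ₀ * Real.cos α - S.wound θ₀ ≤ S.len θ * Real.cos α - S.wound θ := hmin hθ
  linarith

/-- The fire that starts just clockwise of the point `A` follows the outer side of the barrier at
a small distance. -/
theorem exists_wrap_path {φ σ : ℝ} (h0 : 2 * Real.pi ≤ φ) (h1 : φ < S.last) (hσ : 0 < σ) :
    ∃ (s D₀ : ℝ) (x : ℝ → ℂ), 0 ≤ s ∧ s ≤ S.wound φ + σ ∧ S.wound φ < D₀ ∧
      D₀ ≤ S.wound φ + σ ∧ ‖x 0‖ ≤ A ∧ LipschitzOnWith 1 x (Set.Icc 0 s) ∧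
      (∀ r ∈ Set.Icc 0 s, ∀ ψ ∈ Set.Icc 0 S.last, x r ≠ S.pos ψ) ∧ x s = S.tip φ D₀ := by
  have hπ := Real.pi_pos
  have hA := S.A_pos
  have hα := S.α_pos
  have hφ : 0 < φ := by linarith
  obtain ⟨m, hm, hfree⟩ := S.exists_lt_free h0 h1
  have hlenπ := mul_pos (S.len_pos hπ (by linarith)) S.cos_pos
  -- `ε` is the distance from the barrier, `η` the angle of the starting point
  set ε := min m (min (S.len Real.pi * Real.cos α / 2) (σ / (3 * (1 + φ)))) with hε
  have hε0 : 0 < ε := lt_min hm (lt_min (by linarith) (by positivity))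
  have hεm : ε ≤ m := min_le_left _ _
  have hεl : ε < S.len Real.pi * Real.cos α :=
    ((min_le_right _ _).trans (min_le_left _ _)).trans_lt (by linarith)
  have hεσ : ε * (3 * (1 + φ)) ≤ σ := by
    rw [← le_div_iff₀ (by positivity)]
    exact (min_le_right _ _).trans (min_le_right _ _)
  set η := min (Real.pi / 2) (σ / (3 * (A + ε))) with hη
  have hη0 : 0 < η := by positivity
  have hηπ : η < Real.pi := (min_le_left _ _).trans_lt (by linarith)
  have hησ : η * (3 * (A + ε)) ≤ σ := by
    rw [← le_div_iff₀ (by positivity)]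
    exact min_le_right _ _
  -- the path spirals outwards by `ε` until direction `2π`, then the string keeps length `ε`
  set rad : ℝ → ℝ := fun u => A + ε / η * (u - (2 * Real.pi - η)) with hrad
  set X : ℝ → ℂ := fun u => (rad (min u (2 * Real.pi)) : ℂ) * dir (min u (2 * Real.pi)) +
    (S.anchor (max u (2 * Real.pi)) - A + ε * (dir (max u (2 * Real.pi)) - 1)) with hX
  set g : ℝ → ℝ := fun u => (ε / η + (A + ε)) * (min u (2 * Real.pi) - (2 * Real.pi - η)) +
    (S.wound (max u (2 * Real.pi)) + ε * (max u (2 * Real.pi) - 2 * Real.pi)) with hg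
  have hd2 : dir (2 * Real.pi) = 1 := by
    rw [← zero_add (2 * Real.pi), dir_add_two_pi, dir_zero]
  have hrad2 : rad (2 * Real.pi) = A + ε := by
    simp only [hrad]; field_simp; ring
  have hX1 : ∀ u, u ≤ 2 * Real.pi → X u = (rad u : ℂ) * dir u := by
    intro u hu
    simp only [hX, min_eq_left hu, max_eq_right hu, hd2, S.anchor_of_le le_rfl
      (by linarith : 2 * Real.pi ≤ 2 * Real.pi + α)]
    ring
  have hX2 : ∀ u, 2 * Real.pi ≤ u → X u = S.tip u (S.wound u + ε) := by
    intro u hu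
    simp only [hX, min_eq_right hu, max_eq_left hu, hd2, hrad2]
    rw [← tip_eq]
    push_cast
    ring
  have hg2 : ∀ u, 2 * Real.pi ≤ u → g u = ε + η * (A + ε) + (S.wound u + ε * (u - 2 * Real.pi)) := by
    intro u hu
    simp only [hg, min_eq_right hu, max_eq_left hu]
    field_simp
    ring
  have hga : g (2 * Real.pi - η) = 0 := by
    have : 2 * Real.pi - η ≤ 2 * Real.pi := by linarith
    simp only [hg, min_eq_left this, max_eq_right this]
    rw [S.wound_of_le le_rfl (by linarith)]
    ring
  have hcont : ContinuousOn g (Set.Icc (2 * Real.pi - η) φ) := by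
    have hw : ContinuousOn (fun u => S.wound (max u (2 * Real.pi)))
        (Set.Icc (2 * Real.pi - η) φ) :=
      S.continuousOn_wound.comp (by fun_prop) fun u hu =>
        ⟨le_max_right _ _, max_le (by linarith [hu.2]) (by linarith)⟩
    exact (Continuous.continuousOn (by fun_prop)).add
      (hw.add (Continuous.continuousOn (by fun_prop)))
  have hdist : ∀ u ∈ Set.Icc (2 * Real.pi - η) φ, ∀ u' ∈ Set.Icc (2 * Real.pi - η) φ, u ≤ u' →
      ‖X u' - X u‖ ≤ g u' - g u := by
    intro u hu u' hu' huu'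
    have hm1 : min u (2 * Real.pi) ≤ min u' (2 * Real.pi) := min_le_min_right _ huu'
    have hm2 : max u (2 * Real.pi) ≤ max u' (2 * Real.pi) := max_le_max_right _ huu'
    have hM : max u' (2 * Real.pi) ≤ S.last := max_le (by linarith [hu'.2]) (by linarith)
    have hm3 : 2 * Real.pi - η ≤ min u (2 * Real.pi) := le_min hu.1 (by linarith)
    have hm4 : min u (2 * Real.pi) ≤ 2 * Real.pi := min_le_right _ _
    set p := min u (2 * Real.pi)
    set p' := min u' (2 * Real.pi)
    set q := max u (2 * Real.pi)
    set q' := max u' (2 * Real.pi)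
    have e : X u' - X u = (((rad p' - rad p : ℝ) : ℂ) * dir p' +
        (rad p : ℂ) * (dir p' - dir p)) + ((S.anchor q' - S.anchor q) +
        (ε : ℂ) * (dir q' - dir q)) := by
      simp only [hX]; push_cast; ring
    have b1 : ‖((rad p' - rad p : ℝ) : ℂ) * dir p'‖ ≤ ε / η * (p' - p) := by
      have : rad p' - rad p = ε / η * (p' - p) := by simp only [hrad]; ring
      rw [norm_mul_dir, this, abs_of_nonneg (mul_nonneg (by positivity) (by linarith))]
    have hr0 : 0 ≤ rad p := by
      have : 0 ≤ ε / η * (p - (2 * Real.pi - η)) := mul_nonneg (by positivity) (by linarith)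
      simp only [hrad]; linarith
    have hr1 : rad p ≤ A + ε := by
      rw [← hrad2]; simp only [hrad]; gcongr
    have b2 : ‖(rad p : ℂ) * (dir p' - dir p)‖ ≤ (A + ε) * (p' - p) := by
      rw [norm_mul, Complex.norm_real, Real.norm_eq_abs, abs_of_nonneg hr0]
      exact mul_le_mul hr1 (norm_dir_sub_dir_le hm1) (norm_nonneg _) (by linarith)
    have b3 := S.norm_anchor_sub_le hm2 hM
    have b4 : ‖(ε : ℂ) * (dir q' - dir q)‖ ≤ ε * (q' - q) := by
      rw [norm_mul, Complex.norm_real, Real.norm_eq_abs, abs_of_pos hε0]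
      exact mul_le_mul_of_nonneg_left (norm_dir_sub_dir_le hm2) hε0.le
    rw [e]
    refine (norm_add_le_of_le (norm_add_le_of_le b1 b2) (norm_add_le_of_le b3 b4)).trans_eq ?_
    simp only [hg]
    ring
  obtain ⟨x, hx0, hx1, hxl, hxm⟩ := exists_reparam (by linarith) hcont hga hdist
  refine ⟨g φ, S.wound φ + ε, x, ?_, ?_, by linarith, ?_, ?_, hxl, ?_, ?_⟩
  · have := (norm_nonneg _).trans (hdist _ (Set.left_mem_Icc.2 (by linarith)) φ
      (Set.right_mem_Icc.2 (by linarith)) (by linarith))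
    linarith
  · rw [hg2 φ h0]
    nlinarith
  · nlinarith
  · rw [hx0, hX1 _ (by linarith), norm_mul_dir]
    simp only [hrad, sub_self, mul_zero, add_zero, abs_of_pos hA, le_refl]
  · intro r hr
    obtain ⟨u, hu, e⟩ := hxm r hr
    rw [e]
    rcases lt_or_ge u (2 * Real.pi) with h2 | h2
    · have hD1 : 0 ≤ ε / η * (u - (2 * Real.pi - η)) :=
        mul_nonneg (by positivity) (by linarith [hu.1])
      have hD2 : ε / η * (u - (2 * Real.pi - η)) ≤ ε := by
        calc _ ≤ ε / η * (2 * Real.pi - (2 * Real.pi - η)) := by gcongr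
          _ = ε := by field_simp; ring
      have hl := mul_le_mul_of_nonneg_right (S.len_mono (x := Real.pi) (y := u)
        (by linarith [hu.1]) (by linarith)) S.cos_pos.le
      have e2 : X u = S.tip u (ε / η * (u - (2 * Real.pi - η))) := by
        rw [hX1 u h2.le, tip, S.anchor_of_lt h2, S.wound_of_lt h2, zero_add, sub_neg_eq_add,
          add_comm]
      rw [e2]
      exact (reached_tip (r := ε / η * (u - (2 * Real.pi - η)))
        ⟨by linarith [hu.1], by linarith⟩ (by rw [S.wound_of_lt h2]; linarith)
        (by linarith) le_rfl).ne_pos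
    · rw [hX2 u h2]
      exact (reached_tip (r := S.wound u + ε) ⟨by linarith, by linarith [hu.2]⟩ (by linarith)
        (by linarith [hfree u ⟨h2, hu.2⟩]) le_rfl).ne_pos
  · rw [hx1, hX2 φ h0]

theorem norm_tip_sub (φ D D' : ℝ) : ‖S.tip φ D - S.tip φ D'‖ = |D - D'| := by
  have : S.tip φ D - S.tip φ D' = ((D - D' : ℝ) : ℂ) * dir φ := by
    simp only [tip]; push_cast; ring
  rw [this, norm_mul_dir]

/-- The fire reaches each point in string coordinates as fast as along the curve and the string, up
to an arbitrarily small delay `σ`: until some time `s` it stays off the curve, and from then on it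
moves along the string. -/
theorem exists_path {φ D σ : ℝ} (h1 : φ < S.last) (hD : S.wound φ < D) (hD0 : 0 ≤ D)
    (hσ : 0 < σ) :
    ∃ (s s' : ℝ) (x : ℝ → ℂ), 0 ≤ s ∧ s ≤ s' ∧ s' ≤ D + σ ∧ s ≤ max (S.wound φ + σ) 0 ∧
      ‖x 0‖ ≤ A ∧ LipschitzOnWith 1 x (Set.Icc 0 s') ∧
      (∀ r ∈ Set.Ico 0 s, ∀ ψ ∈ Set.Icc 0 S.last, x r ≠ S.pos ψ) ∧ x s' = S.tip φ D ∧
      ∀ r ∈ Set.Icc s s', ∃ D', S.wound φ < D' ∧ D' ≤ D ∧ r ≤ D' + σ ∧ x r = S.tip φ D' := by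
  have key : ∃ (s D₀ : ℝ) (x : ℝ → ℂ), 0 ≤ s ∧ s ≤ max (S.wound φ + σ) 0 ∧ s ≤ D₀ + σ ∧
      S.wound φ < D₀ ∧ D₀ ≤ D ∧ ‖x 0‖ ≤ A ∧ LipschitzOnWith 1 x (Set.Icc 0 s) ∧
      (∀ r ∈ Set.Ico 0 s, ∀ ψ ∈ Set.Icc 0 S.last, x r ≠ S.pos ψ) ∧ x s = S.tip φ D₀ := by
    rcases lt_or_ge φ (2 * Real.pi) with h | h
    · refine ⟨0, 0, fun _ => S.tip φ 0, le_rfl, le_max_right _ _, by linarith, ?_, hD0, ?_, ?_, ?_,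
        rfl⟩
      · rw [S.wound_of_lt h]; linarith [S.A_pos]
      · rw [tip, S.anchor_of_lt h, S.wound_of_lt h, zero_add, norm_mul_dir, sub_neg_eq_add,
          zero_add, abs_of_pos S.A_pos]
      · exact LipschitzOnWith.of_norm_sub_le fun a _ b _ hab => by
          rw [sub_self, norm_zero]; linarith
      · intro r hr
        exact absurd (hr.1.trans_lt hr.2) (lt_irrefl _)
    · obtain ⟨s, D₀, x, a1, a2, a3, a4, a5, a6, a7, a8⟩ :=
        S.exists_wrap_path h h1 (lt_min hσ (sub_pos.2 hD))
      have b1 := min_le_left σ (D - S.wound φ)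
      have b2 := min_le_right σ (D - S.wound φ)
      exact ⟨s, D₀, x, a1, le_max_of_le_left (by linarith), by linarith, a3, by linarith, a5, a6,
        fun r hr => a7 r ⟨hr.1, hr.2.le⟩, a8⟩
  obtain ⟨s, D₀, x, hs0, hs1, hs2, hw, hDD, hx0, hxl, hxa, hxs⟩ := key
  set y : ℝ → ℂ := fun r => if r ≤ s then x r else S.tip φ (D₀ + (r - s)) with hy
  have y1 : ∀ r, r ≤ s → y r = x r := fun r hr => if_pos hr
  have y2 : ∀ r, s ≤ r → y r = S.tip φ (D₀ + (r - s)) := by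
    intro r hr
    rcases hr.lt_or_eq with h | h
    · exact if_neg (not_le.2 h)
    · rw [← h, y1 s le_rfl, hxs, sub_self, add_zero]
  have hl2 : ∀ a b, s ≤ a → a ≤ b → ‖y b - y a‖ ≤ b - a := by
    intro a b ha hab
    rw [y2 a ha, y2 b (ha.trans hab), norm_tip_sub,
      show D₀ + (b - s) - (D₀ + (a - s)) = b - a by ring, abs_of_nonneg (sub_nonneg.2 hab)]
  have hl1 : ∀ a b, 0 ≤ a → a ≤ b → b ≤ s → ‖y b - y a‖ ≤ b - a := by
    intro a b ha hab hb
    rw [y1 a (hab.trans hb), y1 b hb]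
    have := hxl.dist_le_mul b ⟨ha.trans hab, hb⟩ a ⟨ha, hab.trans hb⟩
    rwa [dist_eq_norm, Real.dist_eq, abs_of_nonneg (sub_nonneg.2 hab), NNReal.coe_one,
      one_mul] at this
  refine ⟨s, s + (D - D₀), y, hs0, by linarith, by linarith, hs1, ?_, ?_, ?_, ?_, ?_⟩
  · rw [y1 0 hs0]; exact hx0
  · refine LipschitzOnWith.of_norm_sub_le fun a ha b hb hab => ?_
    rcases le_total b s with h | h
    · exact hl1 a b ha.1 hab h
    rcases le_total a s with h' | h'
    · have := norm_add_le (y b - y s) (y s - y a)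
      rw [sub_add_sub_cancel] at this
      linarith [hl1 a s ha.1 h' le_rfl, hl2 s b le_rfl h]
    · exact hl2 a b h' hab
  · intro r hr
    rw [y1 r hr.2.le]
    exact hxa r hr
  · rw [y2 _ (by linarith)]
    congr 1
    ring
  · intro r hr
    exact ⟨D₀ + (r - s), by linarith [hr.1], by linarith [hr.2], by linarith, y2 r hr.1⟩

end StringSpiral

namespace StringSpiral

variable {A α : ℝ} (S : StringSpiral A α)

/-! ### The spiral as a function of time -/

/-- The time at which the spiral closes up. -/
noncomputable def endTime : ℝ := S.len S.last * Real.cos α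

theorem time_strictMonoOn :
    StrictMonoOn (fun φ => S.len φ * Real.cos α) (Set.Icc 0 S.last) := fun _ hx _ hy hxy =>
  mul_lt_mul_of_pos_right (S.strictMonoOn_len hx hy hxy) S.cos_pos

theorem time_zero : S.len 0 * Real.cos α = 0 := by rw [S.len_zero, zero_mul]

theorem endTime_pos : 0 < S.endTime := mul_pos (S.len_pos S.last_pos le_rfl) S.cos_pos

theorem time_mem {φ : ℝ} (h : φ ∈ Set.Icc 0 S.last) :
    S.len φ * Real.cos α ∈ Set.Icc 0 S.endTime :=
  ⟨mul_nonneg (S.len_nonneg (by linarith [h.1, S.α_pos]) h.2) S.cos_pos.le,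
    mul_le_mul_of_nonneg_right (S.len_mono h.2 le_rfl) S.cos_pos.le⟩

theorem exists_param (t : ℝ) : ∃ φ, t ∈ Set.Icc 0 S.endTime →
    φ ∈ Set.Icc 0 S.last ∧ S.len φ * Real.cos α = t := by
  by_cases ht : t ∈ Set.Icc 0 S.endTime
  swap
  · exact ⟨0, fun h => absurd h ht⟩
  have hc : ContinuousOn (fun φ => S.len φ * Real.cos α) (Set.Icc 0 S.last) :=
    (S.continuousOn_len.mono (Set.Icc_subset_Icc_left (by linarith [S.α_pos]))).mul
      continuousOn_const
  rw [← S.time_zero] at ht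
  obtain ⟨φ, hφ, e⟩ := intermediate_value_Icc S.last_pos.le hc ht
  exact ⟨φ, fun _ => ⟨hφ, e⟩⟩

/-- The parameter of the point at which the fighter is at time `t`. -/
noncomputable def param (t : ℝ) : ℝ := (S.exists_param t).choose

/-- The position of the fighter at time `t`. -/
noncomputable def curve (t : ℝ) : ℂ := S.pos (S.param t)

theorem param_mem {t : ℝ} (ht : t ∈ Set.Icc 0 S.endTime) : S.param t ∈ Set.Icc 0 S.last :=
  ((S.exists_param t).choose_spec ht).1

theorem time_param {t : ℝ} (ht : t ∈ Set.Icc 0 S.endTime) :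
    S.len (S.param t) * Real.cos α = t :=
  ((S.exists_param t).choose_spec ht).2

theorem param_time {φ : ℝ} (h : φ ∈ Set.Icc 0 S.last) : S.param (S.len φ * Real.cos α) = φ :=
  S.time_strictMonoOn.injOn (S.param_mem (S.time_mem h)) h (S.time_param (S.time_mem h))

theorem curve_time {φ : ℝ} (h : φ ∈ Set.Icc 0 S.last) :
    S.curve (S.len φ * Real.cos α) = S.pos φ := by rw [curve, S.param_time h]

theorem param_strictMonoOn : StrictMonoOn S.param (Set.Icc 0 S.endTime) := by
  intro t ht t' ht' htt'
  rw [← S.time_param ht, ← S.time_param ht'] at htt'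
  exact (S.time_strictMonoOn.lt_iff_lt (S.param_mem ht) (S.param_mem ht')).1 htt'

theorem param_zero : S.param 0 = 0 := by
  have := S.param_time (φ := 0) ⟨le_rfl, S.last_pos.le⟩
  rwa [S.time_zero] at this

theorem param_endTime : S.param S.endTime = S.last :=
  S.param_time ⟨S.last_pos.le, le_rfl⟩

theorem param_lt {t : ℝ} (ht : t ∈ Set.Ico 0 S.endTime) : S.param t < S.last := by
  rw [← S.param_endTime]
  exact S.param_strictMonoOn ⟨ht.1, ht.2.le⟩ ⟨S.endTime_pos.le, le_rfl⟩ ht.2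

theorem param_pos {t : ℝ} (h0 : 0 < t) (h1 : t ≤ S.endTime) : 0 < S.param t := by
  rw [← S.param_zero]
  exact S.param_strictMonoOn ⟨le_rfl, S.endTime_pos.le⟩ ⟨h0.le, h1⟩ h0

theorem continuousOn_param : ContinuousOn S.param (Set.Icc 0 S.endTime) := by
  intro t ht
  refine tendsto_order.2 ⟨fun a ha => ?_, fun a ha => ?_⟩
  · rcases lt_or_ge a 0 with h | h
    · exact Filter.eventually_of_mem self_mem_nhdsWithin fun t' ht' =>
        h.trans_le (S.param_mem ht').1
    · have hm : a ∈ Set.Icc 0 S.last := ⟨h, ha.le.trans (S.param_mem ht).2⟩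
      have hlt : S.len a * Real.cos α < t := by
        rw [← S.time_param ht]
        exact S.time_strictMonoOn hm (S.param_mem ht) ha
      filter_upwards [self_mem_nhdsWithin, mem_nhdsWithin_of_mem_nhds (Ioi_mem_nhds hlt)]
        with t' ht' hlt'
      rw [← S.param_time hm]
      exact S.param_strictMonoOn (S.time_mem hm) ht' hlt'
  · rcases lt_or_ge S.last a with h | h
    · exact Filter.eventually_of_mem self_mem_nhdsWithin fun t' ht' =>
        (S.param_mem ht').2.trans_lt h
    · have hm : a ∈ Set.Icc 0 S.last := ⟨(S.param_mem ht).1.trans ha.le, h⟩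
      have hlt : t < S.len a * Real.cos α := by
        rw [← S.time_param ht]
        exact S.time_strictMonoOn (S.param_mem ht) hm ha
      filter_upwards [self_mem_nhdsWithin, mem_nhdsWithin_of_mem_nhds (Iio_mem_nhds hlt)]
        with t' ht' hlt'
      rw [← S.param_time hm]
      exact S.param_strictMonoOn ht' (S.time_mem hm) hlt'

theorem norm_sub_mul_dir_sq (w : ℂ) (l θ : ℝ) :
    ‖w - (l : ℂ) * dir θ‖ ^ 2 = ‖w‖ ^ 2 - 2 * l * proj θ w + l ^ 2 := by
  rw [Complex.sq_norm, Complex.sq_norm, Complex.normSq_apply, Complex.normSq_apply]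
  simp only [Complex.sub_re, Complex.sub_im, Complex.re_ofReal_mul, Complex.im_ofReal_mul, dir_re,
    dir_im, proj]
  linear_combination l ^ 2 * Real.sin_sq_add_cos_sq θ

/-- An arc of the spiral with small total turning is nearly a straight segment. -/
theorem norm_pos_sub_sub_le {x y θ d : ℝ} (hxy : x ≤ y) (hy : y ≤ S.last)
    (hθ : ∀ s ∈ Set.Icc x y, |s + α - θ| ≤ d) (hd : d ≤ Real.pi) :
    ‖S.pos y - S.pos x - ((S.len y - S.len x : ℝ) : ℂ) * dir θ‖ ≤ (S.len y - S.len x) * d := by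
  have hd0 : 0 ≤ d := (abs_nonneg _).trans (hθ x ⟨le_rfl, hxy⟩)
  have h1 := S.turning x y θ (Real.cos d) hxy hy fun s hs => cos_le_cos_of_abs_le (hθ s hs) hd
  have h2 := S.norm_pos_sub_le hxy hy
  have h3 := norm_nonneg (S.pos y - S.pos x)
  have h4 := Real.one_sub_sq_div_two_le_cos (x := d)
  refine abs_le_of_sq_le_sq' ?_ (mul_nonneg (h3.trans h2) hd0) |>.2
  rw [norm_sub_mul_dir_sq]
  have hl : 0 ≤ S.len y - S.len x := h3.trans h2
  have h5 := pow_le_pow_left₀ h3 h2 2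
  have h6 := mul_le_mul_of_nonneg_left h1 hl
  have h7 := mul_le_mul_of_nonneg_left h4 (mul_nonneg hl hl)
  nlinarith

/-- The fighter has speed `1 / cos α` and heading `param t + α`. -/
theorem hasDerivWithinAt_curve {t : ℝ} (ht : t ∈ Set.Icc 0 S.endTime) :
    HasDerivWithinAt S.curve (((1 / Real.cos α : ℝ) : ℂ) * dir (S.param t + α))
      (Set.Icc 0 S.endTime) t := by
  have hc := S.cos_pos
  rw [hasDerivWithinAt_iff_isLittleO, Asymptotics.isLittleO_iff]
  intro ε hε
  set d := min (ε * Real.cos α) Real.pi with hd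
  have hd0 : 0 < d := lt_min (by positivity) Real.pi_pos
  have hcont := S.continuousOn_param t ht
  rw [ContinuousWithinAt, Metric.tendsto_nhds] at hcont
  filter_upwards [hcont d hd0, self_mem_nhdsWithin] with t' hdist ht'
  rw [Real.dist_eq, abs_lt] at hdist
  have key : ∀ x y : ℝ, x ∈ Set.Icc 0 S.endTime → y ∈ Set.Icc 0 S.endTime → x ≤ y →
      (∀ s ∈ Set.Icc (S.param x) (S.param y), |s + α - (S.param t + α)| ≤ d) →
      ‖S.curve y - S.curve x - (y - x) • (((1 / Real.cos α : ℝ) : ℂ) * dir (S.param t + α))‖ ≤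
        ε * (y - x) := by
    intro x y hx hy hxy h
    have h1 := S.norm_pos_sub_sub_le (S.param_strictMonoOn.monotoneOn hx hy hxy) (S.param_mem hy).2 h
      (min_le_right _ _)
    have e : S.len (S.param y) - S.len (S.param x) = (y - x) * (1 / Real.cos α) := by
      have e1 := S.time_param hx
      have e2 := S.time_param hy
      field_simp
      linarith
    rw [e, Complex.ofReal_mul, mul_assoc] at h1
    rw [Complex.real_smul]
    refine h1.trans ?_
    have h2 : d ≤ ε * Real.cos α := min_le_left _ _
    calc (y - x) * (1 / Real.cos α) * d ≤ (y - x) * (1 / Real.cos α) * (ε * Real.cos α) :=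
          mul_le_mul_of_nonneg_left h2 (mul_nonneg (by linarith) (by positivity))
      _ = ε * (y - x) := by field_simp
  rw [Real.norm_eq_abs]
  rcases le_total t t' with h | h
  · rw [abs_of_nonneg (by linarith)]
    exact key t t' ht ht' h fun s hs => abs_le.2 ⟨by linarith [hs.1], by linarith [hs.2]⟩
  · rw [abs_of_nonpos (by linarith), neg_sub, ← norm_neg]
    have h1 := key t' t ht' ht h fun s hs => abs_le.2 ⟨by linarith [hs.1], by linarith [hs.2]⟩
    rwa [show S.curve t - S.curve t' - (t - t') • (((1 / Real.cos α : ℝ) : ℂ) *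
      dir (S.param t + α)) = -(S.curve t' - S.curve t - (t' - t) • (((1 / Real.cos α : ℝ) : ℂ) *
      dir (S.param t + α))) by module] at h1

/-! ### The spiral is a barrier curve -/

variable {S}

/-- Only those points of the spiral that are known to have been built are needed to confine the
fire. -/
theorem reached_of_isFirePath {g : ℝ → ℂ} {T s : ℝ} {x : ℝ → ℂ} (hx : IsFirePath A g T s x)
    {s' : ℝ} (hs' : s' ≤ s)
    (hb : ∀ r ∈ Set.Icc 0 s', ∀ φ ∈ Set.Icc 0 S.last, S.len φ * Real.cos α ≤ r →
      S.pos φ ∈ barrierAt g T r) : ∀ r ∈ Set.Icc 0 s', S.Reached r (x r) :=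
  reached_of_path hx.start (hx.speed_le.mono (Set.Icc_subset_Icc_right hs'))
    fun r hr φ hφ h e => hx.avoids r ⟨hr.1, hr.2.trans hs'⟩ (e ▸ hb r hr φ hφ h)

theorem pos_mem_barrierAt {φ r : ℝ} (hφ : φ ∈ Set.Icc 0 S.last) (h : S.len φ * Real.cos α ≤ r) :
    S.pos φ ∈ barrierAt S.curve S.endTime r :=
  ⟨S.len φ * Real.cos α, ⟨(S.time_mem hφ).1, le_min h (S.time_mem hφ).2⟩, S.curve_time hφ⟩

theorem exists_eq_pos_of_mem_barrierAt {z : ℂ} {r : ℝ} (h : z ∈ barrierAt S.curve S.endTime r) :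
    ∃ φ ∈ Set.Icc 0 S.last, z = S.pos φ := by
  obtain ⟨t, ht, e⟩ := h
  exact ⟨S.param t, S.param_mem ⟨ht.1, ht.2.trans (min_le_right _ _)⟩, e.symm⟩

theorem reached_of_mem_burned {t : ℝ} {z : ℂ} (h : z ∈ burned A S.curve S.endTime t) :
    S.Reached t z := by
  obtain ⟨s, hs, x, hx, rfl⟩ := h
  exact (reached_of_isFirePath hx le_rfl (fun r _ φ hφ h' => pos_mem_barrierAt hφ h') s
    ⟨hs.1, le_rfl⟩).mono hs.2

theorem curve_eq_tip {t : ℝ} (ht : t ∈ Set.Icc 0 S.endTime) :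
    S.curve t = S.tip (S.param t) t := by
  rw [curve, S.pos_eq_anchor (S.param_mem ht), S.time_param ht, tip]

theorem wound_param_lt {t : ℝ} (ht : t ∈ Set.Ico 0 S.endTime) : S.wound (S.param t) < t := by
  have h := S.wound_lt ⟨(S.param_mem ⟨ht.1, ht.2.le⟩).1, S.param_lt ht⟩
  rwa [S.time_param ⟨ht.1, ht.2.le⟩] at h

/-- The points of the string on which the fighter is burn before she arrives. At the start, points of
the circle next to `A` burn at once. -/
theorem curve_mem_closure_burned {t : ℝ} (ht : t ∈ Set.Ico 0 S.endTime) :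
    S.curve t ∈ closure (burned A S.curve S.endTime t) := by
  have ht' : t ∈ Set.Icc 0 S.endTime := ⟨ht.1, ht.2.le⟩
  rw [Metric.mem_closure_iff]
  intro ε hε
  rcases ht.1.lt_or_eq with h0 | h0
  · have hp : S.param t ∈ Set.Ioo 0 S.last := ⟨S.param_pos h0 ht.2.le, S.param_lt ht⟩
    obtain ⟨D, hD, hDt⟩ := exists_between (max_lt (wound_param_lt ht) (max_lt h0
      (by linarith : t - ε < t)))
    have hD1 := (le_max_left _ _).trans_lt hD
    have hD2 := ((le_max_left _ _).trans (le_max_right _ _)).trans_lt hD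
    have hD3 := ((le_max_right _ _).trans (le_max_right _ _)).trans_lt hD
    obtain ⟨s, s', x, a1, a2, a3, -, a5, a6, a7, a8, a9⟩ :=
      S.exists_path hp.2 hD1 hD2.le (sub_pos.2 hDt)
    refine ⟨S.tip (S.param t) D, ⟨s', ⟨a1.trans a2, by linarith⟩, x, ⟨a5, a6, fun r hr hmem => ?_⟩,
      a8⟩, ?_⟩
    · obtain ⟨ψ, hψ, e⟩ := exists_eq_pos_of_mem_barrierAt hmem
      rcases lt_or_ge r s with h | h
      · exact a7 r ⟨hr.1, h⟩ ψ hψ e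
      · obtain ⟨D', b1, b2, -, e'⟩ := a9 r ⟨h, hr.2⟩
        rw [e'] at e
        exact (reached_tip (r := D') hp b1 (by rw [S.time_param ht']; linarith) le_rfl).ne_pos ψ hψ e
    · rw [curve_eq_tip ht', dist_eq_norm, norm_tip_sub, abs_of_pos (sub_pos.2 hDt)]
      linarith
  · subst h0
    have hcont : Filter.Tendsto (fun ψ : ℝ => (A : ℂ) * dir ψ) (nhdsWithin 0 (Set.Ioi 0))
        (nhds (A : ℂ)) := by
      have : Continuous fun ψ : ℝ => (A : ℂ) * dir ψ := continuous_const.mul continuous_dir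
      have h := this.tendsto 0
      simp only [dir_zero, mul_one] at h
      exact h.mono_left nhdsWithin_le_nhds
    have hev := (Metric.tendsto_nhds.1 hcont ε hε).and
      (Ioo_mem_nhdsGT (show (0 : ℝ) < 2 * Real.pi by positivity))
    obtain ⟨ψ, h1, h2⟩ := hev.exists
    have hc0 : S.curve 0 = A := by rw [curve, S.param_zero, S.pos_zero]
    refine ⟨(A : ℂ) * dir ψ, ⟨0, ⟨le_rfl, le_rfl⟩, fun _ => (A : ℂ) * dir ψ, ⟨?_, ?_, ?_⟩, rfl⟩, ?_⟩
    · rw [norm_mul_dir, abs_of_pos S.A_pos]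
    · exact (LipschitzWith.const _).lipschitzOnWith.weaken zero_le_one
    · intro r _ hmem
      obtain ⟨χ, hχ, e⟩ := exists_eq_pos_of_mem_barrierAt hmem
      have e2 : (A : ℂ) * dir ψ = S.tip ψ 0 := by
        rw [tip, S.anchor_of_lt h2.2, S.wound_of_lt h2.2, zero_add, sub_neg_eq_add, zero_add]
      rw [e2] at e
      have hst := S.lt_last
      have hα := S.α_pos
      refine (reached_tip (r := 0) ⟨h2.1, by linarith [h2.2]⟩ ?_ ?_ le_rfl).ne_pos χ hχ e
      · rw [S.wound_of_lt h2.2]; linarith [S.A_pos]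
      · exact mul_pos (S.len_pos h2.1 (by linarith [h2.2])) S.cos_pos
    · rw [hc0, dist_comm]
      exact h1

theorem isFFCurve {v : ℝ} (hv : v * Real.cos α = 1) : IsFFCurve A v S.endTime S.curve := by
  have hv' : 1 / Real.cos α = v := by rw [← hv, mul_div_cancel_right₀ _ S.cos_pos.ne']
  have hv0 : 0 < v := by rw [← hv']; exact one_div_pos.2 S.cos_pos
  have hu : UniqueDiffOn ℝ (Set.Icc 0 S.endTime) := uniqueDiffOn_Icc S.endTime_pos
  have hd : ∀ t ∈ Set.Icc 0 S.endTime, derivWithin S.curve (Set.Icc 0 S.endTime) t =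
      (v : ℂ) * dir (S.param t + α) := by
    intro t ht
    rw [← hv']
    exact (S.hasDerivWithinAt_curve ht).derivWithin (hu t ht)
  refine ⟨S.endTime_pos, ?_, ?_, ?_, ?_, ?_, ?_⟩
  · rw [curve, S.param_zero, S.pos_zero]
  · rw [contDiffOn_one_iff_derivWithin hu]
    refine ⟨fun t ht => (S.hasDerivWithinAt_curve ht).differentiableWithinAt, ?_⟩
    exact (continuousOn_const.mul (continuous_dir.comp_continuousOn
      (S.continuousOn_param.add continuousOn_const))).congr hd
  · intro t ht
    rw [hd t ht, norm_mul_dir, abs_of_pos hv0]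
  · rw [hd 0 ⟨le_rfl, S.endTime_pos.le⟩, S.param_zero, zero_add, Complex.im_ofReal_mul, dir_im]
    exact mul_pos hv0 S.sin_pos
  · intro t ht t' ht' e
    have h := S.injOn_pos ⟨(S.param_mem ⟨ht.1, ht.2.le⟩).1, S.param_lt ht⟩
      ⟨(S.param_mem ⟨ht'.1, ht'.2.le⟩).1, S.param_lt ht'⟩ e
    exact S.param_strictMonoOn.injOn ⟨ht.1, ht.2.le⟩ ⟨ht'.1, ht'.2.le⟩ h
  · intro t ht
    refine ⟨curve_mem_closure_burned ht, fun h => ?_⟩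
    exact S.not_reached_pos (S.param_mem ⟨ht.1, ht.2.le⟩) (reached_of_mem_burned (interior_subset h))

theorem closesAt : ClosesAt S.curve S.endTime := by
  have hst := S.lt_last
  have hm : S.last - (2 * Real.pi + α) ∈ Set.Icc 0 S.last :=
    ⟨by linarith, by linarith [S.α_pos, Real.pi_pos]⟩
  refine ⟨S.len (S.last - (2 * Real.pi + α)) * Real.cos α, ⟨(S.time_mem hm).1, ?_⟩, ?_⟩
  · exact S.time_strictMonoOn hm ⟨S.last_pos.le, le_rfl⟩ (by linarith [S.α_pos, Real.pi_pos])
  · rw [S.curve_time hm, curve, S.param_endTime, S.pos_last]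

theorem containsFire : ContainsFire A S.curve S.endTime := by
  refine (Metric.isBounded_closedBall (x := (0 : ℂ))
    (r := A + S.len S.last * Real.cos α)).subset ?_
  intro z hz
  simp only [Set.mem_iUnion] at hz
  obtain ⟨t, _, h⟩ := hz
  rw [mem_closedBall_zero_iff]
  exact (reached_of_mem_burned h).norm_le

end StringSpiral

namespace StringSpiral

variable {A α : ℝ} {S : StringSpiral A α}

/-! ### String coordinates as functions of the point -/

theorem tip_inj_of_abs_lt_pi {φ₁ φ₂ D₁ D₂ : ℝ} (hπ : |φ₁ - φ₂| < Real.pi) (h1 : φ₁ ≤ S.last)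
    (h2 : φ₂ ≤ S.last) (hD₁ : S.wound φ₁ < D₁) (hD₂ : S.wound φ₂ < D₂)
    (e : S.tip φ₁ D₁ = S.tip φ₂ D₂) : φ₁ = φ₂ ∧ D₁ = D₂ := by
  rw [abs_lt] at hπ
  have hφ : φ₁ = φ₂ := by
    rcases lt_trichotomy φ₁ φ₂ with h | h | h
    · exact (S.false_of_sub_lt_pi h (by linarith) h2 (sub_pos.2 hD₂) rfl e).elim
    · exact h
    · exact (S.false_of_sub_lt_pi h (by linarith) h1 (sub_pos.2 hD₁) rfl e.symm).elim
  subst hφ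
  have h := S.norm_tip_sub φ₁ D₁ D₂
  rw [e, sub_self, norm_zero] at h
  exact ⟨rfl, sub_eq_zero.1 (abs_eq_zero.1 h.symm)⟩

/-- The arrival time is `1`-Lipschitz as long as the points are farther along than the anchors. -/
theorem abs_sub_le_norm_tip_sub {φ₁ φ₂ D₁ D₂ m : ℝ} (hπ : |φ₁ - φ₂| ≤ Real.pi)
    (h1 : φ₁ ≤ S.last) (h2 : φ₂ ≤ S.last) (hw₁ : S.wound φ₁ ≤ m) (hw₂ : S.wound φ₂ ≤ m)
    (hD₁ : m ≤ D₁) (hD₂ : m ≤ D₂) : |D₁ - D₂| ≤ ‖S.tip φ₁ D₁ - S.tip φ₂ D₂‖ := by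
  have key : ∀ φ₁ φ₂ D₁ D₂, |φ₁ - φ₂| ≤ Real.pi → φ₁ ≤ S.last → φ₂ ≤ S.last → S.wound φ₁ ≤ m →
      S.wound φ₂ ≤ m → m ≤ D₂ → D₁ - D₂ ≤ ‖S.tip φ₁ D₁ - S.tip φ₂ D₂‖ := by
    intro φ₁ φ₂ D₁ D₂ hπ h1 h2 hw₁ hw₂ hD₂
    rcases le_total φ₁ φ₂ with h | h
    · exact sub_le_norm_tip_sub_of_le h h2 (hw₂.trans hD₂)
    · exact sub_le_norm_tip_sub_of_ge h h1 (by linarith [(abs_le.1 hπ).2]) (hw₁.trans hD₂)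
  refine abs_le.2 ⟨?_, key _ _ _ _ hπ h1 h2 hw₁ hw₂ hD₂⟩
  have := key φ₂ φ₁ D₂ D₁ (by rwa [abs_sub_comm]) h2 h1 hw₂ hw₁ hD₁
  rw [norm_sub_rev] at this
  linarith

/-- Away from the anchors, the direction of the string is a Lipschitz function of the point. -/
theorem mul_abs_sub_le_norm_tip_sub {φ₁ φ₂ D₁ D₂ ρ : ℝ} (hπ : |φ₁ - φ₂| ≤ Real.pi / 2)
    (h1 : φ₁ ≤ S.last) (h2 : φ₂ ≤ S.last) (hρ : 0 ≤ ρ) (hD₁ : S.wound φ₁ + ρ ≤ D₁)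
    (hD₂ : S.wound φ₂ + ρ ≤ D₂) :
    ρ * (2 / Real.pi * |φ₁ - φ₂|) ≤ ‖S.tip φ₁ D₁ - S.tip φ₂ D₂‖ := by
  have hπ0 := Real.pi_pos
  have key : ∀ φ₁ φ₂ D₁ D₂, φ₂ ≤ φ₁ → φ₁ ≤ φ₂ + Real.pi / 2 → φ₁ ≤ S.last →
      S.wound φ₁ + ρ ≤ D₁ → ρ * (2 / Real.pi * (φ₁ - φ₂)) ≤ ‖S.tip φ₁ D₁ - S.tip φ₂ D₂‖ := by
    intro φ₁ φ₂ D₁ D₂ h hπ h1 hD₁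
    refine le_trans ?_ (proj_le (φ₂ + Real.pi / 2) _)
    have h3 := S.cross_anchor_nonneg (x := φ₂) (y := φ₁) (θ := φ₂) h h1 fun s hs =>
      Real.sin_nonneg_of_nonneg_of_le_pi (by linarith [hs.1]) (by linarith [hs.2])
    have h4 := Real.mul_le_sin (x := φ₁ - φ₂) (by linarith) (by linarith)
    have h5 := mul_le_mul_of_nonneg_left h4 hρ
    have h6 := Real.sin_nonneg_of_nonneg_of_le_pi (x := φ₁ - φ₂) (by linarith) (by linarith)
    have h7 := mul_le_mul_of_nonneg_right (show ρ ≤ D₁ - S.wound φ₁ by linarith) h6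
    rw [proj_sub] at h3
    simp only [tip, proj_sub, proj_add, cross_mul_dir, sub_self, Real.sin_zero, mul_zero]
    linarith
  rcases le_total φ₂ φ₁ with h | h
  · rw [abs_of_nonneg (by linarith)] at hπ ⊢
    exact key φ₁ φ₂ D₁ D₂ h (by linarith) h1 hD₁
  · rw [abs_of_nonpos (by linarith)] at hπ ⊢
    rw [norm_sub_rev, neg_sub]
    exact key φ₂ φ₁ D₂ D₁ h (by linarith) h2 hD₂

/-- The gradient of the arrival time in string coordinates is the direction of the string. -/
theorem abs_sub_sub_proj_tip_sub_le {φ₁ φ₂ D₁ D₂ m M : ℝ} (hπ : |φ₁ - φ₂| ≤ Real.pi)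
    (h1 : φ₁ ≤ S.last) (h2 : φ₂ ≤ S.last) (hw₁ : S.wound φ₁ ≤ m) (hw₂ : S.wound φ₂ ≤ m)
    (hm : m ≤ D₁) (hM : D₁ ≤ M) :
    |D₁ - D₂ - proj φ₂ (S.tip φ₁ D₁ - S.tip φ₂ D₂)| ≤
      2 * (M + A) * (1 - Real.cos (φ₁ - φ₂)) := by
  have e1 : D₁ - D₂ - proj φ₂ (S.tip φ₁ D₁ - S.tip φ₂ D₂) =
      (S.wound φ₁ - S.wound φ₂ - proj φ₂ (S.anchor φ₁ - S.anchor φ₂)) +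
        (D₁ - S.wound φ₁) * (1 - Real.cos (φ₁ - φ₂)) := by
    simp only [tip, proj_sub, proj_add, proj_mul_dir, sub_self, Real.cos_zero]
    ring
  have e2 := Real.cos_le_one (φ₁ - φ₂)
  have a1 := S.neg_le_wound h1
  have a2 := S.neg_le_wound h2
  have b1 := mul_le_mul_of_nonneg_right (show D₁ - S.wound φ₁ ≤ M + A by linarith)
    (sub_nonneg.2 e2)
  have b2 := mul_nonneg (show 0 ≤ D₁ - S.wound φ₁ by linarith) (sub_nonneg.2 e2)
  rw [abs_le] at hπ
  rw [e1]
  rcases le_total φ₂ φ₁ with h | h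
  · have h3 := S.turning_anchor (θ := φ₂) (c := Real.cos (φ₁ - φ₂)) h h1 fun s hs =>
      cos_le_cos_of_abs_le (abs_le.2 ⟨by linarith [hs.1], by linarith [hs.2]⟩) (by linarith)
    have h4 := (proj_le φ₂ _).trans (S.norm_anchor_sub_le h h1)
    have h5 := mul_le_mul_of_nonneg_right (show S.wound φ₁ - S.wound φ₂ ≤ M + A by linarith)
      (sub_nonneg.2 e2)
    exact abs_le.2 ⟨by linarith, by linarith⟩
  · have h3 := S.turning_anchor (θ := φ₂) (c := Real.cos (φ₁ - φ₂)) h h2 fun s hs => by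
      rw [← Real.cos_neg (φ₁ - φ₂)]
      exact cos_le_cos_of_abs_le (abs_le.2 ⟨by linarith [hs.1], by linarith [hs.2]⟩)
        (by linarith)
    have h4 := (proj_le φ₂ _).trans (S.norm_anchor_sub_le h h2)
    have h5 := mul_le_mul_of_nonneg_right (show S.wound φ₂ - S.wound φ₁ ≤ M + A by linarith)
      (sub_nonneg.2 e2)
    rw [proj_sub] at h3 h4 ⊢
    exact abs_le.2 ⟨by linarith, by linarith⟩

/-- String coordinates near `S.tip φ₀ D₀`: each point `z` at distance less than `radius` is
`S.tip (ang z) (time z)`. The anchors are kept away from these points, with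
`(S.wound φ₀ + D₀) / 2` separating the arrival times at anchors and points. -/
structure Chart (S : StringSpiral A α) (φ₀ D₀ δ : ℝ) where
  /-- radius of the disc on which the coordinates are defined -/
  radius : ℝ
  /-- direction of the string through a point -/
  ang : ℂ → ℝ
  /-- arrival time of the fire that moves along the curve and the string -/
  time : ℂ → ℝ
  radius_pos : 0 < radius
  ang_near : ∀ z, ‖z - S.tip φ₀ D₀‖ < radius → |ang z - φ₀| < δ
  ang_le : ∀ z, ‖z - S.tip φ₀ D₀‖ < radius → ang z ≤ S.last
  eq_tip : ∀ z, ‖z - S.tip φ₀ D₀‖ < radius → z = S.tip (ang z) (time z)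
  lt_time : ∀ z, ‖z - S.tip φ₀ D₀‖ < radius → (S.wound φ₀ + D₀) / 2 < time z
  wound_le : ∀ z, ‖z - S.tip φ₀ D₀‖ < radius → S.wound (ang z) ≤ (S.wound φ₀ + D₀) / 2
  time_near : ∀ z, ‖z - S.tip φ₀ D₀‖ < radius → |time z - D₀| ≤ ‖z - S.tip φ₀ D₀‖

theorem nonempty_chart {φ₀ D₀ δ R : ℝ} (hδ : 0 < δ) (hR : 0 < R) (hs : φ₀ < S.last)
    (hD : S.wound φ₀ < D₀) : ∃ C : S.Chart φ₀ D₀ δ, C.radius ≤ R := by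
  obtain ⟨η, hη, h⟩ := S.exists_chart hδ hs hD
  choose! ang time h using h
  have hm : ∀ z, ‖z - S.tip φ₀ D₀‖ < min η R → ‖z - S.tip φ₀ D₀‖ < η := fun z hz =>
    hz.trans_le (min_le_left _ _)
  exact ⟨⟨min η R, ang, time, lt_min hη hR, fun z hz => (h z (hm z hz)).1,
    fun z hz => (h z (hm z hz)).2.1, fun z hz => (h z (hm z hz)).2.2.1,
    fun z hz => (h z (hm z hz)).2.2.2.1, fun z hz => (h z (hm z hz)).2.2.2.2.1,
    fun z hz => (h z (hm z hz)).2.2.2.2.2⟩, min_le_right _ _⟩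

namespace Chart

variable {φ₀ D₀ δ : ℝ} (C : S.Chart φ₀ D₀ δ)

theorem abs_ang_sub_lt (hδ : δ ≤ 1 / 2) {z z' : ℂ} (hz : ‖z - S.tip φ₀ D₀‖ < C.radius)
    (hz' : ‖z' - S.tip φ₀ D₀‖ < C.radius) : |C.ang z - C.ang z'| < 1 := by
  have h1 := abs_lt.1 (C.ang_near z hz)
  have h2 := abs_lt.1 (C.ang_near z' hz')
  exact abs_lt.2 ⟨by linarith, by linarith⟩

theorem abs_time_sub_le (hδ : δ ≤ 1 / 2) {z z' : ℂ} (hz : ‖z - S.tip φ₀ D₀‖ < C.radius)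
    (hz' : ‖z' - S.tip φ₀ D₀‖ < C.radius) : |C.time z - C.time z'| ≤ ‖z - z'‖ := by
  have h := abs_sub_le_norm_tip_sub
    ((C.abs_ang_sub_lt hδ hz hz').le.trans (by linarith [Real.pi_gt_three]))
    (C.ang_le z hz) (C.ang_le z' hz') (C.wound_le z hz) (C.wound_le z' hz')
    (C.lt_time z hz).le (C.lt_time z' hz').le
  rwa [← C.eq_tip z hz, ← C.eq_tip z' hz'] at h

theorem exists_abs_ang_sub_le (hD : S.wound φ₀ < D₀) (hδ : δ ≤ 1 / 2)
    (hr : C.radius ≤ (D₀ - S.wound φ₀) / 4) :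
    ∃ K > 0, ∀ z z' : ℂ, ‖z - S.tip φ₀ D₀‖ < C.radius → ‖z' - S.tip φ₀ D₀‖ < C.radius →
      |C.ang z - C.ang z'| ≤ K * ‖z - z'‖ := by
  have hπ := Real.pi_gt_three
  refine ⟨2 * Real.pi / (D₀ - S.wound φ₀), by have := sub_pos.2 hD; positivity,
    fun z z' hz hz' => ?_⟩
  have t1 := (abs_le.1 (C.time_near z hz)).1
  have t2 := (abs_le.1 (C.time_near z' hz')).1
  have w1 := C.wound_le z hz
  have w2 := C.wound_le z' hz'
  have h := mul_abs_sub_le_norm_tip_sub (ρ := (D₀ - S.wound φ₀) / 4) (D₁ := C.time z)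
    (D₂ := C.time z') ((C.abs_ang_sub_lt hδ hz hz').le.trans (by linarith))
    (C.ang_le z hz) (C.ang_le z' hz') (by linarith) (by linarith) (by linarith)
  rw [← C.eq_tip z hz, ← C.eq_tip z' hz'] at h
  have hp := sub_pos.2 hD
  rw [div_mul_eq_mul_div, le_div_iff₀ hp]
  have e : (D₀ - S.wound φ₀) / 4 * (2 / Real.pi * |C.ang z - C.ang z'|) * (2 * Real.pi) =
      |C.ang z - C.ang z'| * (D₀ - S.wound φ₀) := by field_simp; ring
  rw [← e]
  have := mul_le_mul_of_nonneg_right h (by positivity : 0 ≤ 2 * Real.pi)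
  linarith

theorem eq_of_eq_tip (hδ : δ ≤ 1 / 2) {z : ℂ} (hz : ‖z - S.tip φ₀ D₀‖ < C.radius) {φ D : ℝ}
    (h1 : |φ - φ₀| < δ) (h2 : φ ≤ S.last) (h3 : S.wound φ < D) (e : z = S.tip φ D) :
    C.ang z = φ ∧ C.time z = D := by
  have a := abs_lt.1 (C.ang_near z hz)
  rw [abs_lt] at h1
  refine tip_inj_of_abs_lt_pi (abs_lt.2 ⟨?_, ?_⟩) (C.ang_le z hz) h2
    ((C.wound_le z hz).trans_lt (C.lt_time z hz)) h3 ((C.eq_tip z hz).symm.trans e)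
  all_goals linarith [Real.pi_gt_three]

theorem center_mem : ‖S.tip φ₀ D₀ - S.tip φ₀ D₀‖ < C.radius := by
  rw [sub_self, norm_zero]
  exact C.radius_pos

/-- Along a curve at which the arrival time in string coordinates equals the time, the velocity has
component `1` in the direction of the string. -/
theorem proj_ang_eq_one (hD : S.wound φ₀ < D₀) (hδ : δ ≤ 1 / 2)
    (hr : C.radius ≤ (D₀ - S.wound φ₀) / 4) {g : ℝ → ℂ} {g' : ℂ} {a b t : ℝ} (hab : a < b)
    (ht : t ∈ Set.Icc a b) (hg : HasDerivWithinAt g g' (Set.Icc a b) t)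
    (hmem : ∀ s ∈ Set.Icc a b, ‖g s - S.tip φ₀ D₀‖ < C.radius)
    (htime : ∀ s ∈ Set.Icc a b, C.time (g s) = s) : proj (C.ang (g t)) g' = 1 := by
  obtain ⟨K, hK, hang⟩ := C.exists_abs_ang_sub_le hD hδ hr
  have h1 : HasDerivWithinAt (fun s => proj (C.ang (g t)) (g s)) (proj (C.ang (g t)) g')
      (Set.Icc a b) t := hasDerivWithinAt_proj _ hg
  have h2 : HasDerivWithinAt (fun s => proj (C.ang (g t)) (g s)) 1 (Set.Icc a b) t := by
    rw [hasDerivWithinAt_iff_isLittleO]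
    have hO := hg.differentiableWithinAt.isBigO_sub
    have ho : (fun s => ‖g s - g t‖ * ‖g s - g t‖) =o[nhdsWithin t (Set.Icc a b)]
        fun s => s - t := by
      have hc : Filter.Tendsto (fun s => ‖g s - g t‖) (nhdsWithin t (Set.Icc a b)) (nhds 0) := by
        have := (hg.continuousWithinAt.sub (continuousWithinAt_const (b := g t))).norm
        simpa [ContinuousWithinAt] using this
      have h := (Asymptotics.isLittleO_one_iff ℝ).2 hc |>.mul_isBigO hO.norm_left
      simpa using h
    refine Asymptotics.IsBigO.trans_isLittleO ?_ ho
    refine Asymptotics.IsBigO.of_bound (2 * (b + A) * K ^ 2) ?_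
    filter_upwards [self_mem_nhdsWithin] with s hs
    have z1 := hmem s hs
    have z2 := hmem t ht
    have hbA : 0 ≤ b + A := by
      have := C.lt_time _ z1
      have h3 := C.wound_le _ z1
      have h4 := S.neg_le_wound (C.ang_le _ z1)
      rw [htime s hs] at this
      linarith [hs.2]
    have h := abs_sub_sub_proj_tip_sub_le (D₁ := C.time (g s)) (D₂ := C.time (g t)) (M := b)
      ((C.abs_ang_sub_lt hδ z1 z2).le.trans (by linarith [Real.pi_gt_three]))
      (C.ang_le _ z1) (C.ang_le _ z2) (C.wound_le _ z1) (C.wound_le _ z2)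
      (C.lt_time _ z1).le (by rw [htime s hs]; exact hs.2)
    rw [← C.eq_tip _ z1, ← C.eq_tip _ z2, htime s hs, htime t ht, abs_sub_comm] at h
    rw [smul_eq_mul, mul_one, ← proj_sub, Real.norm_eq_abs, norm_mul, norm_norm]
    refine h.trans ?_
    rw [mul_assoc (2 * (b + A))]
    refine mul_le_mul_of_nonneg_left ?_ (by linarith)
    have h5 := Real.one_sub_sq_div_two_le_cos (x := C.ang (g s) - C.ang (g t))
    have h6 := pow_le_pow_left₀ (abs_nonneg _) (hang _ _ z1 z2) 2
    rw [sq_abs] at h6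
    nlinarith [sq_nonneg (C.ang (g s) - C.ang (g t))]
  exact (uniqueDiffOn_Icc hab t ht).eq_deriv _ h1 h2

end Chart

end StringSpiral

namespace StringSpiral

variable {A α : ℝ} {S : StringSpiral A α}

/-! ### The arrival time along a barrier curve -/

theorem cos_lt_one (S : StringSpiral A α) : Real.cos α < 1 := by
  rw [← Real.cos_zero]
  exact Real.cos_lt_cos_of_nonneg_of_le_pi_div_two le_rfl S.α_lt.le S.α_pos

theorem curve_zero (S : StringSpiral A α) : S.curve 0 = A := by
  rw [curve, S.param_zero, S.pos_zero]

theorem continuousOn_curve (S : StringSpiral A α) :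
    ContinuousOn S.curve (Set.Icc 0 S.endTime) := fun _ ht =>
  (S.hasDerivWithinAt_curve ht).continuousWithinAt

/-- No string but her own, not even its anchor or its free end, brings fire to the fighter. -/
theorem notMem_closedReach {t δ : ℝ} (h0 : 0 < t) (ht : t < S.endTime) (hδ : 0 < δ) :
    (t, S.curve t) ∉ S.closedReach {φ | δ ≤ |φ - S.param t|} := by
  have ht' : t ∈ Set.Icc 0 S.endTime := ⟨h0.le, ht.le⟩
  have hπ := Real.pi_pos
  have hα := S.α_pos
  have hst := S.lt_last
  have hp0 := S.param_pos h0 ht.le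
  have hp1 := S.param_lt ⟨h0.le, ht⟩
  have hA : A < ‖S.curve t‖ := S.lt_norm_pos hp0 hp1
  have hw := S.wound_param_lt ⟨h0.le, ht⟩
  have hz := S.curve_eq_tip ht'
  have uniq : ∀ φ ρ, δ ≤ |φ - S.param t| → φ ∈ Set.Icc 0 S.last → 0 < ρ →
      S.wound φ + ρ ≤ S.len φ * Real.cos α →
      S.curve t = S.anchor φ + ((ρ : ℝ) : ℂ) * dir φ → False := by
    intro φ ρ hφ hm hρ hb e
    rw [hz] at e
    have := (string_unique (S.param_mem ht') hm (sub_pos.2 hw) hρ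
      (by rw [S.time_param ht']; linarith) hb e).1
    rw [← this, sub_self, abs_zero] at hφ
    linarith
  rintro ((h | ⟨⟨φ, u⟩, ⟨⟨hI, hφ⟩, hu⟩, e, h1⟩) | ⟨⟨φ, u⟩, ⟨⟨hI, hφ⟩, hu⟩, e, h1⟩)
  · exact absurd (show ‖S.curve t‖ ≤ A from h) (not_le.2 hA)
  · simp only at e h1 hφ hu
    have hl := mul_nonneg (S.len_nonneg (x := φ) (by linarith [hφ.1]) (by linarith [hφ.2]))
      S.cos_pos.le
    have h2 := mul_le_of_le_one_left hl hu.2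
    have h3 := mul_nonneg hu.1 hl
    have hm : φ ∈ Set.Icc 0 S.last := ⟨hφ.1, by linarith [hφ.2]⟩
    rcases hφ.2.lt_or_eq with h4 | h4
    · refine uniq φ (A + u * (S.len φ * Real.cos α)) hI hm (by linarith [S.A_pos]) ?_
        (by rw [S.anchor_of_lt h4, zero_add, e])
      rw [S.wound_of_lt h4]
      linarith
    · have hd : dir φ = 1 := by rw [h4, ← zero_add (2 * Real.pi), dir_add_two_pi, dir_zero]
      refine uniq φ (u * (S.len φ * Real.cos α)) hI hm ?_ ?_ ?_
      · rw [e, norm_mul_dir, abs_of_nonneg (by linarith [S.A_pos])] at hA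
        linarith
      · rw [S.wound_of_le h4.ge (by linarith)]; linarith
      · rw [S.anchor_of_le h4.ge (by linarith), e, hd]
        push_cast
        ring
  · simp only at e h1 hφ hu
    have hF : 0 ≤ S.len φ * Real.cos α - S.wound φ := by
      rcases hφ.2.lt_or_eq with h4 | h4
      · exact sub_nonneg.2 (S.wound_lt ⟨by linarith [hφ.1], h4⟩).le
      · rw [h4, S.wound_last, sub_self]
    have h2 := mul_le_of_le_one_left hF hu.2
    rcases (mul_nonneg hu.1 hF).lt_or_eq with h3 | h3
    · exact uniq φ _ hI ⟨by linarith [hφ.1], hφ.2⟩ h3 (by linarith) (by rw [e, tip_eq])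
    · -- the point would be an anchor, where the fire arrives only after the fighter
      rw [← h3, add_zero] at e h1
      rw [tip, sub_self, Complex.ofReal_zero, zero_mul, add_zero] at e
      rcases le_or_gt φ (2 * Real.pi + α) with h5 | h5
      · rw [e, S.anchor_of_le hφ.1 h5, Complex.norm_real, Real.norm_eq_abs,
          abs_of_pos S.A_pos] at hA
        exact lt_irrefl _ hA
      · have h6 : S.param t = φ - (2 * Real.pi + α) :=
          S.injOn_pos ⟨hp0.le, hp1⟩ ⟨by linarith, by linarith [hφ.2]⟩ e
        rw [wound, ← h6] at h1
        have h7 := S.time_param ht'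
        have h8 := mul_lt_of_lt_one_right (S.len_pos hp0 hp1.le) S.cos_lt_one
        linarith

/-- Near the fighter, the region reached by her time lies where the arrival time in string
coordinates is not later. -/
theorem exists_time_le_of_reached {t δ : ℝ} (ht : t ∈ Set.Ico 0 S.endTime) (hδ : δ ≤ 1 / 2)
    (C : S.Chart (S.param t) t δ) : ∃ η > 0, η ≤ C.radius ∧
      ∀ y, ‖y - S.tip (S.param t) t‖ < η → S.Reached t y → C.time y ≤ t := by
  have hπ := Real.pi_gt_three
  -- at the start the initial disc itself is next to the fighter, and times are read off the norm
  rcases ht.1.lt_or_eq with h0 | h0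
  · have hδ0 : 0 < δ := (abs_nonneg _).trans_lt (C.ang_near _ C.center_mem)
    have hcl := S.isClosed_closedReach (I := {φ | δ ≤ |φ - S.param t|})
      (isClosed_le (by fun_prop) (by fun_prop))
    obtain ⟨η, hη, hball⟩ := Metric.isOpen_iff.1 hcl.isOpen_compl _
      (notMem_closedReach h0 ht.2 hδ0)
    refine ⟨min η C.radius, lt_min hη C.radius_pos, min_le_right _ _, fun y hy hre => ?_⟩
    have hy1 := hy.trans_le (min_le_left _ _)
    have hy2 := hy.trans_le (min_le_right _ _)
    rcases hre.mem_closedReach_or {φ | δ ≤ |φ - S.param t|} with h | ⟨φ, D, h1, h2, h3, -, h5, e⟩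
    · refine absurd h (hball ?_)
      rw [Metric.mem_ball, Prod.dist_eq, dist_self, S.curve_eq_tip ⟨ht.1, ht.2.le⟩, dist_eq_norm]
      exact max_lt hη hy1
    · rw [(C.eq_of_eq_tip hδ hy2 (not_le.1 h2) h1.2.le h3 e).2]
      exact h5
  · refine ⟨C.radius, C.radius_pos, le_rfl, fun y hy hre => ?_⟩
    have hn : ‖y‖ ≤ A := by
      rcases hre with h | ⟨φ, hφ, ρ, hρ, e, -, h2⟩
      · exact h.le
      · rw [← h0] at h2
        rcases lt_or_ge φ (2 * Real.pi) with h | h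
        · rw [S.wound_of_lt h] at h2
          rw [e, S.anchor_of_lt h, zero_add, norm_mul_dir, abs_of_pos hρ]
          linarith
        · have := S.len_nonneg (x := φ - (2 * Real.pi + α)) (by linarith)
            (by linarith [hφ.2, S.α_pos])
          rw [wound] at h2
          linarith
    have ha := (abs_lt.1 (C.ang_near y hy)).2
    have hw := C.wound_le y hy
    have hl := C.lt_time y hy
    have e := C.eq_tip y hy
    have hlt : C.ang y < 2 * Real.pi := by
      have : S.param t = 0 := by rw [← h0, S.param_zero]
      linarith
    rw [tip, S.anchor_of_lt hlt, S.wound_of_lt hlt, zero_add] at e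
    rw [S.wound_of_lt hlt] at hw
    rw [e, norm_mul_dir] at hn
    have := (le_abs_self _).trans hn
    linarith [ht.1]

section Front

variable {v T t₁ : ℝ} {g : ℝ → ℂ}

theorem pos_mem_barrierAt_of_eqOn (hT : t₁ ≤ T)
    (he : Set.EqOn g S.curve (Set.Icc 0 t₁)) {r φ : ℝ} (hr : r ≤ t₁) (hφ : φ ∈ Set.Icc 0 S.last)
    (h : S.len φ * Real.cos α ≤ r) : S.pos φ ∈ barrierAt g T r := by
  have hm := S.time_mem hφ
  refine ⟨S.len φ * Real.cos α, ⟨hm.1, le_min h (by linarith)⟩, ?_⟩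
  rw [he ⟨hm.1, by linarith⟩, S.curve_time hφ]

/-- The fire does not come to the fighter earlier than along the spiral and the string. -/
theorem exists_time_le (hg : IsFFCurve A v T g) (hT : t₁ < T) (ht : t₁ ∈ Set.Ico 0 S.endTime)
    (he : Set.EqOn g S.curve (Set.Icc 0 t₁)) {δ : ℝ} (hδ : δ ≤ 1 / 2)
    (C : S.Chart (S.param t₁) t₁ δ) : ∃ ε > 0, t₁ + ε < T ∧ ∀ t ∈ Set.Icc t₁ (t₁ + ε),
      ‖g t - S.tip (S.param t₁) t₁‖ < C.radius ∧ C.time (g t) ≤ t := by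
  have ht' : t₁ ∈ Set.Icc 0 S.endTime := ⟨ht.1, ht.2.le⟩
  obtain ⟨η, hη, hηr, hre⟩ := exists_time_le_of_reached ht hδ C
  have hg1 : g t₁ = S.tip (S.param t₁) t₁ := by
    rw [he ⟨ht.1, le_rfl⟩, S.curve_eq_tip ht']
  have hc := hg.smooth.continuousOn t₁ ⟨ht.1, hT.le⟩
  rw [Metric.continuousWithinAt_iff] at hc
  obtain ⟨ε, hε, hc⟩ := hc (η / 4) (by linarith)
  obtain ⟨ε', hε', hm⟩ := exists_between (lt_min hε (lt_min (sub_pos.2 hT)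
    (by linarith : 0 < η / 4)))
  have m1 := hm.trans_le (min_le_left _ _)
  have m2 := hm.trans_le ((min_le_right _ _).trans (min_le_left _ _))
  have m3 := hm.trans_le ((min_le_right _ _).trans (min_le_right _ _))
  refine ⟨ε', hε', by linarith, fun t htm => ?_⟩
  have hd : ‖g t - S.tip (S.param t₁) t₁‖ < η / 4 := by
    have := hc (x := t) ⟨by linarith [ht.1, htm.1], by linarith [htm.2]⟩ (by
      rw [Real.dist_eq, abs_of_nonneg (by linarith [htm.1])]; linarith [htm.2])
    rwa [dist_eq_norm, hg1] at this
  have hdr : ‖g t - S.tip (S.param t₁) t₁‖ < C.radius := by linarith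
  -- the estimate holds for burned points near `g t`, and passes to the limit
  refine ⟨hdr, le_of_forall_pos_le_add fun κ hκ => ?_⟩
  have hcl := (hg.on_front t ⟨by linarith [ht.1, htm.1], by linarith [htm.2]⟩).1
  obtain ⟨y, ⟨s, hs, x, hx, e⟩, hy⟩ := Metric.mem_closure_iff.1 hcl (min κ (η / 4)) (by positivity)
  rw [dist_eq_norm] at hy
  have hy1 := hy.trans_le (min_le_left _ _)
  have hy2 := hy.trans_le (min_le_right _ _)
  have hyn : ‖y - S.tip (S.param t₁) t₁‖ < η / 2 := by
    have := norm_sub_le_norm_sub_add_norm_sub y (g t) (S.tip (S.param t₁) t₁)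
    rw [norm_sub_rev] at hy2
    linarith
  -- until `t₁` the path of the fire avoids the spiral, and afterwards it has unit speed
  have hs0 : 0 ≤ min s t₁ := le_min hs.1 ht.1
  have hR : S.Reached t₁ (x (min s t₁)) :=
    (reached_of_isFirePath hx (min_le_left s t₁) (fun r hr φ hφ h =>
      pos_mem_barrierAt_of_eqOn hT.le he (hr.2.trans (min_le_right _ _)) hφ h) _
      ⟨hs0, le_rfl⟩).mono (min_le_right _ _)
  have hL : ‖y - x (min s t₁)‖ ≤ s - min s t₁ := by
    have := hx.speed_le.dist_le_mul s ⟨hs.1, le_rfl⟩ (min s t₁) ⟨hs0, min_le_left _ _⟩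
    rwa [dist_eq_norm, Real.dist_eq, abs_of_nonneg (sub_nonneg.2 (min_le_left _ _)),
      NNReal.coe_one, one_mul, e] at this
  have hss : s - min s t₁ ≤ t - t₁ ∨ s = min s t₁ := by
    rcases le_total s t₁ with h | h
    · exact Or.inr (min_eq_left h).symm
    · rw [min_eq_right h]
      exact Or.inl (by linarith [hs.2])
  have hxn : ‖x (min s t₁) - S.tip (S.param t₁) t₁‖ < η := by
    have := norm_sub_le_norm_sub_add_norm_sub (x (min s t₁)) y (S.tip (S.param t₁) t₁)
    rw [norm_sub_rev (x (min s t₁)) y] at this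
    rcases hss with h | h <;> linarith [htm.2]
  have a1 := hre _ hxn hR
  have a2 := (abs_le.1 (C.abs_time_sub_le hδ (z := y) (by linarith) (hxn.trans_le hηr))).2
  have a3 := (abs_le.1 (C.abs_time_sub_le hδ hdr (z' := y) (by linarith))).2
  rcases le_total s t₁ with h | h
  · rw [min_eq_left h] at a1 a2 hL
    linarith [htm.1]
  · rw [min_eq_right h] at a1 a2 hL
    linarith [hs.2]

end Front

end StringSpiral

namespace StringSpiral

variable {A α : ℝ} {S : StringSpiral A α}

section Front

variable {v T t₁ : ℝ} {g : ℝ → ℂ}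

/-- Locally, a continuously differentiable curve of speed greater than `1` moves away from its
points at least at speed `1`. -/
theorem exists_abs_sub_le_norm_sub (hg : IsFFCurve A v T g) (hv : 1 < v) (ht : t₁ ∈ Set.Icc 0 T) :
    ∃ κ > 0, ∀ a ∈ Set.Icc 0 T, ∀ b ∈ Set.Icc 0 T, |a - t₁| < κ → |b - t₁| < κ →
      |b - a| ≤ ‖g b - g a‖ := by
  have hu := uniqueDiffOn_Icc hg.pos
  have hd := (contDiffOn_one_iff_derivWithin hu).1 hg.smooth
  have hc := hd.2 t₁ ht
  rw [Metric.continuousWithinAt_iff] at hc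
  obtain ⟨κ, hκ, hc⟩ := hc (v - 1) (by linarith)
  refine ⟨κ, hκ, fun a ha b hb ha' hb' => ?_⟩
  set w := derivWithin g (Set.Icc 0 T) t₁ with hw
  have key := Convex.norm_image_sub_le_of_norm_hasDerivWithin_le
    (f := fun t => g t - t • w) (f' := fun t => derivWithin g (Set.Icc 0 T) t - w)
    (s := Set.Icc 0 T ∩ Metric.ball t₁ κ) (C := v - 1) (x := a) (y := b)
    (fun x hx => ?_) (fun x hx => ?_) ((convex_Icc 0 T).inter (convex_ball t₁ κ))
    ⟨ha, by rwa [Metric.mem_ball, Real.dist_eq]⟩ ⟨hb, by rwa [Metric.mem_ball, Real.dist_eq]⟩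
  · have e : g b - b • w - (g a - a • w) = g b - g a - (b - a) • w := by module
    rw [e, Real.norm_eq_abs] at key
    have h1 := norm_sub_norm_le ((b - a) • w) (g b - g a)
    rw [norm_sub_rev ((b - a) • w) (g b - g a), norm_smul, hw, hg.speed t₁ ht, Real.norm_eq_abs] at h1
    rw [hw] at key
    linarith
  · have h1 := (hd.1 x hx.1).hasDerivWithinAt.mono Set.inter_subset_left (s := _ ∩ Metric.ball t₁ κ)
    have h2 := ((hasDerivAt_id x).smul_const w).hasDerivWithinAt
      (s := Set.Icc 0 T ∩ Metric.ball t₁ κ)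
    rw [one_smul] at h2
    exact h1.sub h2
  · have := hc hx.1 hx.2
    rw [dist_eq_norm] at this
    exact this.le

theorem mem_burned_of_norm_lt (hg : IsFFCurve A v T g) {t : ℝ} (ht : 0 ≤ t) {z : ℂ}
    (hz : ‖z‖ < A) : z ∈ burned A g T t := by
  refine ⟨0, ⟨le_rfl, ht⟩, fun _ => z, ⟨hz.le, ?_, ?_⟩, rfl⟩
  · exact (LipschitzWith.const _).lipschitzOnWith.weaken zero_le_one
  · rintro r hr ⟨u, hu, e⟩
    have hu0 : u = 0 := le_antisymm (hu.2.trans ((min_le_left _ _).trans hr.2)) hu.1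
    have e : g u = z := e
    rw [hu0, hg.start] at e
    rw [← e, Complex.norm_real, Real.norm_eq_abs] at hz
    exact absurd hz (not_lt.2 (le_abs_self A))

/-- The fire that moves along the spiral and then along the string reaches the end of the string in
time if it does not meet the part of the barrier off the spiral. -/
theorem tip_mem_burned (ht : t₁ ≤ S.endTime) (ht0 : 0 ≤ t₁)
    (he : Set.EqOn g S.curve (Set.Icc 0 t₁)) {φ D σ t : ℝ} (hφ : φ < S.last) (hw : S.wound φ < D)
    (hD : 0 ≤ D) (hσ : 0 < σ) (hσt : S.wound φ + σ ≤ t₁) (hDt : D + σ ≤ t)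
    (h : ∀ u ∈ Set.Icc 0 t, D - u + σ < ‖S.tip φ D - g u‖ ∨
      u ≤ t₁ ∧ φ ∈ Set.Ioo 0 S.last ∧ D - S.len φ * Real.cos α < ‖S.tip φ D - g u‖) :
    S.tip φ D ∈ burned A g T t := by
  obtain ⟨s, s', x, a1, a2, a3, a4, a5, a6, a7, a8, a9⟩ := S.exists_path hφ hw hD hσ
  have hpos : ∀ u ∈ Set.Icc 0 t₁, ∃ ψ ∈ Set.Icc 0 S.last, g u = S.pos ψ := fun u hu =>
    ⟨S.param u, S.param_mem ⟨hu.1, hu.2.trans ht⟩, he hu⟩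
  refine ⟨s', ⟨a1.trans a2, a3.trans hDt⟩, x, ⟨a5, a6, ?_⟩, a8⟩
  rintro r hr ⟨u, hu, e⟩
  have hur : u ≤ r := hu.2.trans (min_le_left _ _)
  rcases lt_or_ge r s with hrs | hrs
  · have : s ≤ t₁ := a4.trans (max_le hσt ht0)
    obtain ⟨ψ, hψ, e'⟩ := hpos u ⟨hu.1, by linarith⟩
    exact a7 r ⟨hr.1, hrs⟩ ψ hψ (e.symm.trans e')
  · obtain ⟨D', b1, b2, b3, e'⟩ := a9 r ⟨hrs, hr.2⟩
    have hn : ‖S.tip φ D - g u‖ = D - D' := by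
      have := S.norm_tip_sub φ D D'
      rwa [← e', ← e, abs_of_nonneg (sub_nonneg.2 b2)] at this
    rw [← e] at e'
    rcases h u ⟨hu.1, by linarith [hr.2]⟩ with h1 | ⟨h1, h2, h3⟩
    · linarith
    · obtain ⟨ψ, hψ, e2⟩ := hpos u ⟨hu.1, h1⟩
      rw [hn] at h3
      exact (reached_tip (r := D') h2 b1 (by linarith) le_rfl).ne_pos ψ hψ (e'.symm.trans e2)

/-- In suitable string coordinates near the fighter, fire and fighter arrive simultaneously. -/
theorem exists_chart_time_eq (hg : IsFFCurve A v T g) (hv : 1 < v) (hT : t₁ < T)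
    (ht : t₁ ∈ Set.Ico 0 S.endTime) (he : Set.EqOn g S.curve (Set.Icc 0 t₁)) :
    ∃ δ ≤ 1 / 2, ∃ C : S.Chart (S.param t₁) t₁ δ, C.radius ≤ (t₁ - S.wound (S.param t₁)) / 4 ∧
      ∃ ε > 0, t₁ + ε < T ∧ ∀ t ∈ Set.Icc t₁ (t₁ + ε),
        ‖g t - S.tip (S.param t₁) t₁‖ < C.radius ∧ C.time (g t) = t := by
  have hπ := Real.pi_gt_three
  have ht' : t₁ ∈ Set.Icc 0 S.endTime := ⟨ht.1, ht.2.le⟩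
  have hw := S.wound_param_lt ht
  have hp := S.param_lt ht
  have hc1 := S.curve_eq_tip ht'
  obtain ⟨κ, hκ, hLB⟩ := exists_abs_sub_le_norm_sub hg hv ⟨ht.1, hT.le⟩
  -- the part of the spiral before time `t₁ - κ` has distance at least `d` from the fighter
  obtain ⟨d, hd, hfar⟩ : ∃ d > 0, ∀ u ∈ Set.Icc 0 (t₁ - κ), d ≤ ‖S.curve u - S.curve t₁‖ := by
    have hK : IsCompact (S.curve '' Set.Icc 0 (t₁ - κ)) :=
      isCompact_Icc.image_of_continuousOn (S.continuousOn_curve.mono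
        (Set.Icc_subset_Icc_right (by linarith [ht.2])))
    have hn : S.curve t₁ ∈ (S.curve '' Set.Icc 0 (t₁ - κ))ᶜ := by
      rintro ⟨u, hu, e⟩
      have hu' : u ∈ Set.Ico 0 S.endTime := ⟨hu.1, by linarith [hu.2, ht.2]⟩
      have h1 := S.injOn_pos ⟨(S.param_mem ⟨hu'.1, hu'.2.le⟩).1, S.param_lt hu'⟩
        ⟨(S.param_mem ht').1, hp⟩ e
      have h2 := S.param_strictMonoOn.injOn ⟨hu'.1, hu'.2.le⟩ ht' h1
      linarith [hu.2]
    obtain ⟨d, hd, hb⟩ := Metric.isOpen_iff.1 hK.isClosed.isOpen_compl _ hn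
    refine ⟨d, hd, fun u hu => not_lt.1 fun hlt => ?_⟩
    rw [← dist_eq_norm] at hlt
    exact hb hlt ⟨u, hu, rfl⟩
  obtain ⟨δ, hδ0, hδ1, hδs, hδ⟩ : ∃ δ > 0, δ ≤ 1 / 2 ∧ δ ≤ S.last - S.param t₁ ∧
      (0 < t₁ → ∀ φ, |φ - S.param t₁| < δ → 0 < φ ∧ t₁ - d / 4 < S.len φ * Real.cos α) := by
    have h0 : 0 < min (1 / 2) (S.last - S.param t₁) := lt_min (by norm_num) (by linarith)
    rcases ht.1.lt_or_eq with h | h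
    · have hp0 := S.param_pos h ht.2.le
      have hc : ContinuousAt (fun x => S.len x * Real.cos α) (S.param t₁) :=
        (S.continuousAt_len ⟨hp0, hp⟩).mul continuousAt_const
      rw [Metric.continuousAt_iff] at hc
      obtain ⟨δ, hδ, hc⟩ := hc (d / 4) (by linarith)
      refine ⟨min (min (1 / 2) (S.last - S.param t₁)) (min δ (S.param t₁)),
        lt_min h0 (lt_min hδ hp0), (min_le_left _ _).trans (min_le_left _ _),
        (min_le_left _ _).trans (min_le_right _ _), fun _ φ hφ => ⟨?_, ?_⟩⟩
      · have := hφ.trans_le ((min_le_right _ _).trans (min_le_right _ _))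
        linarith [(abs_lt.1 this).1]
      · have := hc (x := φ) (by
          rw [Real.dist_eq]
          exact hφ.trans_le ((min_le_right _ _).trans (min_le_left _ _)))
        rw [Real.dist_eq, S.time_param ht'] at this
        linarith [(abs_lt.1 this).1]
    · exact ⟨_, h0, min_le_left _ _, min_le_right _ _, fun h' => absurd h' (by linarith)⟩
  obtain ⟨R, hR, hR1, hR2, hR3⟩ : ∃ R > 0, R ≤ (t₁ - S.wound (S.param t₁)) / 4 ∧ R ≤ d / 4 ∧
      (0 < t₁ → R ≤ t₁) := by
    have h0 : 0 < min ((t₁ - S.wound (S.param t₁)) / 4) (d / 4) :=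
      lt_min (by linarith) (by linarith)
    rcases ht.1.lt_or_eq with h | h
    · exact ⟨min (min ((t₁ - S.wound (S.param t₁)) / 4) (d / 4)) t₁, lt_min h0 h,
        (min_le_left _ _).trans (min_le_left _ _), (min_le_left _ _).trans (min_le_right _ _),
        fun _ => min_le_right _ _⟩
    · exact ⟨_, h0, min_le_left _ _, min_le_right _ _, fun h' => absurd h' (by linarith)⟩
  obtain ⟨C, hC⟩ := nonempty_chart hδ0 hR hp hw
  obtain ⟨ε₀, hε₀, hε₀T, hup⟩ := exists_time_le hg hT ht he hδ1 C
  obtain ⟨ε, hε, hm⟩ := exists_between (lt_min hε₀ (lt_min hκ (by linarith : 0 < d / 4)))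
  have m1 := hm.trans_le (min_le_left _ _)
  have m2 := hm.trans_le ((min_le_right _ _).trans (min_le_left _ _))
  have m3 := hm.trans_le ((min_le_right _ _).trans (min_le_right _ _))
  refine ⟨δ, hδ1, C, hC.trans hR1, ε, hε, by linarith, fun t htm => ?_⟩
  obtain ⟨hmem, hle⟩ := hup t ⟨htm.1, by linarith [htm.2]⟩
  refine ⟨hmem, le_antisymm hle (not_lt.1 fun hlt => ?_)⟩
  -- otherwise the fire has already passed the fighter
  have ht0 : 0 ≤ t := ht.1.trans htm.1
  refine (hg.on_front t ⟨ht0, by linarith [htm.2]⟩).2 (mem_interior_iff_mem_nhds.2 ?_)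
  set β := t - C.time (g t) with hβ
  have hβ0 : 0 < β := sub_pos.2 hlt
  refine Filter.mem_of_superset (Metric.ball_mem_nhds (g t) (ε := min (β / 8)
    (C.radius - ‖g t - S.tip (S.param t₁) t₁‖)) (lt_min (by linarith) (sub_pos.2 hmem)))
    fun z hz => ?_
  rw [Metric.mem_ball, dist_eq_norm] at hz
  have hz1 := hz.trans_le (min_le_left _ _)
  have hz2 := hz.trans_le (min_le_right _ _)
  have hzC : ‖z - S.tip (S.param t₁) t₁‖ < C.radius := by
    have := norm_sub_le_norm_sub_add_norm_sub z (g t) (S.tip (S.param t₁) t₁)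
    linarith
  have hang := C.ang_near z hzC
  have hlt' := C.lt_time z hzC
  have hwl := C.wound_le z hzC
  have hD := (abs_le.1 (C.abs_time_sub_le hδ1 hzC hmem)).2
  have hlast : C.ang z < S.last := by linarith [(abs_lt.1 hang).2]
  rcases lt_or_ge (C.time z) 0 with hneg | hnn
  · -- only at the start of the curve can the fire have had the point from the beginning
    have ht1 : t₁ = 0 := by
      by_contra hne
      have h1 := lt_of_le_of_ne ht.1 (Ne.symm hne)
      linarith [(abs_le.1 (C.time_near z hzC)).1, hR3 h1]
    have hp1 : S.param t₁ = 0 := by rw [ht1, S.param_zero]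
    have ha : C.ang z < 2 * Real.pi := by linarith [(abs_lt.1 hang).2]
    refine mem_burned_of_norm_lt hg ht0 ?_
    have hA : S.wound (C.ang z) < C.time z := by linarith
    rw [C.eq_tip z hzC, tip, S.anchor_of_lt ha, zero_add, norm_mul_dir, abs_of_pos (by linarith),
      S.wound_of_lt ha]
    linarith
  · have hσ : 0 < min (β / 8) ((t₁ - S.wound (S.param t₁)) / 2) :=
      lt_min (by linarith) (by linarith)
    have hσ1 := min_le_left (β / 8) ((t₁ - S.wound (S.param t₁)) / 2)
    have hσ2 := min_le_right (β / 8) ((t₁ - S.wound (S.param t₁)) / 2)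
    rw [C.eq_tip z hzC]
    refine tip_mem_burned ht.2.le ht.1 he hlast (by linarith) hnn hσ (by linarith) (by linarith)
      fun u hu => ?_
    rw [← C.eq_tip z hzC]
    -- neither a point of the spiral nor a later point of the barrier lies on the way to `z`
    rcases le_or_gt u (t₁ - κ) with h | h
    · right
      have h0 : 0 < t₁ := by linarith [hu.1]
      obtain ⟨h1, h2⟩ := hδ h0 _ hang
      have h3 := hfar u ⟨hu.1, h⟩
      rw [← he ⟨hu.1, by linarith⟩, hc1] at h3
      have h4 := norm_sub_le_norm_sub_add_norm_sub (g u) z (S.tip (S.param t₁) t₁)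
      rw [norm_sub_rev (g u) z] at h4
      exact ⟨by linarith, ⟨h1, hlast⟩, by linarith [htm.2]⟩
    · left
      have h1 := hLB u ⟨hu.1, by linarith [hu.2, htm.2]⟩ t ⟨ht0, by linarith [htm.2]⟩
        (abs_lt.2 ⟨by linarith, by linarith [hu.2, htm.2]⟩)
        (abs_lt.2 ⟨by linarith [htm.1], by linarith [htm.2]⟩)
      rw [abs_of_nonneg (by linarith [hu.2])] at h1
      have h2 := norm_sub_le_norm_sub_add_norm_sub (g t) z (g u)
      rw [norm_sub_rev (g t) z] at h2
      linarith

end Front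

end StringSpiral

/-! ### Uniqueness of the barrier curve -/

theorem norm_sq_eq_proj (θ : ℝ) (z : ℂ) :
    ‖z‖ ^ 2 = proj θ z ^ 2 + proj (θ + Real.pi / 2) z ^ 2 := by
  rw [Complex.sq_norm, Complex.normSq_apply, proj, proj, Real.cos_add_pi_div_two,
    Real.sin_add_pi_div_two]
  linear_combination (-(z.re * z.re) - z.im * z.im) * Real.sin_sq_add_cos_sq θ

theorem eq_of_proj_eq {θ : ℝ} {z w : ℂ} (h1 : proj θ z = proj θ w)
    (h2 : proj (θ + Real.pi / 2) z = proj (θ + Real.pi / 2) w) : z = w := by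
  have h := eq_proj_mul_dir (θ := θ) (z := z - w) (by rw [proj_sub, h2, sub_self])
  rw [proj_sub, h1, sub_self, Complex.ofReal_zero, zero_mul] at h
  exact sub_eq_zero.1 h

theorem norm_dir_sub_dir_le_abs (x y : ℝ) : ‖dir x - dir y‖ ≤ |x - y| := by
  rcases le_total x y with h | h
  · rw [norm_sub_rev, abs_sub_comm, abs_of_nonneg (sub_nonneg.2 h)]
    exact norm_dir_sub_dir_le h
  · rw [abs_of_nonneg (sub_nonneg.2 h)]
    exact norm_dir_sub_dir_le h

namespace StringSpiral

variable {A α : ℝ} {S : StringSpiral A α} {v T t₁ : ℝ} {g : ℝ → ℂ}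

theorem Chart.lipschitzOnWith_dir_ang {φ₀ D₀ δ : ℝ} (C : S.Chart φ₀ D₀ δ)
    (hD : S.wound φ₀ < D₀) (hδ : δ ≤ 1 / 2) (hr : C.radius ≤ (D₀ - S.wound φ₀) / 4) (hv : 0 < v) :
    ∃ K, LipschitzOnWith K (fun z => (v : ℂ) * dir (C.ang z + α))
      (Metric.ball (S.tip φ₀ D₀) C.radius) := by
  obtain ⟨K, hK, h⟩ := C.exists_abs_ang_sub_le hD hδ hr
  refine ⟨(v * K).toNNReal, LipschitzOnWith.of_dist_le_mul fun z hz z' hz' => ?_⟩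
  rw [mem_ball_iff_norm] at hz hz'
  rw [dist_eq_norm, dist_eq_norm, ← mul_sub, norm_mul, Complex.norm_real, Real.norm_eq_abs,
    abs_of_pos hv, Real.coe_toNNReal _ (by positivity), mul_assoc]
  refine mul_le_mul_of_nonneg_left ((norm_dir_sub_dir_le_abs _ _).trans ?_) hv.le
  rw [add_sub_add_right_eq_sub]
  exact h z z' hz hz'

theorem Chart.continuousOn_ang {φ₀ D₀ δ : ℝ} (C : S.Chart φ₀ D₀ δ)
    (hD : S.wound φ₀ < D₀) (hδ : δ ≤ 1 / 2) (hr : C.radius ≤ (D₀ - S.wound φ₀) / 4) :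
    ContinuousOn C.ang (Metric.ball (S.tip φ₀ D₀) C.radius) := by
  obtain ⟨K, hK, h⟩ := C.exists_abs_ang_sub_le hD hδ hr
  refine (LipschitzOnWith.of_dist_le_mul (K := K.toNNReal) fun z hz z' hz' => ?_).continuousOn
  rw [mem_ball_iff_norm] at hz hz'
  rw [Real.dist_eq, dist_eq_norm, Real.coe_toNNReal K hK.le]
  exact h z z' hz hz'

/-- The velocity of a barrier curve that agrees with the spiral until time `t₁` points at that time
to the left of the string. -/
theorem proj_derivWithin_pos (hg : IsFFCurve A v T g) (hT : t₁ < T)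
    (ht : t₁ ∈ Set.Ico 0 S.endTime) (he : Set.EqOn g S.curve (Set.Icc 0 t₁)) :
    0 < proj (S.param t₁ + Real.pi / 2) (derivWithin g (Set.Icc 0 T) t₁) := by
  rcases ht.1.lt_or_eq with h | h
  · have hm : t₁ ∈ Set.Icc 0 t₁ := ⟨h.le, le_rfl⟩
    have hd := (hg.smooth.differentiableOn one_ne_zero t₁ ⟨h.le, hT.le⟩).hasDerivWithinAt.mono
      (Set.Icc_subset_Icc_right hT.le)
    have hd' := ((S.hasDerivWithinAt_curve ⟨h.le, ht.2.le⟩).mono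
      (Set.Icc_subset_Icc_right ht.2.le)).congr he (he hm)
    rw [(uniqueDiffOn_Icc h t₁ hm).eq_deriv _ hd hd', cross_mul_dir, add_sub_cancel_left]
    exact mul_pos (one_div_pos.2 S.cos_pos) S.sin_pos
  · rw [← h, S.param_zero, zero_add, proj, Real.cos_pi_div_two, Real.sin_pi_div_two, mul_zero,
      zero_add, mul_one]
    exact hg.counterclockwise

/-- The velocity is determined by the string: its component along the string is `1`, its norm is `v`,
and it keeps pointing to the left of the string. -/
theorem derivWithin_eq_dir (hg : IsFFCurve A v T g) (hv : v * Real.cos α = 1) {δ : ℝ}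
    (hδ : δ ≤ 1 / 2) (C : S.Chart (S.param t₁) t₁ δ)
    (hr : C.radius ≤ (t₁ - S.wound (S.param t₁)) / 4) (ht : t₁ ∈ Set.Ico 0 S.endTime)
    (he : Set.EqOn g S.curve (Set.Icc 0 t₁)) {b : ℝ} (hb : t₁ < b) (hbT : b < T)
    (hmem : ∀ t ∈ Set.Icc t₁ b, ‖g t - S.tip (S.param t₁) t₁‖ < C.radius)
    (htime : ∀ t ∈ Set.Icc t₁ b, C.time (g t) = t) {t : ℝ} (htb : t ∈ Set.Icc t₁ b) :
    derivWithin g (Set.Icc 0 T) t = (v : ℂ) * dir (C.ang (g t) + α) := by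
  have hw := S.wound_param_lt ht
  have hu := uniqueDiffOn_Icc hg.pos
  have hd := (contDiffOn_one_iff_derivWithin hu).1 hg.smooth
  have hsub : Set.Icc t₁ b ⊆ Set.Icc 0 T := Set.Icc_subset_Icc ht.1 hbT.le
  have hv0 : 0 < v := pos_of_mul_pos_left (by rw [hv]; exact one_pos) S.cos_pos.le
  have h1 : ∀ s ∈ Set.Icc t₁ b, proj (C.ang (g s)) (derivWithin g (Set.Icc 0 T) s) = 1 :=
    fun s hs => C.proj_ang_eq_one hw hδ hr hb hs
      ((hd.1 s (hsub hs)).hasDerivWithinAt.mono hsub) hmem htime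
  set c : ℝ → ℝ := fun s =>
    proj (C.ang (g s) + Real.pi / 2) (derivWithin g (Set.Icc 0 T) s) with hc
  have h2 : ∀ s ∈ Set.Icc t₁ b, c s ^ 2 = (v * Real.sin α) ^ 2 := by
    intro s hs
    have h := norm_sq_eq_proj (C.ang (g s)) (derivWithin g (Set.Icc 0 T) s)
    rw [h1 s hs, hg.speed s (hsub hs)] at h
    have h3 := Real.sin_sq_add_cos_sq α
    calc c s ^ 2 = v ^ 2 - (v * Real.cos α) ^ 2 := by rw [hv, h]; ring
      _ = v ^ 2 * (Real.sin α ^ 2 + Real.cos α ^ 2) - (v * Real.cos α) ^ 2 := by rw [h3, mul_one]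
      _ = (v * Real.sin α) ^ 2 := by ring
  have h3 : 0 < v * Real.sin α := mul_pos hv0 S.sin_pos
  have hcont : ContinuousOn c (Set.Icc t₁ b) := by
    have ha : ContinuousOn (fun s => C.ang (g s)) (Set.Icc t₁ b) :=
      (C.continuousOn_ang hw hδ hr).comp (hd.1.continuousOn.mono hsub) fun s hs =>
        mem_ball_iff_norm.2 (hmem s hs)
    have hd2 := hd.2.mono hsub
    have hre := Complex.continuous_re.comp_continuousOn hd2
    have him := Complex.continuous_im.comp_continuousOn hd2
    have ha' := ha.add (continuousOn_const (c := Real.pi / 2))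
    exact (hre.mul (Real.continuous_cos.comp_continuousOn ha')).add
      (him.mul (Real.continuous_sin.comp_continuousOn ha'))
  have hstart : 0 < c t₁ := by
    have hm : t₁ ∈ Set.Icc t₁ b := ⟨le_rfl, hb.le⟩
    have e : g t₁ = S.tip (S.param t₁) t₁ := by
      rw [he ⟨ht.1, le_rfl⟩, S.curve_eq_tip ⟨ht.1, ht.2.le⟩]
    have ha : C.ang (g t₁) = S.param t₁ :=
      (C.eq_of_eq_tip hδ (hmem t₁ hm) (by
        rw [sub_self, abs_zero]
        exact (abs_nonneg _).trans_lt (C.ang_near _ C.center_mem)) (S.param_lt ht).le hw e).1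
    simp only [hc, ha]
    exact proj_derivWithin_pos hg (hb.trans hbT) ht he
  -- the velocity has no component `0` across the string, hence it stays on the left
  have hpos : 0 < c t := by
    by_contra hneg
    obtain ⟨s, hs, hs0⟩ := intermediate_value_Icc' htb.1
      (hcont.mono (Set.Icc_subset_Icc_right htb.2)) ⟨not_lt.1 hneg, hstart.le⟩
    have := h2 s ⟨hs.1, hs.2.trans htb.2⟩
    rw [hs0] at this
    nlinarith
  refine eq_of_proj_eq (θ := C.ang (g t)) ?_ ?_
  · rw [h1 t htb, proj_mul_dir, add_sub_cancel_left, hv]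
  · rw [cross_mul_dir, add_sub_cancel_left]
    exact (pow_left_inj₀ hpos.le h3.le two_ne_zero).1 (h2 t htb)

/-- A barrier curve that agrees with the spiral until time `t₁` solves, for a while after `t₁`, the
same differential equation as the spiral. -/
theorem exists_eqOn_extend (hg : IsFFCurve A v T g) (hv : v * Real.cos α = 1) (hT : t₁ < T)
    (ht : t₁ ∈ Set.Ico 0 S.endTime) (he : Set.EqOn g S.curve (Set.Icc 0 t₁)) :
    ∃ b > t₁, Set.EqOn g S.curve (Set.Icc 0 b) := by
  have hv0 : 0 < v := pos_of_mul_pos_left (by rw [hv]; exact one_pos) S.cos_pos.le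
  have hv1 : 1 < v := by
    rw [← hv]
    exact mul_lt_of_lt_one_right hv0 S.cos_lt_one
  have hv' : 1 / Real.cos α = v := by rw [← hv, mul_div_cancel_right₀ _ S.cos_pos.ne']
  have ht' : t₁ ∈ Set.Icc 0 S.endTime := ⟨ht.1, ht.2.le⟩
  have hw := S.wound_param_lt ht
  obtain ⟨δ, hδ, C, hr, ε, hε, hεT, hC⟩ := exists_chart_time_eq hg hv1 hT ht he
  have hδ0 : 0 < δ := (abs_nonneg _).trans_lt (C.ang_near _ C.center_mem)
  have e1 := S.curve_eq_tip ht'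
  have hc1 := S.continuousOn_curve t₁ ht'
  have hc2 := S.continuousOn_param t₁ ht'
  rw [Metric.continuousWithinAt_iff] at hc1 hc2
  obtain ⟨ε₁, hε₁, hc1⟩ := hc1 C.radius C.radius_pos
  obtain ⟨ε₂, hε₂, hc2⟩ := hc2 δ hδ0
  obtain ⟨d, hd, hm⟩ := exists_between (lt_min (lt_min hε hε₁) (lt_min hε₂ (sub_pos.2 ht.2)))
  have m1 := hm.trans_le ((min_le_left _ _).trans (min_le_left _ _))
  have m2 := hm.trans_le ((min_le_left _ _).trans (min_le_right _ _))
  have m3 := hm.trans_le ((min_le_right _ _).trans (min_le_left _ _))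
  have m4 := hm.trans_le ((min_le_right _ _).trans (min_le_right _ _))
  have hsubT : Set.Icc t₁ (t₁ + d) ⊆ Set.Icc 0 T := Set.Icc_subset_Icc ht.1 (by linarith)
  have hsubE : Set.Icc t₁ (t₁ + d) ⊆ Set.Icc 0 S.endTime :=
    Set.Icc_subset_Icc ht.1 (by linarith)
  have hmem : ∀ t ∈ Set.Icc t₁ (t₁ + d), ‖g t - S.tip (S.param t₁) t₁‖ < C.radius :=
    fun t htd => (hC t ⟨htd.1, by linarith [htd.2]⟩).1
  have htime : ∀ t ∈ Set.Icc t₁ (t₁ + d), C.time (g t) = t :=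
    fun t htd => (hC t ⟨htd.1, by linarith [htd.2]⟩).2
  have hdist : ∀ t ∈ Set.Icc t₁ (t₁ + d), dist t t₁ ≤ d := fun t htd => by
    rw [Real.dist_eq, abs_of_nonneg (by linarith [htd.1])]; linarith [htd.2]
  have hmem' : ∀ t ∈ Set.Icc t₁ (t₁ + d), ‖S.curve t - S.tip (S.param t₁) t₁‖ < C.radius := by
    intro t htd
    rw [← e1, ← dist_eq_norm]
    exact hc1 (hsubE htd) ((hdist t htd).trans_lt m2)
  have hang : ∀ t ∈ Set.Icc t₁ (t₁ + d), C.ang (S.curve t) = S.param t := by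
    intro t htd
    refine (C.eq_of_eq_tip hδ (hmem' t htd) ?_ (S.param_mem (hsubE htd)).2
      (S.wound_param_lt ⟨(hsubE htd).1, by linarith [htd.2]⟩) (S.curve_eq_tip (hsubE htd))).1
    rw [← Real.dist_eq]
    exact hc2 (hsubE htd) ((hdist t htd).trans_lt m3)
  obtain ⟨K, hK⟩ := C.lipschitzOnWith_dir_ang hw hδ hr hv0
  have hnhds : ∀ t ∈ Set.Ico t₁ (t₁ + d), ∀ c, t₁ + d ≤ c → Set.Icc 0 c ∈ nhdsWithin t (Set.Ici t) :=
    fun t htd c hc => Filter.mem_of_superset (Icc_mem_nhdsGE (htd.2.trans_le hc))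
      (Set.Icc_subset_Icc_left (ht.1.trans htd.1))
  have key := ODE_solution_unique_of_mem_Icc_right (a := t₁) (b := t₁ + d)
    (v := fun _ z => (v : ℂ) * dir (C.ang z + α)) (f := g) (g := S.curve)
    (s := fun _ => Metric.ball (S.tip (S.param t₁) t₁) C.radius) (fun _ _ => hK)
    (hg.smooth.continuousOn.mono hsubT) (fun t htd => ?_)
    (fun t htd => mem_ball_iff_norm.2 (hmem t ⟨htd.1, htd.2.le⟩))
    (S.continuousOn_curve.mono hsubE) (fun t htd => ?_)
    (fun t htd => mem_ball_iff_norm.2 (hmem' t ⟨htd.1, htd.2.le⟩)) (he ⟨ht.1, le_rfl⟩)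
  · refine ⟨t₁ + d, by linarith, fun t htd => ?_⟩
    rcases le_total t t₁ with h | h
    · exact he ⟨htd.1, h⟩
    · exact key ⟨h, htd.2⟩
  · have htd' : t ∈ Set.Icc t₁ (t₁ + d) := ⟨htd.1, htd.2.le⟩
    have := (hg.smooth.differentiableOn one_ne_zero t (hsubT htd')).hasDerivWithinAt
    rw [derivWithin_eq_dir hg hv hδ C hr ht he (b := t₁ + d) (by linarith) (by linarith) hmem htime
      htd'] at this
    exact this.mono_of_mem_nhdsWithin (hnhds t htd T (by linarith))
  · have htd' : t ∈ Set.Icc t₁ (t₁ + d) := ⟨htd.1, htd.2.le⟩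
    have := S.hasDerivWithinAt_curve (hsubE htd')
    rw [hv', ← hang t htd'] at this
    exact this.mono_of_mem_nhdsWithin (hnhds t htd S.endTime (by linarith))

theorem eqOn_curve (hg : IsFFCurve A v T g) (hv : v * Real.cos α = 1) :
    T ≤ S.endTime ∧ Set.EqOn g S.curve (Set.Icc 0 T) := by
  have hM : 0 < min T S.endTime := lt_min hg.pos S.endTime_pos
  have hgc : ContinuousOn g (Set.Icc 0 (min T S.endTime)) :=
    hg.smooth.continuousOn.mono (Set.Icc_subset_Icc_right (min_le_left _ _))
  have hcc : ContinuousOn S.curve (Set.Icc 0 (min T S.endTime)) :=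
    S.continuousOn_curve.mono (Set.Icc_subset_Icc_right (min_le_right _ _))
  have h0 : g 0 = S.curve 0 := by rw [hg.start, S.curve_zero]
  have key : Set.Icc 0 (min T S.endTime) ⊆ {t | Set.EqOn g S.curve (Set.Icc 0 t)} := by
    refine IsClosed.Icc_subset_of_forall_exists_gt (isClosed_of_closure_subset fun t ht => ?_)
      ?_ ?_
    · have htm : t ∈ Set.Icc 0 (min T S.endTime) :=
        closure_minimal Set.inter_subset_right isClosed_Icc ht
      refine ⟨?_, htm⟩
      rcases htm.1.lt_or_eq with h | h
      · have hlt : Set.EqOn g S.curve (Set.Ico 0 t) := by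
          intro u hu
          obtain ⟨t', ht', h1, -⟩ := mem_closure_iff.1 ht (Set.Ioi u) isOpen_Ioi hu.2
          exact h1 ⟨hu.1, (show u < t' from ht').le⟩
        exact hlt.of_subset_closure (hgc.mono (Set.Icc_subset_Icc_right htm.2))
          (hcc.mono (Set.Icc_subset_Icc_right htm.2)) Set.Ico_subset_Icc_self
          (closure_Ico h.ne).ge
      · rw [← h]
        rintro u ⟨h1, h2⟩
        rw [le_antisymm h2 h1]
        exact h0
    · rintro u ⟨h1, h2⟩
      rw [le_antisymm h2 h1]
      exact h0
    · rintro t ⟨ht, htm⟩ y hy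
      obtain ⟨b, hb, hbe⟩ := exists_eqOn_extend hg hv (htm.2.trans_le (min_le_left _ _))
        ⟨htm.1, htm.2.trans_le (min_le_right _ _)⟩ ht
      exact ⟨min b y, fun u hu => hbe ⟨hu.1, hu.2.trans (min_le_left _ _)⟩,
        lt_min hb hy, min_le_right _ _⟩
  have hEq := key ⟨hM.le, le_rfl⟩
  have hle : T ≤ S.endTime := by
    -- a simple curve cannot continue after the spiral has closed on itself
    by_contra hlt
    rw [not_le] at hlt
    rw [min_eq_right hlt.le] at hEq
    obtain ⟨u, hu, e⟩ := closesAt (S := S)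
    rw [← hEq ⟨hu.1, hu.2.le⟩, ← hEq ⟨S.endTime_pos.le, le_rfl⟩] at e
    have := hg.simple ⟨hu.1, hu.2.trans hlt⟩ ⟨S.endTime_pos.le, hlt⟩ e
    linarith [hu.2]
  rw [min_eq_left hle] at hEq
  exact ⟨hle, hEq⟩

end StringSpiral

/-- There is exactly one critical speed `v_c`, it is `2.6144...`, and for every speed `v > v_c` the
barrier curve `FF_v` exists until it closes on itself at some time `T`, and it then contains the
fire. The last clause says that this is the only such curve: every curve built in this way is an
initial piece of it. -/
theorem mainTheorem1 :
    ∃ vc : ℝ, IsCriticalSpeed vc ∧ 2.6144 ≤ vc ∧ vc < 2.6145 ∧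
      ∀ A v : ℝ, 0 < A → vc < v →
        ∃ (T : ℝ) (γ : ℝ → ℂ),
          IsFFCurve A v T γ ∧ ClosesAt γ T ∧ ContainsFire A γ T ∧
          ∀ (T' : ℝ) (γ' : ℝ → ℂ), IsFFCurve A v T' γ' →
            T' ≤ T ∧ Set.EqOn γ' γ (Set.Icc 0 T') := by
  obtain ⟨vc, hvc, h1, h2⟩ := exists_criticalSpeed
  refine ⟨vc, hvc, h1, h2, fun A v hA hv => ?_⟩
  have hv1 : 1 < v := hvc.1.trans hv
  have hα := arccos_one_div_mem hv1
  obtain ⟨S⟩ := exists_stringSpiral hA hα.1 hα.2 (hvc.speedRatio_lt hv)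
  have hcos : v * Real.cos (Real.arccos (1 / v)) = 1 := by
    rw [cos_arccos_one_div hv1, mul_one_div_cancel (by linarith)]
  exact ⟨S.endTime, S.curve, S.isFFCurve hcos, S.closesAt, S.containsFire,
    fun _ _ hg => S.eqOn_curve hg hcos⟩
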